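/- Let $p$ be an odd prime and $n\ge 0$ an integer. Let $k_n=\mathbb Q(\mu_{p^{n+1}})$, $G_n=\mathrm{Gal}(k_n/\mathbb Q)$, and let $I_n$ be the group of fractional ideals of $k_n$ prime to $p$. For an integer $t$ prime to $p$ let $\sigma_t\in G_n$ be the automorphism raising $p^{n+1}$-th roots of unity to the power $t$. Let $\Omega$ be the field generated over $\mathbb Q$ by all roots of unity of order prime to $p$; $G_n$ acts on $\Omega k_n$ through $\mathrm{Gal}(\Omega k_n/\Omega)\simeq G_n$. Multiplicative groups are regarded as $\mathbb Z[G_n]$-modules, written exponentially; for a homomorphism $f$ from $I_n$ to $k_n^*$ or $(\Omega k_n)^*$ and $\delta\in\mathbb Z[G_n]$ put $f^\delta(\mathfrak a)=f(\mathfrak a)^\delta$. The Weil module $\mathcal W_n$ is the set of all $f\in\mathrm{Hom}_{\mathbb Z[G_n]}(I_n,k_n^*)$ for which there is $\beta\in\mathbb Z[G_n]$ such that $f(\mathfrak a)\equiv\alpha^{\beta} \bmod \mu_{2p^{n+1}}$ whenever $\mathfrak a\in I_n$ and $\mathfrak a=(\alpha)$ with $\alpha\in k_n^*$. For every prime number $\ell\ne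 p$ fix a primitive $\ell$-th root of unity $\zeta_\ell$. For a prime $\mathfrak l$ of $k_n$ above $\ell$, with residue field $\mathbb F_q$, let $\chi_{\mathfrak l}$ be the character of $\mathbb F_q^*$ with values in $\mu_{p^{n+1}}$ such that $\chi_{\mathfrak l}(x)\equiv x^{-(q-1)/p^{n+1}} \bmod \mathfrak l$ (extended by $\chi_{\mathfrak l}(0)=0$), and let $\tau_n(\mathfrak l)=-\sum_{a\in\mathbb F_q}\chi_{\mathfrak l}(a)\,\zeta_\ell^{\mathrm{Tr}_{\mathbb F_q/\mathbb F_\ell}(a)}$. Extend $\tau_n$ multiplicatively to a homomorphism $I_n\to(\Omega k_n)^*$. The Jacobi module is $\mathcal J_n=\mathbb Z[G_n]\tau_n\cap\mathrm{Hom}_{\mathbb Z[G_n]}(I_n,k_n^*)$. Let $\theta_n=\frac1{p^{n+1}}\sum_{1\le a\le p^{n+1},\,(a,p)=1}a\,\sigma_a^{-1}\in\mathbb Q[G_n]$, let $\mathcal S_n'=\sum_{(t,p)=1}\mathbb Z[G_n](t-\sigma_t)$, where $t$ runs through the integers prime to $p$, and let $\mathcal S_n=\mathcal S_n'\theta_n$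 be the Stickelberger ideal. Then: (1) $\mathcal J_n\subset\mathcal W_n$. (2) For every $\delta\in\mathcal S_n'$ one has $\tau_n^\delta\in\mathcal J_n$, and there is an isomorphism of $\mathbb Z[G_n]$-modules $\mathcal J_n\to\mathcal S_n$ that sends $\tau_n^\delta$ to $\delta\theta_n$ for every $\delta\in\mathbb Z[G_n]$ with $\tau_n^\delta\in\mathcal J_n$. -/

import Mathlib

open NumberField

namespace WeilJacobi

section Lift

/-- `Ω`: the subfield generated by all roots of unity of order prime to `p`. -/
def primeToPField (p : ℕ) (L : Type*) [Field L] [CharZero L] : IntermediateField ℚ L :=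
  IntermediateField.adjoin ℚ {x : L | ∃ m : ℕ, m.Coprime p ∧ x ^ m = 1}

/-- The subfield generated by the `m`-th roots of unity. -/
def muField (m : ℕ) (L : Type*) [Field L] [CharZero L] : IntermediateField ℚ L :=
  IntermediateField.adjoin ℚ {x : L | x ^ m = 1}

variable {L : Type*} [Field L] [CharZero L]

theorem muField_mono {m k : ℕ} (h : m ∣ k) : muField m L ≤ muField k L := by
  apply IntermediateField.adjoin.mono
  rintro x (hx : x ^ m = 1)
  obtain ⟨c, rfl⟩ := h
  change x ^ (m * c) = 1
  rw [pow_mul, hx, one_pow]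

theorem exists_muField_of_mem {p : ℕ} {x : L} (hx : x ∈ primeToPField p L) :
    ∃ m : ℕ, m.Coprime p ∧ x ∈ muField m L := by
  induction hx using IntermediateField.adjoin_induction with
  | mem x hx =>
    obtain ⟨m, hm, h⟩ := hx
    exact ⟨m, hm, IntermediateField.subset_adjoin _ _ h⟩
  | algebraMap x => exact ⟨1, Nat.coprime_one_left p, IntermediateField.algebraMap_mem _ x⟩
  | add x y _ _ hx hy =>
    obtain ⟨m, hm, hx⟩ := hx
    obtain ⟨k, hk, hy⟩ := hy
    exact ⟨m * k, hm.mul_left hk, add_mem (muField_mono (Dvd.intro _ rfl) hx)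
      (muField_mono (Dvd.intro_left _ rfl) hy)⟩
  | mul x y _ _ hx hy =>
    obtain ⟨m, hm, hx⟩ := hx
    obtain ⟨k, hk, hy⟩ := hy
    exact ⟨m * k, hm.mul_left hk, mul_mem (muField_mono (Dvd.intro _ rfl) hx)
      (muField_mono (Dvd.intro_left _ rfl) hy)⟩
  | inv x _ hx =>
    obtain ⟨m, hm, hx⟩ := hx
    exact ⟨m, hm, inv_mem hx⟩

theorem exists_muField_of_forall_mem {p : ℕ} {ι : Type*} (s : Finset ι) (c : ι → L)
    (hc : ∀ i ∈ s, c i ∈ primeToPField p L) :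
    ∃ m : ℕ, m.Coprime p ∧ ∀ i ∈ s, c i ∈ muField m L := by
  classical
  induction s using Finset.induction_on with
  | empty => exact ⟨1, Nat.coprime_one_left p, by simp⟩
  | insert a s ha ih =>
    obtain ⟨m, hm, h⟩ := ih fun i hi => hc i (Finset.mem_insert_of_mem hi)
    obtain ⟨k, hk, h'⟩ := exists_muField_of_mem (hc a (Finset.mem_insert_self a s))
    refine ⟨m * k, hm.mul_left hk, fun i hi => ?_⟩
    rcases Finset.mem_insert.1 hi with rfl | hi
    · exact muField_mono (Dvd.intro_left _ rfl) h'
    · exact muField_mono (Dvd.intro _ rfl) (h i hi)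

theorem muField_isCyclotomic {m : ℕ} {μ : L} (h : IsPrimitiveRoot μ m) (hm : m ≠ 0) :
    IsCyclotomicExtension {m} ℚ (muField m L) := by
  have := IntermediateField.isCyclotomicExtension_adjoin_of_exists_isPrimitiveRoot {m} ℚ L
    (fun n hn _ => ⟨μ, by rw [Set.mem_singleton_iff] at hn; exact hn ▸ h⟩)
  have e : {b : L | ∃ n ∈ ({m} : Set ℕ), n ≠ 0 ∧ b ^ n = 1} = {x : L | x ^ m = 1} := by
    ext x; simp [hm]
  rw [e] at this
  exact this

theorem linearDisjoint_muField {q m : ℕ} {μ ν : L} (hq : IsPrimitiveRoot μ q) (hq0 : q ≠ 0)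
    (hm : IsPrimitiveRoot ν m) (hm0 : m ≠ 0) (hqm : q.Coprime m) :
    (muField q L).LinearDisjoint (muField m L) := by
  have h3 : NeZero q := ⟨hq0⟩
  have h4 : NeZero m := ⟨hm0⟩
  have c1 := muField_isCyclotomic hq hq0
  have d1 := IsCyclotomicExtension.finiteDimensional {q} ℚ (muField q L)
  have e1 := IsCyclotomicExtension.Rat.finrank q (muField q L)
  have c2 := muField_isCyclotomic hm hm0
  have d2 := IsCyclotomicExtension.finiteDimensional {m} ℚ (muField m L)
  have e2 := IsCyclotomicExtension.Rat.finrank m (muField m L)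
  apply IntermediateField.LinearDisjoint.of_finrank_sup
  have c3 := IntermediateField.isCyclotomicExtension_lcm_sup ℚ L q m (muField q L) (muField m L)
    (h₁ := c1) (h₂ := c2)
  rw [hqm.lcm_eq_mul] at c3
  have e3 := @IsCyclotomicExtension.Rat.finrank (q * m) ↥(muField q L ⊔ muField m L) _ _ _ c3
  rw [e1, e2, ← Nat.totient_mul hqm]
  exact e3

theorem irreducible_cyclotomic_primeToPField {p q : ℕ} (hpq : ∀ m : ℕ, m.Coprime p → q.Coprime m)
    (hroots : ∀ m : ℕ, m.Coprime p → m ≠ 0 → ∃ ν : L, IsPrimitiveRoot ν m)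
    (hp : p ≠ 1) {μ : L} (hμ : IsPrimitiveRoot μ q) (hq0 : q ≠ 0) :
    Irreducible (Polynomial.cyclotomic q (primeToPField p L)) := by
  have : NeZero q := ⟨hq0⟩
  have hcyc := muField_isCyclotomic hμ hq0
  have hfd := IsCyclotomicExtension.finiteDimensional {q} ℚ (muField q L)
  let ζ : muField q L := ⟨μ, IntermediateField.subset_adjoin _ _ hμ.pow_eq_one⟩
  have hζ : IsPrimitiveRoot ζ q := IsPrimitiveRoot.coe_submonoidClass_iff.mp hμ
  have hdeg : (minpoly ℚ ζ).natDegree = q.totient := by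
    rw [← Polynomial.cyclotomic_eq_minpoly_rat hζ (Nat.pos_of_ne_zero hq0),
      Polynomial.natDegree_cyclotomic]
  have hli0 : LinearIndependent ℚ fun i : Fin q.totient => ζ ^ (i : ℕ) := by
    rw [← hdeg]; exact linearIndependent_pow ζ
  have hli : LinearIndependent (primeToPField p L) fun i : Fin q.totient => μ ^ (i : ℕ) := by
    rw [Fintype.linearIndependent_iff]
    intro g hg
    obtain ⟨m, hm, h⟩ := exists_muField_of_forall_mem (p := p) Finset.univ
      (fun i => (g i : L)) (fun i _ => (g i).2)
    have hm0 : m ≠ 0 := by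
      rintro rfl
      exact hp ((Nat.coprime_zero_left p).1 hm)
    obtain ⟨ν, hν⟩ := hroots m hm hm0
    have hd := (linearDisjoint_muField hμ hq0 hν hm0 (hpq m hm)).linearIndependent_left hli0
    rw [Fintype.linearIndependent_iff] at hd
    have := hd (fun i => ⟨g i, h i (Finset.mem_univ i)⟩) (by
      rw [← hg]
      exact Finset.sum_congr rfl fun i _ => by
        rw [Algebra.smul_def, Algebra.smul_def]; rfl)
    intro i
    have := congrArg (fun x : muField m L => (x : L)) (this i)
    exact Subtype.ext this
  have hint : IsIntegral (primeToPField p L) μ := hμ.isIntegral (Nat.pos_of_ne_zero hq0) |>.tower_top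
  have hdvd : minpoly (primeToPField p L) μ ∣ Polynomial.cyclotomic q (primeToPField p L) := by
    apply minpoly.dvd
    rw [Polynomial.aeval_def, ← Polynomial.eval_map, Polynomial.map_cyclotomic,
      ← Polynomial.IsRoot.def]
    exact hμ.isRoot_cyclotomic (Nat.pos_of_ne_zero hq0)
  have hle : q.totient ≤ (minpoly (primeToPField p L) μ).natDegree := by
    by_contra hlt
    push Not at hlt
    have h0 := minpoly.aeval (primeToPField p L) μ
    rw [Polynomial.aeval_eq_sum_range' hlt, ← Fin.sum_univ_eq_sum_range
      (fun i => (minpoly (primeToPField p L) μ).coeff i • μ ^ i)] at h0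
    have := (Fintype.linearIndependent_iff.1 hli) _ h0 ⟨_, hlt⟩
    exact minpoly.ne_zero hint (Polynomial.leadingCoeff_eq_zero.1 this)
  have heq : minpoly (primeToPField p L) μ = Polynomial.cyclotomic q (primeToPField p L) :=
    (Polynomial.eq_of_monic_of_dvd_of_natDegree_le (minpoly.monic hint)
      (Polynomial.cyclotomic.monic _ _) hdvd (by rwa [Polynomial.natDegree_cyclotomic])).symm
  rw [← heq]
  exact minpoly.irreducible hint

end Lift

section GaloisLift

variable (p : ℕ) [hp : Fact p.Prime] (n : ℕ) (K L : Type*) [Field K] [NumberField K]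
  [IsCyclotomicExtension {p ^ (n + 1)} ℚ K] [Field L] [CharZero L] [Algebra K L]
  [IsCyclotomicExtension {m : ℕ | m.Coprime p} K L]

theorem exists_isPrimitiveRoot_big (p : ℕ) [hp : Fact p.Prime] (n : ℕ) (K L : Type*)
    [Field K] [NumberField K] [IsCyclotomicExtension {p ^ (n + 1)} ℚ K] [Field L] [Algebra K L] : ∃ μ : L, IsPrimitiveRoot μ (p ^ (n + 1)) :=
  ⟨_, (IsCyclotomicExtension.zeta_spec (p ^ (n + 1)) ℚ K).map_of_injective
    (algebraMap K L).injective⟩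

theorem irreducible_cyclotomic_big
    (p : ℕ) [hp : Fact p.Prime] (n : ℕ) (K L : Type*) [Field K] [NumberField K]
    [IsCyclotomicExtension {p ^ (n + 1)} ℚ K] [Field L] [CharZero L] [Algebra K L]
    [IsCyclotomicExtension {m : ℕ | m.Coprime p} K L] :
    Irreducible (Polynomial.cyclotomic (p ^ (n + 1)) (primeToPField p L)) := by
  obtain ⟨μ, hμ⟩ := exists_isPrimitiveRoot_big p n K L
  exact irreducible_cyclotomic_primeToPField (fun m hm => (hm.pow_right _).symm)
    (fun m hm hm0 => IsCyclotomicExtension.exists_isPrimitiveRoot K L (S := {m : ℕ | m.Coprime p}) hm hm0)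
    hp.out.ne_one hμ (NeZero.ne _)

theorem isCyclotomicExtension_big
    (p : ℕ) [hp : Fact p.Prime] (n : ℕ) (K L : Type*) [Field K] [NumberField K]
    [IsCyclotomicExtension {p ^ (n + 1)} ℚ K] [Field L] [CharZero L] [Algebra K L]
    [IsCyclotomicExtension {m : ℕ | m.Coprime p} K L] :
    IsCyclotomicExtension {p ^ (n + 1)} (primeToPField p L) L := by
  obtain ⟨μ, hμ⟩ := exists_isPrimitiveRoot_big p n K L
  rw [IsCyclotomicExtension.iff_adjoin_eq_top]
  refine ⟨?_, ?_⟩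
  · rintro m hm -
    rw [Set.mem_singleton_iff] at hm
    exact ⟨μ, hm ▸ hμ⟩
  set A := Algebra.adjoin (primeToPField p L)
    {b : L | ∃ m ∈ ({p ^ (n + 1)} : Set ℕ), m ≠ 0 ∧ b ^ m = 1} with hA
  have hK : ∀ x : K, algebraMap K L x ∈ A := by
    intro x
    have hx := IsCyclotomicExtension.adjoin_roots (S := {p ^ (n + 1)}) (A := ℚ) (B := K) x
    induction hx using Algebra.adjoin_induction with
    | mem x hx =>
      obtain ⟨m, hm, hm0, hx⟩ := hx
      exact Algebra.subset_adjoin ⟨m, hm, hm0, by rw [← map_pow, hx, map_one]⟩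
    | algebraMap r =>
      rw [← IsScalarTower.algebraMap_apply ℚ K L,
        IsScalarTower.algebraMap_apply ℚ (primeToPField p L) L]
      exact A.algebraMap_mem _
    | add x y _ _ hx hy => rw [map_add]; exact add_mem hx hy
    | mul x y _ _ hx hy => rw [map_mul]; exact mul_mem hx hy
  rw [eq_top_iff]
  rintro x -
  have hx := IsCyclotomicExtension.adjoin_roots (S := {m : ℕ | m.Coprime p}) (A := K) (B := L) x
  induction hx using Algebra.adjoin_induction with
  | mem x hx =>
    obtain ⟨m, hm, hm0, hx⟩ := hx
    have : x ∈ primeToPField p L := IntermediateField.subset_adjoin _ _ ⟨m, hm, hx⟩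
    exact A.algebraMap_mem ⟨x, this⟩
  | algebraMap r => exact hK r
  | add x y _ _ hx hy => exact add_mem hx hy
  | mul x y _ _ hx hy => exact mul_mem hx hy

/-- The isomorphism `Gal(K/ℚ) ≃ Gal(L/Ω)`, inverse to restriction: the automorphism of `K` that
raises the `p ^ (n + 1)`-th roots of unity to the power `a` goes to the automorphism of
`L = Ω K` that fixes `Ω` and raises them to the same power. -/
noncomputable def galLift : Gal(K/ℚ) ≃* Gal(L/primeToPField p L) :=
  have := isCyclotomicExtension_big p n K L
  (IsCyclotomicExtension.Rat.galEquivZMod (p ^ (n + 1)) K).trans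
    (IsCyclotomicExtension.autEquivPow L (irreducible_cyclotomic_big p n K L)).symm

theorem galLift_algebraMap (σ : Gal(K/ℚ)) (x : K) :
    galLift p n K L σ (algebraMap K L x) = algebraMap K L (σ x) := by
  have hx := IsCyclotomicExtension.adjoin_roots (S := {p ^ (n + 1)}) (A := ℚ) (B := K) x
  have hc := isCyclotomicExtension_big p n K L
  induction hx using Algebra.adjoin_induction with
  | mem x hx =>
    obtain ⟨m, hm, hm0, hx⟩ := hx
    rw [Set.mem_singleton_iff] at hm
    subst hm
    have h1 := IsCyclotomicExtension.Rat.galEquivZMod_apply_of_pow_eq (p ^ (n + 1)) K σ hx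
    have hz := IsCyclotomicExtension.zeta_spec (p ^ (n + 1)) (primeToPField p L) L
    have h2 := hz.autToPow_spec (primeToPField p L) (galLift p n K L σ)
    have h3 : (hz.autToPow (primeToPField p L) (galLift p n K L σ)) =
        IsCyclotomicExtension.Rat.galEquivZMod (p ^ (n + 1)) K σ :=
      (IsCyclotomicExtension.autEquivPow L (irreducible_cyclotomic_big p n K L)).apply_symm_apply _
    have hx' : (algebraMap K L x) ^ (p ^ (n + 1)) = 1 := by rw [← map_pow, hx, map_one]
    obtain ⟨i, -, hi⟩ := hz.eq_pow_of_pow_eq_one hx'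
    rw [h1, map_pow, ← hi, map_pow, ← h2, h3, pow_right_comm]
  | algebraMap r =>
    rw [AlgEquiv.commutes, ← IsScalarTower.algebraMap_apply ℚ K L,
      IsScalarTower.algebraMap_apply ℚ (primeToPField p L) L, AlgEquiv.commutes]
  | add x y _ _ hx hy => simp only [map_add, hx, hy]
  | mul x y _ _ hx hy => simp only [map_mul, hx, hy]

end GaloisLift

section Ideals

open scoped nonZeroDivisors

/-- The group of fractional ideals of `K` prime to `p`: the subgroup of the group of all nonzero
fractional ideals generated by the integral ideals that are coprime to `p`. -/
noncomputable def idealGroup (p : ℕ) (K : Type*) [Field K] [NumberField K] :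
    Subgroup (FractionalIdeal (𝓞 K)⁰ K)ˣ :=
  Subgroup.closure {I | ∃ 𝔞 : Ideal (𝓞 K), IsCoprime 𝔞 (Ideal.span {(p : 𝓞 K)}) ∧
    (I : FractionalIdeal (𝓞 K)⁰ K) = (𝔞 : FractionalIdeal (𝓞 K)⁰ K)}

variable (p : ℕ) {K : Type*} [Field K] [NumberField K]

/-- The action of `σ ∈ Gal(K/ℚ)` on the group of fractional ideals, `I ↦ σ(I)`. -/
noncomputable def galFractionalIdeal (σ : Gal(K/ℚ)) :
    (FractionalIdeal (𝓞 K)⁰ K)ˣ →* (FractionalIdeal (𝓞 K)⁰ K)ˣ :=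
  Units.map (FractionalIdeal.ringEquivOfRingEquiv K K
    (RingOfIntegers.mapRingEquiv σ.toRingEquiv)).toRingHom.toMonoidHom

theorem mem_galFractionalIdeal (σ : Gal(K/ℚ)) (I : (FractionalIdeal (𝓞 K)⁰ K)ˣ) (x : K) :
    x ∈ (galFractionalIdeal σ I : FractionalIdeal (𝓞 K)⁰ K) ↔
      ∃ y ∈ (I : FractionalIdeal (𝓞 K)⁰ K), σ y = x := by
  have key : ∀ y : K, IsFractionRing.ringEquivOfRingEquiv (K := K) (L := K)
      (RingOfIntegers.mapRingEquiv σ.toRingEquiv) y = σ y := by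
    intro y
    obtain ⟨a, b, hb, rfl⟩ := IsFractionRing.div_surjective (A := 𝓞 K) y
    rw [map_div₀, map_div₀, IsFractionRing.ringEquivOfRingEquiv_algebraMap,
      IsFractionRing.ringEquivOfRingEquiv_algebraMap]
    rfl
  have h : x ∈ (galFractionalIdeal σ I : FractionalIdeal (𝓞 K)⁰ K) ↔
      ∃ y ∈ (I : FractionalIdeal (𝓞 K)⁰ K), IsFractionRing.ringEquivOfRingEquiv (K := K) (L := K)
      (RingOfIntegers.mapRingEquiv σ.toRingEquiv) y = x := Iff.rfl
  simpa only [key] using h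

theorem galFractionalIdeal_mem (σ : Gal(K/ℚ)) {I : (FractionalIdeal (𝓞 K)⁰ K)ˣ}
    (hI : I ∈ idealGroup p K) : galFractionalIdeal σ I ∈ idealGroup p K := by
  have h : idealGroup p K ≤ (idealGroup p K).comap (galFractionalIdeal σ) := by
    rw [idealGroup, Subgroup.closure_le]
    rintro J ⟨𝔞, h𝔞, hJ⟩
    apply Subgroup.subset_closure
    refine ⟨𝔞.map (RingOfIntegers.mapRingEquiv σ.toRingEquiv : 𝓞 K →+* 𝓞 K), ?_, ?_⟩
    · have := h𝔞.map (Ideal.mapHom (RingOfIntegers.mapRingEquiv σ.toRingEquiv : 𝓞 K →+* 𝓞 K))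
      simpa [Ideal.map_span] using this
    · ext x
      rw [mem_galFractionalIdeal, FractionalIdeal.mem_coeIdeal, hJ]
      constructor
      · rintro ⟨y, hy, rfl⟩
        obtain ⟨a, ha, rfl⟩ := (FractionalIdeal.mem_coeIdeal _).1 hy
        exact ⟨_, Ideal.mem_map_of_mem _ ha, rfl⟩
      · rintro ⟨b, hb, rfl⟩
        obtain ⟨a, ha, rfl⟩ := (Ideal.mem_map_of_equiv _ _).1 hb
        exact ⟨algebraMap (𝓞 K) K a, (FractionalIdeal.mem_coeIdeal _).2 ⟨a, ha, rfl⟩, rfl⟩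
  exact h hI

/-- The action of `σ ∈ Gal(K/ℚ)` on the group of fractional ideals prime to `p`. -/
noncomputable def galIdeal (σ : Gal(K/ℚ)) : idealGroup p K →* idealGroup p K :=
  ((galFractionalIdeal σ).comp (idealGroup p K).subtype).codRestrict (idealGroup p K)
    fun I => galFractionalIdeal_mem p σ I.2

end Ideals

section Modules

variable (p : ℕ) [hp : Fact p.Prime] (n : ℕ) (K L : Type*) [Field K] [NumberField K]
  [IsCyclotomicExtension {p ^ (n + 1)} ℚ K] [Field L] [CharZero L] [Algebra K L]
  [IsCyclotomicExtension {m : ℕ | m.Coprime p} K L]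

/-- The multiplicative group of `K`, written additively, as a `ℤ[Gal(K/ℚ)]`-module. -/
abbrev UnitsModule (K : Type*) [Field K] [NumberField K] : Type _ :=
  (Representation.ofMulDistribMulAction Gal(K/ℚ) Kˣ).asModule

/-- The action of `Gal(K/ℚ)` on the multiplicative group of `L`, through
`Gal(K/ℚ) ≃ Gal(L/Ω)`. -/
noncomputable def bigUnitsRep : Representation ℤ Gal(K/ℚ) (Additive Lˣ) :=
  (Representation.ofMulDistribMulAction Gal(L/primeToPField p L) Lˣ).comp
    (galLift p n K L).toMonoidHom

/-- The multiplicative group of `L`, written additively, as a `ℤ[Gal(K/ℚ)]`-module. -/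
abbrev BigUnitsModule : Type _ := (bigUnitsRep p n K L).asModule

/-- The tautological isomorphism from `Kˣ`, written additively, to `UnitsModule K`. -/
noncomputable def toUnitsModule (K : Type*) [Field K] [NumberField K] :
    Additive Kˣ ≃+ UnitsModule K :=
  (Representation.asModuleEquiv _).symm.toAddEquiv

/-- The tautological isomorphism from `Lˣ`, written additively, to `BigUnitsModule p n K L`. -/
noncomputable def toBigUnitsModule : Additive Lˣ ≃+ BigUnitsModule p n K L :=
  (Representation.asModuleEquiv _).symm.toAddEquiv

/-- The inclusion `Kˣ → Lˣ` as a homomorphism of `ℤ[Gal(K/ℚ)]`-modules. -/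
noncomputable def unitsInclusion :
    UnitsModule K →ₗ[MonoidAlgebra ℤ Gal(K/ℚ)] BigUnitsModule p n K L :=
  MonoidAlgebra.equivariantOfLinearOfComm
    ((toBigUnitsModule p n K L).toAddMonoidHom.comp
      ((MonoidHom.toAdditive (Units.map (algebraMap K L : K →* L))).comp
        (toUnitsModule K).symm.toAddMonoidHom)).toIntLinearMap (by
      intro σ v
      rw [Representation.single_smul, Representation.single_smul, one_smul, one_smul]
      apply congrArg (toBigUnitsModule p n K L)
      apply Additive.toMul.injective
      apply Units.ext
      exact (galLift_algebraMap p n K L σ _).symm)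

/-- The group `Hom(I, Kˣ)` of all homomorphisms from the group `I` of fractional ideals prime to
`p`. It is a `ℤ[Gal(K/ℚ)]`-module with `(δ • f) 𝔞 = δ • f 𝔞`. -/
abbrev HomSmall : Type _ := Additive (idealGroup p K) →+ UnitsModule K

/-- The group `Hom(I, Lˣ)`. It is a `ℤ[Gal(K/ℚ)]`-module with `(δ • f) 𝔞 = δ • f 𝔞`. -/
abbrev HomBig : Type _ := Additive (idealGroup p K) →+ BigUnitsModule p n K L

/-- The inclusion `Hom(I, Kˣ) → Hom(I, Lˣ)`. -/
noncomputable def homInclusion :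
    HomSmall p K →ₗ[MonoidAlgebra ℤ Gal(K/ℚ)] HomBig p n K L where
  toFun f := (unitsInclusion p n K L).toAddMonoidHom.comp f
  map_add' f g := by ext a; exact map_add (unitsInclusion p n K L) _ _
  map_smul' δ f := by ext a; exact map_smul (unitsInclusion p n K L) δ _

/-- `Hom_{ℤ[G]}(I, Kˣ)`: the homomorphisms that commute with the action of `G = Gal(K/ℚ)`. -/
noncomputable def equivariantHom : Submodule (MonoidAlgebra ℤ Gal(K/ℚ)) (HomSmall p K) where
  carrier := {f | ∀ (σ : Gal(K/ℚ)) (𝔞 : idealGroup p K),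
    f (Additive.ofMul (galIdeal p σ 𝔞)) =
      MonoidAlgebra.single σ (1 : ℤ) • f (Additive.ofMul 𝔞)}
  zero_mem' σ 𝔞 := (smul_zero _).symm
  add_mem' {f g} hf hg σ 𝔞 := by
    rw [AddMonoidHom.add_apply, AddMonoidHom.add_apply, hf, hg, smul_add]
  smul_mem' δ f hf σ 𝔞 := by
    have hc := IsCyclotomicExtension.isMulCommutative {p ^ (n + 1)} ℚ K
    rw [AddMonoidHom.smul_apply, AddMonoidHom.smul_apply, hf, ← mul_smul, ← mul_smul]
    congr 1
    induction δ using MonoidAlgebra.induction_on with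
    | of τ =>
      rw [MonoidAlgebra.of_apply, MonoidAlgebra.single_mul_single,
        MonoidAlgebra.single_mul_single, mul_comm' τ σ]
    | add x y hx hy => rw [add_mul, mul_add, hx, hy]
    | smul r x hx => rw [smul_mul_assoc, mul_smul_comm, hx]

theorem mem_rootsOfUnity_iff (k : ℕ) (x : UnitsModule K) :
    ((toUnitsModule K).symm x).toMul ∈ rootsOfUnity k K ↔ k • x = 0 := by
  rw [mem_rootsOfUnity, ← toMul_nsmul, ← map_nsmul, toMul_eq_one,
    EmbeddingLike.map_eq_zero_iff]

/-- The Weil module: the `f` in `Hom_{ℤ[G]}(I, Kˣ)` for which there is a `β` in `ℤ[G]` such that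
`f(𝔞) ≡ α ^ β` modulo the roots of unity of order dividing `2 p ^ (n + 1)` whenever `𝔞 = (α)`. -/
noncomputable def weilModule : Submodule (MonoidAlgebra ℤ Gal(K/ℚ)) (HomSmall p K) where
  carrier := {f | f ∈ equivariantHom p n K ∧ ∃ β : MonoidAlgebra ℤ Gal(K/ℚ),
    ∀ (𝔞 : idealGroup p K) (α : Kˣ), toPrincipalIdeal (𝓞 K) K α = 𝔞 →
      ((toUnitsModule K).symm (f (Additive.ofMul 𝔞) -
        β • toUnitsModule K (Additive.ofMul α))).toMul ∈ rootsOfUnity (2 * p ^ (n + 1)) K}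
  zero_mem' := ⟨zero_mem _, 0, fun 𝔞 α _ => by simp⟩
  add_mem' := by
    rintro f g ⟨hf, β, hβ⟩ ⟨hg, γ, hγ⟩
    refine ⟨add_mem hf hg, β + γ, fun 𝔞 α h => ?_⟩
    rw [AddMonoidHom.add_apply, add_smul, add_sub_add_comm, map_add, toMul_add]
    exact mul_mem (hβ 𝔞 α h) (hγ 𝔞 α h)
  smul_mem' := by
    rintro δ f ⟨hf, β, hβ⟩
    refine ⟨Submodule.smul_mem _ δ hf, δ * β, fun 𝔞 α h => ?_⟩
    have := hβ 𝔞 α h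
    rw [mem_rootsOfUnity_iff] at this ⊢
    rw [AddMonoidHom.smul_apply, mul_smul δ β, ← smul_sub, smul_comm, this, smul_zero]

end Modules

section GaussSums

open IsDedekindDomain

variable {K : Type*} [Field K] [NumberField K]

noncomputable local instance residueField (v : HeightOneSpectrum (𝓞 K)) :
    Field (𝓞 K ⧸ v.asIdeal) :=
  Ideal.Quotient.field v.asIdeal

noncomputable local instance residueFintype (v : HeightOneSpectrum (𝓞 K)) :
    Fintype (𝓞 K ⧸ v.asIdeal) :=
  Fintype.ofFinite _

theorem natCast_residue_ne_zero {K : Type*} [Field K] {p : ℕ} (v : HeightOneSpectrum (𝓞 K))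
    (hv : (p : 𝓞 K) ∉ v.asIdeal) : (p : 𝓞 K ⧸ v.asIdeal) ≠ 0 := by
  rw [← map_natCast (Ideal.Quotient.mk v.asIdeal), ne_eq, Ideal.Quotient.eq_zero_iff_mem]
  exact hv

theorem absNorm_coprime {p : ℕ} (hp : p.Prime) (n : ℕ) (v : HeightOneSpectrum (𝓞 K))
    (hv : (p : 𝓞 K) ∉ v.asIdeal) : (Ideal.absNorm v.asIdeal).Coprime (p ^ (n + 1)) := by
  apply Nat.Coprime.pow_right
  rw [Nat.coprime_comm, Nat.Prime.coprime_iff_not_dvd hp]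
  intro h
  rw [Ideal.absNorm_apply, Submodule.cardQuot_apply] at h
  have : Fact p.Prime := ⟨hp⟩
  obtain ⟨x, hx⟩ := exists_prime_addOrderOf_dvd_card' (G := 𝓞 K ⧸ v.asIdeal) p h
  have h0 : (p : 𝓞 K ⧸ v.asIdeal) * x = 0 := by
    rw [← nsmul_eq_mul, ← hx, addOrderOf_nsmul_eq_zero]
  rcases mul_eq_zero.1 h0 with h1 | h1
  · exact natCast_residue_ne_zero v hv h1
  · rw [h1, addOrderOf_zero] at hx
    exact hp.ne_one hx.symm

variable (p : ℕ) [hp : Fact p.Prime] (n : ℕ) [IsCyclotomicExtension {p ^ (n + 1)} ℚ K]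

theorem exists_residue_root (v : HeightOneSpectrum (𝓞 K)) (hv : (p : 𝓞 K) ∉ v.asIdeal) :
    ∃ ζ : 𝓞 K, IsPrimitiveRoot ζ (p ^ (n + 1)) ∧
      IsPrimitiveRoot (Ideal.Quotient.mk v.asIdeal ζ) (p ^ (n + 1)) ∧
      p ^ (n + 1) ∣ Nat.card (𝓞 K ⧸ v.asIdeal) - 1 := by
  have hζ := (IsCyclotomicExtension.zeta_spec (p ^ (n + 1)) ℚ K).toInteger_isPrimitiveRoot
  have h := hζ.idealQuotient_mk (I := v.asIdeal)
    (Ideal.absNorm_eq_one_iff.not.2 v.isPrime.ne_top) (absNorm_coprime hp.out n v hv)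
  refine ⟨_, hζ, h, ?_⟩
  have hu := h.isUnit_unit (NeZero.ne _)
  have := orderOf_dvd_natCard (h.isUnit (NeZero.ne _)).unit
  rwa [← hu.eq_orderOf, Nat.card_units] at this

/-- The residue field at a prime `v ∤ p` carries exactly one multiplicative character `χ` with
values in `𝓞 K` such that, for all units `x`, `χ x` is a `p ^ (n + 1)`-th root of unity that is
congruent to `x ^ (-(q - 1) / p ^ (n + 1))` modulo `v`, where `q` is the number of elements of the
residue field. -/
theorem existsUnique_residueChar (v : HeightOneSpectrum (𝓞 K)) (hv : (p : 𝓞 K) ∉ v.asIdeal) :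
    ∃! χ : MulChar (𝓞 K ⧸ v.asIdeal) (𝓞 K), ∀ x : (𝓞 K ⧸ v.asIdeal)ˣ,
      χ x ^ p ^ (n + 1) = 1 ∧ Ideal.Quotient.mk v.asIdeal (χ x) =
        ((x⁻¹ ^ ((Nat.card (𝓞 K ⧸ v.asIdeal) - 1) / p ^ (n + 1)) : (𝓞 K ⧸ v.asIdeal)ˣ) :
          𝓞 K ⧸ v.asIdeal) := by
  obtain ⟨ζ, hζ, hζ', hd⟩ := exists_residue_root p n v hv
  set k := (Nat.card (𝓞 K ⧸ v.asIdeal) - 1) / p ^ (n + 1) with hk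
  have hinj := Ideal.rootsOfUnityMapQuot_injective (I := v.asIdeal) (p ^ (n + 1))
    (Ideal.absNorm_eq_one_iff.not.2 v.isPrime.ne_top) (absNorm_coprime hp.out n v hv)
  set φ := Ideal.rootsOfUnityMapQuot v.asIdeal (p ^ (n + 1)) with hφ
  let w : (𝓞 K ⧸ v.asIdeal)ˣ →* (𝓞 K ⧸ v.asIdeal)ˣ := (powMonoidHom k).comp invMonoidHom
  have hw : ∀ x, w x = x⁻¹ ^ k := fun x => rfl
  have hr : ∀ x, w x ∈ φ.range := by
    intro x
    have h1 : (w x : 𝓞 K ⧸ v.asIdeal) ^ p ^ (n + 1) = 1 := by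
      rw [← Units.val_pow_eq_pow_val, hw, ← pow_mul, Nat.div_mul_cancel hd, ← Nat.card_units,
        pow_card_eq_one', Units.val_one]
    obtain ⟨i, -, hi⟩ := hζ'.eq_pow_of_pow_eq_one h1
    refine ⟨hζ.toRootsOfUnity ^ i, Units.ext ?_⟩
    rw [← hi, map_pow, Units.val_pow_eq_pow_val]
    rfl
  let χ₀ : (𝓞 K ⧸ v.asIdeal)ˣ →* (𝓞 K)ˣ := (rootsOfUnity (p ^ (n + 1)) (𝓞 K)).subtype.comp
    ((MonoidHom.ofInjective hinj).symm.toMonoidHom.comp (w.codRestrict φ.range hr))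
  have hχ₀ : ∀ x, (χ₀ x) ^ p ^ (n + 1) = 1 := fun x =>
    ((MonoidHom.ofInjective hinj).symm ⟨w x, hr x⟩).2
  have hχ₀' : ∀ x, Ideal.Quotient.mk v.asIdeal (χ₀ x) = w x := by
    intro x
    have := (MonoidHom.ofInjective hinj).apply_symm_apply ⟨w x, hr x⟩
    exact congrArg (fun y : φ.range => ((y : (𝓞 K ⧸ v.asIdeal)ˣ) : 𝓞 K ⧸ v.asIdeal)) this
  refine ⟨MulChar.ofUnitHom χ₀, fun x => ?_, fun χ hχ => ?_⟩
  · rw [MulChar.ofUnitHom_coe]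
    exact ⟨by rw [← Units.val_pow_eq_pow_val, hχ₀, Units.val_one], hχ₀' x⟩
  · apply MulChar.ext
    intro x
    rw [MulChar.ofUnitHom_coe]
    obtain ⟨i, hi, h1⟩ := hζ.eq_pow_of_pow_eq_one (hχ x).1
    obtain ⟨j, hj, h2⟩ := hζ.eq_pow_of_pow_eq_one
      (by rw [← Units.val_pow_eq_pow_val, hχ₀, Units.val_one] :
        (χ₀ x : 𝓞 K) ^ p ^ (n + 1) = 1)
    have h3 : Ideal.Quotient.mk v.asIdeal ζ ^ i = Ideal.Quotient.mk v.asIdeal ζ ^ j := by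
      rw [← map_pow, ← map_pow, h1, h2, (hχ x).2, hχ₀' x, hw]
    rw [← h1, ← h2, hζ'.pow_inj hi hj h3]

/-- The character `χ_v` of the residue field at a prime `v ∤ p`: the one with
`χ_v x ≡ x ^ (-(q - 1) / p ^ (n + 1))` modulo `v`, with values in the `p ^ (n + 1)`-th roots of
unity. -/
noncomputable def residueChar (v : HeightOneSpectrum (𝓞 K)) (hv : (p : 𝓞 K) ∉ v.asIdeal) :
    MulChar (𝓞 K ⧸ v.asIdeal) (𝓞 K) :=
  (existsUnique_residueChar p n v hv).choose

theorem residueChar_ne_one (v : HeightOneSpectrum (𝓞 K)) (hv : (p : 𝓞 K) ∉ v.asIdeal) :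
    residueChar p n v hv ≠ 1 := by
  obtain ⟨ζ, hζ, hζ', hd⟩ := exists_residue_root p n v hv
  intro h
  have hs := (existsUnique_residueChar p n v hv).choose_spec.1
  obtain ⟨g, hg⟩ := IsCyclic.exists_generator (α := (𝓞 K ⧸ v.asIdeal)ˣ)
  have h1 := (hs g⁻¹).2
  change Ideal.Quotient.mk v.asIdeal (residueChar p n v hv _) = _ at h1
  rw [h, MulChar.one_apply_coe, map_one, inv_inv, eq_comm, Units.val_eq_one,
    ← orderOf_dvd_iff_pow_eq_one, orderOf_eq_card_of_forall_mem_zpowers hg, Nat.card_units] at h1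
  have hpos : 0 < Nat.card (𝓞 K ⧸ v.asIdeal) - 1 := by
    have := Finite.one_lt_card (α := 𝓞 K ⧸ v.asIdeal)
    omega
  have hm : 1 < p ^ (n + 1) := Nat.one_lt_pow (Nat.succ_ne_zero n) hp.out.one_lt
  have := Nat.le_of_dvd (Nat.div_pos (Nat.le_of_dvd hpos hd) (by omega)) h1
  exact absurd (Nat.div_lt_self hpos hm) (not_lt.2 this)

theorem ringChar_prime (v : HeightOneSpectrum (𝓞 K)) : (ringChar (𝓞 K ⧸ v.asIdeal)).Prime :=
  CharP.char_is_prime (𝓞 K ⧸ v.asIdeal) _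

theorem ringChar_ne {K : Type*} [Field K] {p : ℕ} (v : HeightOneSpectrum (𝓞 K)) (hv : (p : 𝓞 K) ∉ v.asIdeal) :
    ringChar (𝓞 K ⧸ v.asIdeal) ≠ p := by
  intro h
  apply natCast_residue_ne_zero v hv
  rw [← h]
  exact ringChar.Nat.cast_ringChar

variable {L : Type*} [Field L]

/-- The additive character `a ↦ z ^ Tr(a)` of the residue field at `v`, for `z ^ ℓ = 1`, where `ℓ`
is the characteristic of the residue field and `Tr` is the trace to `𝔽_ℓ`. -/
noncomputable def residueAddChar (v : HeightOneSpectrum (𝓞 K)) (z : L)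
    (hz : z ^ ringChar (𝓞 K ⧸ v.asIdeal) = 1) : AddChar (𝓞 K ⧸ v.asIdeal) L :=
  haveI : NeZero (ringChar (𝓞 K ⧸ v.asIdeal)) := ⟨(ringChar_prime v).ne_zero⟩
  letI : Algebra (ZMod (ringChar (𝓞 K ⧸ v.asIdeal))) (𝓞 K ⧸ v.asIdeal) := ZMod.algebra _ _
  (AddChar.zmodChar (ringChar (𝓞 K ⧸ v.asIdeal)) hz).compAddMonoidHom
    (Algebra.trace (ZMod (ringChar (𝓞 K ⧸ v.asIdeal))) (𝓞 K ⧸ v.asIdeal)).toAddMonoidHom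

theorem residueAddChar_isPrimitive (v : HeightOneSpectrum (𝓞 K)) (z : L)
    (hz : IsPrimitiveRoot z (ringChar (𝓞 K ⧸ v.asIdeal))) :
    (residueAddChar v z hz.pow_eq_one).IsPrimitive := by
  apply AddChar.IsPrimitive.of_ne_one
  have : NeZero (ringChar (𝓞 K ⧸ v.asIdeal)) := ⟨(ringChar_prime v).ne_zero⟩
  let _ : Algebra (ZMod (ringChar (𝓞 K ⧸ v.asIdeal))) (𝓞 K ⧸ v.asIdeal) := ZMod.algebra _ _
  obtain ⟨a, ha⟩ := FiniteField.trace_to_zmod_nondegenerate (𝓞 K ⧸ v.asIdeal) one_ne_zero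
  rw [one_mul] at ha
  refine AddChar.ne_one_iff.2 ⟨a, fun hf => ha ?_⟩
  exact ((AddChar.zmodChar_primitive_of_primitive_root _ hz).zmod_char_eq_one_iff _ _).1 hf

variable [Algebra K L] {z : ℕ → L}
  (hz : ∀ ℓ : ℕ, ℓ.Prime → ℓ ≠ p → IsPrimitiveRoot (z ℓ) ℓ)

/-- The Gauss sum `τ(v) = - ∑ a, χ_v a * z_ℓ ^ Tr(a)` of a prime `v ∤ p` of `K`, where `ℓ` is the
prime number below `v` and `z_ℓ` is the chosen primitive `ℓ`-th root of unity. -/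
noncomputable def primeGaussSum (v : HeightOneSpectrum (𝓞 K)) (hv : (p : 𝓞 K) ∉ v.asIdeal) : L :=
  -gaussSum ((residueChar p n v hv).ringHomComp ((algebraMap K L).comp (algebraMap (𝓞 K) K)))
    (residueAddChar v (z (ringChar (𝓞 K ⧸ v.asIdeal)))
      (hz _ (ringChar_prime v) (ringChar_ne v hv)).pow_eq_one)

theorem primeGaussSum_ne_zero [CharZero L] (v : HeightOneSpectrum (𝓞 K))
    (hv : (p : 𝓞 K) ∉ v.asIdeal) : primeGaussSum p n hz v hv ≠ 0 := by
  rw [primeGaussSum, neg_ne_zero]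
  apply gaussSum_ne_zero_of_nontrivial
  · exact Nat.cast_ne_zero.2 Fintype.card_ne_zero
  · rw [MulChar.ringHomComp_ne_one_iff]
    · exact residueChar_ne_one p n v hv
    · exact (algebraMap K L).injective.comp RingOfIntegers.coe_injective
  · exact residueAddChar_isPrimitive v _ (hz _ (ringChar_prime v) (ringChar_ne v hv))

open scoped nonZeroDivisors Classical in
/-- The homomorphism `τ` on the group of nonzero fractional ideals with `τ(v)` the Gauss sum for
the primes `v ∤ p`, and `τ(v) = 1` for `v ∣ p`. Only its restriction to the ideals prime to `p` will
be used. -/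
noncomputable def tauAll [CharZero L] : (FractionalIdeal (𝓞 K)⁰ K)ˣ →* Lˣ where
  toFun I := ∏ᶠ v : HeightOneSpectrum (𝓞 K),
    (if hv : (p : 𝓞 K) ∉ v.asIdeal then
      Units.mk0 (primeGaussSum p n hz v hv) (primeGaussSum_ne_zero p n hz v hv) else 1) ^
      FractionalIdeal.count K v (I : FractionalIdeal (𝓞 K)⁰ K)
  map_one' := by simp [FractionalIdeal.count_one]
  map_mul' I J := by
    rw [← finprod_mul_distrib]
    · refine finprod_congr fun v => ?_
      rw [Units.val_mul, FractionalIdeal.count_mul K v I.ne_zero J.ne_zero, zpow_add]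
    · refine Set.Finite.subset (FractionalIdeal.finite_factors (I : FractionalIdeal (𝓞 K)⁰ K)) ?_
      intro v hv hc
      exact hv (by have hc' : FractionalIdeal.count K v _ = 0 := hc; simp [hc'])
    · refine Set.Finite.subset (FractionalIdeal.finite_factors (J : FractionalIdeal (𝓞 K)⁰ K)) ?_
      intro v hv hc
      exact hv (by have hc' : FractionalIdeal.count K v _ = 0 := hc; simp [hc'])

end GaussSums

section JacobiStickelberger

variable (p : ℕ) [hp : Fact p.Prime] (n : ℕ) (K : Type*) {L : Type*} [Field K] [NumberField K]
  [IsCyclotomicExtension {p ^ (n + 1)} ℚ K] [Field L] [CharZero L] [Algebra K L]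
  [IsCyclotomicExtension {m : ℕ | m.Coprime p} K L] {z : ℕ → L}
  (hz : ∀ ℓ : ℕ, ℓ.Prime → ℓ ≠ p → IsPrimitiveRoot (z ℓ) ℓ)

/-- The homomorphism `τ` from the group of fractional ideals prime to `p` to `Lˣ` whose values at
primes are the Gauss sums. -/
noncomputable def tau : HomBig p n K L :=
  (toBigUnitsModule p n K L).toAddMonoidHom.comp
    (MonoidHom.toAdditive ((tauAll p n hz).comp (idealGroup p K).subtype))

/-- The Jacobi module `ℤ[G] τ ∩ Hom_{ℤ[G]}(I, Kˣ)`, as a submodule of `Hom(I, Kˣ)`: the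
equivariant homomorphisms `I → Kˣ` that, as homomorphisms `I → Lˣ`, are multiples of `τ`. -/
noncomputable def jacobiModule : Submodule (MonoidAlgebra ℤ Gal(K/ℚ)) (HomSmall p K) :=
  equivariantHom p n K ⊓
    (Submodule.span (MonoidAlgebra ℤ Gal(K/ℚ)) {tau p n K hz}).comap (homInclusion p n K L)

/-- The automorphism `σ_t` of `K` that raises the `p ^ (n + 1)`-th roots of unity to the power
`t`, for an integer `t` prime to `p`. -/
noncomputable def sigma (t : ℤ) (ht : IsCoprime t (p : ℤ)) : Gal(K/ℚ) :=
  (IsCyclotomicExtension.Rat.galEquivZMod (p ^ (n + 1)) K).symm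
    (ZMod.unitOfIsCoprime t (by rw [Nat.cast_pow]; exact ht.pow_right))

/-- The Stickelberger element `p ^ -(n + 1) * ∑ a, a * σ_a⁻¹`, where `a` runs through the integers
prime to `p` with `1 ≤ a ≤ p ^ (n + 1)`. -/
noncomputable def stickelbergerElement : MonoidAlgebra ℚ Gal(K/ℚ) :=
  (1 / (p ^ (n + 1) : ℚ)) • ∑ a ∈ Finset.Icc 1 (p ^ (n + 1)),
    if h : IsCoprime (a : ℤ) (p : ℤ) then
      MonoidAlgebra.single (sigma p n K (a : ℤ) h)⁻¹ (a : ℚ) else 0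

/-- The ideal `S'` of `ℤ[G]` generated by the elements `t - σ_t`, for the integers `t` prime to
`p`. -/
noncomputable def stickelbergerCoeffIdeal : Ideal (MonoidAlgebra ℤ Gal(K/ℚ)) :=
  Ideal.span {x | ∃ (t : ℤ) (ht : IsCoprime t (p : ℤ)),
    x = MonoidAlgebra.single 1 t - MonoidAlgebra.single (sigma p n K t ht) 1}

/-- `ℚ[G]` as a `ℤ[G]`-module, by multiplication through `ℤ[G] → ℚ[G]`. -/
noncomputable instance rationalGroupRingModule (G : Type*) [Group G] :
    Module (MonoidAlgebra ℤ G) (MonoidAlgebra ℚ G) :=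
  Module.compHom _ (MonoidAlgebra.mapRingHom G (Int.castRingHom ℚ))

/-- The Stickelberger ideal `S = S' θ`, where `θ` is the Stickelberger element. -/
noncomputable def stickelbergerIdeal :
    Submodule (MonoidAlgebra ℤ Gal(K/ℚ)) (MonoidAlgebra ℚ Gal(K/ℚ)) :=
  Submodule.map
    (LinearMap.toSpanSingleton (MonoidAlgebra ℤ Gal(K/ℚ)) (MonoidAlgebra ℚ Gal(K/ℚ))
      (stickelbergerElement p n K))
    (stickelbergerCoeffIdeal p n K)

end JacobiStickelberger

end WeilJacobi

open WeilJacobi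

/-!
# The Jacobi module, the Weil module and the Stickelberger ideal

Let `m = p ^ (n + 1)`, `G = Gal(K/ℚ) ≃ (ℤ/m)ˣ`, `θ` the Stickelberger element, `J = σ_{-1}` complex
conjugation, and let `τ` be the homomorphism that sends a prime `w ∤ p` to its Gauss sum.

*Values in `Kˣ`.* An automorphism `s` of `L/K` only moves the additive character in a Gauss sum, so
`s` multiplies `τ(w)` by an `m`-th root of unity `u` and, as `σ` commutes with the construction,
`τ(w) ^ δ` by `u ^ κ(δ)`, where `κ : ℤ[G] → ℤ/m` is the reduction `σ_a ↦ a`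
(`algEquiv_tau_pow`). The kernel of `κ` is `S'` (`mem_stickelbergerCoeffIdeal_iff`), hence `τ ^ δ` has
values in `Kˣ` for `δ` in `S'` (`exists_homInclusion_eq`). Conversely, at a prime of degree one, `u`
can be taken to be primitive, so only the `δ` in `S'` occur
(`mem_stickelbergerCoeffIdeal_of_homInclusion_eq`). Thus the Jacobi module is `S' τ`.

*Stickelberger's theorem.* The ideal generated by `τ(I) ^ m` is `I ^ (m θ)` (`unitsOrd_apply`). The
local statement is that the valuation of the Gauss sum of a power `ω ^ (-k)` of the Teichmüller
character is given by the sum of the base-`ℓ` digits of `k`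
(`IsTeichmuller.val_gaussSum_inv_pow`). The case `k = 1` is a first order expansion; Jacobi sums being
integral, it gives one inequality for every `k`, and `g(χ) g(χ⁻¹) = ± q` forces equality. For `k` a
multiple of `(q - 1) / m` the digits sum to the multiplicities of `m θ`, since the decomposition group
of `w` consists of the powers of `ℓ` (`val_gaussSum_residueChar_pow`, `sum_stabilizer`).

*The Weil module.* For a principal ideal `I = (α)` both `τ(I) ^ m` and `α ^ (m θ)` generate the same
ideal, and since `τ(I) ^ (1 + J)` is the absolute norm of `I` (`tau_add_conj`) and
`θ (1 + J)` is the norm element (`integralStickelberger_add_conj`), their quotient has all absolute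
values `1`. By Kronecker's theorem it is a root of unity. Applying `δ` in `S'`, for which
`β = δ θ` is integral, yields `τ(I) ^ δ ≡ α ^ β` (`mem_weilModule`).

*The isomorphism.* It remains to see that `δ τ = 0` if and only if `δ θ = 0`. If `δ τ = 0`, evaluate
Stickelberger's theorem at a prime whose conjugates are distinct
(`mul_integralStickelberger_eq_zero`). If `δ θ = 0`, then every odd character `χ` of `G` vanishes on
`δ`, because `∑ a, χ(a) a ≠ 0` (`sum_char_mul_val_ne_zero`, a consequence of `L(1, χ) ≠ 0` through the
functional equation). Hence `δ = J δ`, so `δ = (1 + J) δ'` with `δ'` of degree `0`, and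
`τ ^ δ = N ^ δ' = 1`, where `N` is the absolute norm (`smul_tau_eq_zero`).
-/

/-! ### Nonvanishing of generalized Bernoulli numbers -/

namespace WeilJacobi

section Bernoulli

open Complex Polynomial Filter Asymptotics Set Topology

variable {N : ℕ}

/-- The polynomial `∑ a < N, χ(a) X ^ a`; for `x = exp (-t)` its value divided by `1 - x ^ N` is the
exponential series `∑ χ(n) exp (-n t)`. -/
noncomputable def charPoly (χ : DirichletCharacter ℂ N) : ℂ[X] :=
  ∑ a ∈ Finset.range N, C (χ a) * X ^ a

theorem charPoly_eval (χ : DirichletCharacter ℂ N) (x : ℂ) :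
    (charPoly χ).eval x = ∑ a ∈ Finset.range N, χ a * x ^ a := by
  simp [charPoly, eval_finsetSum]

variable [NeZero N]

theorem sum_range_eq_sum_zmod (f : ZMod N → ℂ) :
    ∑ a ∈ Finset.range N, f a = ∑ a : ZMod N, f a := by
  symm
  apply Finset.sum_nbij' (fun a : ZMod N => a.val) (fun a : ℕ => (a : ZMod N))
  · intro a _; exact Finset.mem_range.2 (ZMod.val_lt a)
  · intro a _; exact Finset.mem_univ _
  · intro a _; exact ZMod.natCast_zmod_val a
  · intro a ha; exact ZMod.val_cast_of_lt (Finset.mem_range.1 ha)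
  · intro a _; rw [ZMod.natCast_zmod_val]

theorem exists_charPoly_eq (χ : DirichletCharacter ℂ N) (hχ : χ ≠ 1)
    (h : ∑ a : ZMod N, χ a * (a.val : ℂ) = 0) :
    ∃ R : ℂ[X], charPoly χ = (X - C 1) ^ 2 * (X * R) := by
  have hN : N ≠ 1 := fun h => by subst h; exact hχ (Subsingleton.elim _ _)
  have h0 : X ∣ charPoly χ := by
    rw [X_dvd_iff, coeff_zero_eq_eval_zero, charPoly_eval,
      Finset.sum_eq_single_of_mem 0 (Finset.mem_range.2 (NeZero.pos N))]
    · have : χ ((0 : ℕ) : ZMod N) = 0 := by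
        have := χ.map_zero' hN
        rwa [Nat.cast_zero]
      rw [this, zero_mul]
    · intro b _ hb; simp [hb]
  have h1 : (X - C 1) ^ 2 ∣ charPoly χ := by
    by_cases hz : charPoly χ = 0
    · rw [hz]; exact dvd_zero _
    rw [← le_rootMultiplicity_iff hz, Nat.succ_le_iff, one_lt_rootMultiplicity_iff_isRoot hz]
    refine ⟨?_, ?_⟩
    · rw [IsRoot.def, charPoly_eval]
      simp only [one_pow, mul_one]
      rw [sum_range_eq_sum_zmod (fun a => χ a), χ.sum_eq_zero_of_ne_one hχ]
    · rw [IsRoot.def, charPoly, derivative_sum, eval_finsetSum, ← h, ← sum_range_eq_sum_zmod]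
      refine Finset.sum_congr rfl fun a ha => ?_
      rw [ZMod.val_cast_of_lt (Finset.mem_range.1 ha)]
      simp [derivative_X_pow]
  obtain ⟨P, hP⟩ := h1
  have hc : IsCoprime (X : ℂ[X]) ((X - C 1) ^ 2) := by
    apply IsCoprime.pow_right
    exact ⟨1, -1, by simp⟩
  rw [hP] at h0
  obtain ⟨R, hR⟩ := hc.dvd_of_dvd_mul_left h0
  exact ⟨R, by rw [hP, hR]⟩

/-- The function `t ↦ ∑ χ(n) exp (-n t)` in closed form, when `∑ a χ(a) = 0`: here `R` is the
quotient of `∑ a < N, χ(a) X ^ a` by `X (X - 1) ^ 2`. -/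
noncomputable def expSeries (N : ℕ) (R : ℂ[X]) (t : ℝ) : ℂ :=
  (Real.exp (-t) : ℂ) * (1 - Real.exp (-t)) * R.eval (Real.exp (-t) : ℂ) /
    ∑ i ∈ Finset.range N, (Real.exp (-t) : ℂ) ^ i

theorem one_le_norm_geom (t : ℝ) :
    1 ≤ ‖∑ i ∈ Finset.range N, (Real.exp (-t) : ℂ) ^ i‖ := by
  have : (∑ i ∈ Finset.range N, (Real.exp (-t) : ℂ) ^ i) =
      ((∑ i ∈ Finset.range N, Real.exp (-t) ^ i : ℝ) : ℂ) := by push_cast; rfl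
  rw [this, Complex.norm_real, Real.norm_eq_abs]
  refine le_trans ?_ (le_abs_self _)
  have := Finset.single_le_sum (f := fun i => Real.exp (-t) ^ i) (s := Finset.range N)
    (fun i _ => by positivity) (Finset.mem_range.2 (NeZero.pos N))
  simpa using this

theorem hasSum_expSeries (χ : DirichletCharacter ℂ N) {R : ℂ[X]}
    (hR : charPoly χ = (X - C 1) ^ 2 * (X * R)) {t : ℝ} (ht : 0 < t) :
    HasSum (fun n : ℕ => χ n * Real.exp (-(n : ℝ) * t)) (expSeries N R t) := by
  set x : ℂ := (Real.exp (-t) : ℂ) with hx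
  have hx1 : ‖x‖ < 1 := by
    rw [hx, Complex.norm_real, Real.norm_eq_abs, Real.abs_exp, Real.exp_lt_one_iff]
    linarith
  have hterm : ∀ n : ℕ, χ n * (Real.exp (-(n : ℝ) * t) : ℂ) = χ n * x ^ n := by
    intro n
    rw [hx, ← Complex.ofReal_pow, ← Real.exp_nat_mul]
    ring_nf
  simp_rw [hterm]
  have hs : Summable fun n : ℕ => χ n * x ^ n := by
    apply Summable.of_norm_bounded (g := fun n => ‖x‖ ^ n)
      (summable_geometric_of_lt_one (norm_nonneg _) hx1)
    intro n
    rw [norm_mul, norm_pow]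
    exact mul_le_of_le_one_left (by positivity) (χ.norm_le_one _)
  have h1 := hs.sum_add_tsum_nat_add N
  have h2 : ∀ n : ℕ, χ ((n + N : ℕ) : ZMod N) * x ^ (n + N) = x ^ N * (χ n * x ^ n) := by
    intro n
    rw [Nat.cast_add, ZMod.natCast_self, add_zero, pow_add]
    ring
  simp_rw [h2] at h1
  rw [tsum_mul_left, ← charPoly_eval, hR] at h1
  simp only [eval_mul, eval_pow, eval_sub, eval_X, eval_C] at h1
  have hg := geom_sum_mul x N
  have hgn : (∑ i ∈ Finset.range N, x ^ i) ≠ 0 := by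
    have := one_le_norm_geom (N := N) t
    intro h
    rw [h, norm_zero] at this
    linarith
  have hxn : 1 - x ≠ 0 := by
    intro h
    rw [← sub_eq_zero.1 h, norm_one] at hx1
    exact lt_irrefl _ hx1
  have h3 : ∑' n : ℕ, χ n * x ^ n = expSeries N R t := by
    rw [expSeries, ← hx, eq_div_iff hgn]
    apply mul_left_cancel₀ hxn
    linear_combination (-h1) - (∑' n : ℕ, χ n * x ^ n) * hg
  rw [← h3]
  exact hs.hasSum

theorem continuous_expSeries (R : ℂ[X]) : Continuous (expSeries N R) := by
  unfold expSeries
  apply Continuous.div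
  · have : Continuous fun t : ℝ => (Real.exp (-t) : ℂ) := by fun_prop
    exact (this.mul (continuous_const.sub this)).mul (R.continuous.comp this)
  · fun_prop
  · intro t h
    have := one_le_norm_geom (N := N) t
    rw [h, norm_zero] at this
    linarith

theorem exists_norm_expSeries_le (R : ℂ[X]) :
    ∃ c : ℝ, ∀ t : ℝ, 0 < t → ‖expSeries N R t‖ ≤ c * (Real.exp (-t) * (1 - Real.exp (-t))) := by
  obtain ⟨c, hc⟩ := (isCompact_Icc (a := (0 : ℝ)) (b := 1)).exists_bound_of_continuousOn
    (f := fun x : ℝ => R.eval (x : ℂ)) (by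
      exact (R.continuous.comp Complex.continuous_ofReal).continuousOn)
  refine ⟨c, fun t ht => ?_⟩
  have he : Real.exp (-t) < 1 := by rw [Real.exp_lt_one_iff]; linarith
  have h1 := hc (Real.exp (-t)) ⟨(Real.exp_pos _).le, he.le⟩
  rw [expSeries, norm_div]
  refine (div_le_self (norm_nonneg _) (one_le_norm_geom t)).trans ?_
  rw [norm_mul, norm_mul, mul_comm]
  have e1 : ‖(Real.exp (-t) : ℂ)‖ = Real.exp (-t) := by
    rw [Complex.norm_real, Real.norm_eq_abs, Real.abs_exp]
  have e2 : ‖(1 - Real.exp (-t) : ℂ)‖ = 1 - Real.exp (-t) := by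
    rw [← Complex.ofReal_one, ← Complex.ofReal_sub, Complex.norm_real, Real.norm_eq_abs,
      abs_of_nonneg (by linarith)]
  rw [e1, e2]
  gcongr

/-- If `∑ a χ(a) = 0`, then `∑ χ(n) exp (-n t)` is `O(t)` at `0`; its Mellin transform
`Γ(s) L(s, χ)` is therefore regular at `s = 0`, where `Γ` has a pole. -/
theorem LFunction_zero_eq_zero (χ : DirichletCharacter ℂ N) (hχ : χ ≠ 1)
    (h : ∑ a : ZMod N, χ a * (a.val : ℂ) = 0) : χ.LFunction 0 = 0 := by
  have hN : N ≠ 1 := fun h => by subst h; exact hχ (Subsingleton.elim _ _)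
  obtain ⟨R, hR⟩ := exists_charPoly_eq χ hχ h
  obtain ⟨c, hc⟩ := exists_norm_expSeries_le (N := N) R
  have hd : ∀ s : ℂ, -1 < s.re → DifferentiableAt ℂ (mellin (expSeries N R)) s := by
    intro s hs
    refine mellin_differentiableAt_of_isBigO_rpow_exp one_pos
      ((continuous_expSeries R).locallyIntegrable.locallyIntegrableOn _) ?_ ?_ hs
    · apply IsBigO.of_bound |c|
      filter_upwards [eventually_gt_atTop 0] with t ht
      have he : Real.exp (-t) < 1 := by rw [Real.exp_lt_one_iff]; linarith
      have h0 := Real.exp_pos (-t)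
      refine (hc t ht).trans ?_
      rw [Real.norm_eq_abs, Real.abs_exp, neg_one_mul]
      refine (mul_le_mul_of_nonneg_right (le_abs_self c) (by nlinarith)).trans ?_
      gcongr
      nlinarith
    · apply IsBigO.of_bound |c|
      filter_upwards [self_mem_nhdsWithin] with t ht
      have ht' : 0 < t := ht
      have he : Real.exp (-t) < 1 := by rw [Real.exp_lt_one_iff]; linarith
      have h0 := Real.exp_pos (-t)
      refine (hc t ht).trans ?_
      rw [neg_neg, Real.rpow_one, Real.norm_eq_abs, abs_of_pos ht']
      have h1 := Real.add_one_le_exp (-t)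
      refine (mul_le_mul_of_nonneg_right (le_abs_self c) (by nlinarith)).trans ?_
      gcongr
      nlinarith
  have hU : IsOpen {s : ℂ | -1 < s.re} := Complex.continuous_re.isOpen_preimage _ isOpen_Ioi
  have hpre : IsPreconnected {s : ℂ | -1 < s.re} :=
    (convex_halfSpace_re_gt (-1)).isPreconnected
  have heq : Set.EqOn χ.LFunction (fun s => mellin (expSeries N R) s * (Gamma s)⁻¹)
      {s : ℂ | -1 < s.re} := by
    refine AnalyticOnNhd.eqOn_of_preconnected_of_eventuallyEq (𝕜 := ℂ) (z₀ := 2) ?_ ?_ hpre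
      (by simp; norm_num) ?_
    · exact ((DirichletCharacter.differentiable_LFunction hχ).differentiableOn).analyticOnNhd hU
    · refine DifferentiableOn.analyticOnNhd (fun s hs => ?_) hU
      exact ((hd s hs).mul (Complex.differentiable_one_div_Gamma s)).differentiableWithinAt
    · refine eventually_of_mem ((continuous_re.isOpen_preimage _ isOpen_Ioi).mem_nhds
        (by simp : 1 < (2 : ℂ).re)) fun s (hs : 1 < s.re) => ?_
      have hz : χ ((0 : ℕ) : ZMod N) = 0 := by
        have := χ.map_zero' hN
        rwa [Nat.cast_zero]
      have hG : Gamma s ≠ 0 := Gamma_ne_zero_of_re_pos (by linarith)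
      have hm := hasSum_mellin (a := fun n : ℕ => χ n) (p := fun n : ℕ => (n : ℝ))
        (F := expSeries N R) (s := s) (fun n => by
          rcases Nat.eq_zero_or_pos n with rfl | hn
          · exact Or.inl hz
          · exact Or.inr (Nat.cast_pos.2 hn)) (by linarith)
        (fun t ht => hasSum_expSeries χ hR ht) (by
          refine Summable.of_nonneg_of_le (fun n => by positivity) (fun n => ?_)
            (Real.summable_one_div_nat_rpow.2 hs)
          gcongr
          exact χ.norm_le_one _)
      rw [DirichletCharacter.LFunction_eq_LSeries χ hs, LSeries, eq_mul_inv_iff_mul_eq₀ hG,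
        ← hm.tsum_eq, ← tsum_mul_right]
      refine tsum_congr fun n => ?_
      rcases Nat.eq_zero_or_pos n with rfl | hn
      · rw [hz, LSeries.term_zero, mul_zero, zero_div, zero_mul]
      · rw [LSeries.term_of_ne_zero hn.ne', ofReal_natCast]
        ring
  rw [heq (show (-1 : ℝ) < (0 : ℂ).re by simp)]
  simp [Complex.Gamma_zero]

theorem LFunction_zero_ne_zero_of_isPrimitive {χ : DirichletCharacter ℂ N} (hχ : χ.Odd)
    (hp : χ.IsPrimitive) : χ.LFunction 0 ≠ 0 := by
  have h1 : χ ≠ 1 := by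
    rintro rfl
    have : (1 : DirichletCharacter ℂ N) (-1) = -1 := hχ
    rw [MulChar.one_apply (isUnit_one.neg)] at this
    norm_num at this
  have h1' : χ⁻¹ ≠ 1 := inv_ne_one.2 h1
  have hN : N ≠ 1 := fun h => by subst h; exact h1 (Subsingleton.elim _ _)
  intro h0
  rw [DirichletCharacter.LFunction_eq_completed_div_gammaFactor χ 0 (Or.inr hN), hχ.gammaFactor_def,
    div_eq_zero_iff] at h0
  have h2 : DirichletCharacter.completedLFunction χ 0 = 0 := by
    refine h0.resolve_right (Gammaℝ_ne_zero_of_re_pos (by simp))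
  have hp' : χ⁻¹.IsPrimitive := by
    rw [DirichletCharacter.isPrimitive_def] at hp ⊢
    rwa [DirichletCharacter.conductor_inv]
  have h3 := hp'.completedLFunction_one_sub 0
  rw [inv_inv, h2, mul_zero, sub_zero] at h3
  have h4 := DirichletCharacter.LFunction_apply_one_ne_zero h1'
  rw [DirichletCharacter.LFunction_eq_completed_div_gammaFactor _ 1 (Or.inr hN), h3, zero_div] at h4
  exact h4 rfl

/-- The generalized Bernoulli number `B_{1,χ} = N⁻¹ ∑ a χ(a)` of an odd character of prime power
level does not vanish. The level being a prime power, no Euler factors appear in the passage to the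
primitive character. -/
theorem sum_char_mul_val_ne_zero {p n : ℕ} [hp : Fact p.Prime] {χ : DirichletCharacter ℂ (p ^ n)}
    (hχ : χ.Odd) : ∑ a : ZMod (p ^ n), χ a * (a.val : ℂ) ≠ 0 := by
  have h1 : χ ≠ 1 := by
    rintro rfl
    have : (1 : DirichletCharacter ℂ (p ^ n)) (-1) = -1 := hχ
    rw [MulChar.one_apply (isUnit_one.neg)] at this
    norm_num at this
  intro h
  have h0 := LFunction_zero_eq_zero χ h1 h
  have hd := χ.conductor_dvd_level
  have : NeZero χ.conductor := ⟨fun h => by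
    rw [h, zero_dvd_iff] at hd; exact (pow_pos hp.out.pos n).ne' hd⟩
  set χ₀ := χ.primitiveCharacter with hχ₀
  have hch : DirichletCharacter.changeLevel hd χ₀ = χ :=
    (χ.factorsThrough_conductor.eq_changeLevel).symm
  have h10 : χ₀ ≠ 1 := by
    intro h
    rw [h, map_one] at hch
    exact h1 hch.symm
  have hodd : χ₀.Odd := by
    have h2 : χ (-1) = -1 := hχ
    have h3 := DirichletCharacter.changeLevel_eq_cast_of_dvd χ₀ hd (-1)
    rw [hch, Units.val_neg, Units.val_one, h2, ZMod.cast_neg hd, ZMod.cast_one hd] at h3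
    exact h3.symm
  refine LFunction_zero_ne_zero_of_isPrimitive hodd χ.primitiveCharacter_isPrimitive ?_
  rw [← hch, DirichletCharacter.LFunction_changeLevel hd χ₀ (Or.inl h10)] at h0
  refine (mul_eq_zero.1 h0).resolve_right ?_
  refine Finset.prod_ne_zero_iff.2 fun q hq => ?_
  have hqp : q = p :=
    (Nat.prime_dvd_prime_iff_eq (Nat.prime_of_mem_primeFactors hq) hp.out).1
      ((Nat.prime_of_mem_primeFactors hq).dvd_of_dvd_pow (Nat.dvd_of_mem_primeFactors hq))
  subst hqp
  have : χ₀ (q : ZMod χ.conductor) = 0 := by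
    apply χ₀.map_nonunit
    rw [ZMod.isUnit_iff_coprime]
    obtain ⟨k, hk, hk'⟩ := (Nat.dvd_prime_pow hp.out).1 hd
    have hk0 : k ≠ 0 := by
      rintro rfl
      rw [pow_zero] at hk'
      exact h1 (DirichletCharacter.eq_one_iff_conductor_eq_one.2 hk')
    rw [hk', Nat.coprime_pow_right_iff (Nat.pos_of_ne_zero hk0), Nat.coprime_self]
    exact hp.out.ne_one
  rw [this]
  simp

end Bernoulli

end WeilJacobi

/-! ### Valuations of Gauss sums -/

namespace WeilJacobi

section LocalGauss

variable {F : Type*} [Field F] [Fintype F] {M : Type*} [Field M]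
  {Γ : Type*} [LinearOrderedCommGroupWithZero Γ] {v : Valuation M Γ}

theorem val_eq_one_of_pow_eq_one {x : M} {k : ℕ} (hk : k ≠ 0) (hx : x ^ k = 1) : v x = 1 := by
  have : v x ^ k = 1 := by rw [← map_pow, hx, map_one]
  exact (pow_eq_one_iff.1 this).resolve_right hk

theorem val_natCast_le_one (k : ℕ) : v (k : M) ≤ 1 := by
  induction k with
  | zero => simp
  | succ k ih =>
    rw [Nat.cast_succ]
    exact v.map_add_le ih (by simp)

theorem val_mulChar_of_ne_zero (χ : MulChar F M) {a : F} (ha : a ≠ 0) : v (χ a) = 1 := by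
  have h := FiniteField.pow_card_sub_one_eq_one a ha
  apply val_eq_one_of_pow_eq_one (k := Fintype.card F - 1)
  · have := Fintype.one_lt_card (α := F)
    omega
  · rw [← map_pow, h, map_one]

theorem val_mulChar_le_one (χ : MulChar F M) (a : F) : v (χ a) ≤ 1 := by
  by_cases ha : a = 0
  · rw [ha, χ.map_zero, map_zero]
    exact zero_le
  · exact (val_mulChar_of_ne_zero χ ha).le

theorem val_addChar (ψ : AddChar F M) (a : F) : v (ψ a) = 1 := by
  apply val_eq_one_of_pow_eq_one (k := Fintype.card F) Fintype.card_ne_zero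
  rw [← AddChar.map_nsmul_eq_pow, card_nsmul_eq_zero, AddChar.map_zero_eq_one]

theorem val_gaussSum_le_one (χ : MulChar F M) (ψ : AddChar F M) : v (gaussSum χ ψ) ≤ 1 := by
  refine v.map_sum_le fun a _ => ?_
  rw [map_mul, val_addChar, mul_one]
  exact val_mulChar_le_one χ a

theorem val_jacobiSum_le_one (χ φ : MulChar F M) : v (jacobiSum χ φ) ≤ 1 := by
  refine v.map_sum_le fun a _ => ?_
  rw [map_mul]
  exact mul_le_one' (val_mulChar_le_one χ _) (val_mulChar_le_one φ _)

theorem val_gaussSum_one [CharZero M] {ψ : AddChar F M} (hψ : ψ ≠ 1) :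
    v (gaussSum (1 : MulChar F M) ψ) = 1 := by
  rw [gaussSum_one_left hψ, v.map_neg, map_one]

/-- Jacobi sums are integral, so the valuation of Gauss sums is supermultiplicative in the
character. -/
theorem val_gaussSum_mul_le [CharZero M] (χ φ : MulChar F M) {ψ : AddChar F M} (hψ : ψ ≠ 1) :
    v (gaussSum χ ψ) * v (gaussSum φ ψ) ≤ v (gaussSum (χ * φ) ψ) := by
  by_cases h : χ * φ = 1
  · rw [h, val_gaussSum_one hψ]
    exact mul_le_one' (val_gaussSum_le_one _ _) (val_gaussSum_le_one _ _)
  · rw [← map_mul, ← jacobiSum_mul_nontrivial h ψ, map_mul]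
    exact mul_le_of_le_one_right' (val_jacobiSum_le_one _ _)

theorem val_gaussSum_pow_le [CharZero M] (χ : MulChar F M) {ψ : AddChar F M} (hψ : ψ ≠ 1) (k : ℕ) :
    v (gaussSum χ ψ) ^ k ≤ v (gaussSum (χ ^ k) ψ) := by
  induction k with
  | zero => rw [pow_zero, pow_zero, val_gaussSum_one hψ]
  | succ k ih =>
    rw [pow_succ, pow_succ]
    exact (mul_le_mul_left ih _).trans (val_gaussSum_mul_le _ _ hψ)

theorem prod_val_gaussSum_le [CharZero M] {ι : Type*} (s : Finset ι) (χ : ι → MulChar F M)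
    {ψ : AddChar F M} (hψ : ψ ≠ 1) :
    ∏ i ∈ s, v (gaussSum (χ i) ψ) ≤ v (gaussSum (∏ i ∈ s, χ i) ψ) := by
  classical
  induction s using Finset.induction_on with
  | empty => rw [Finset.prod_empty, Finset.prod_empty, val_gaussSum_one hψ]
  | insert a s ha ih =>
    rw [Finset.prod_insert ha, Finset.prod_insert ha]
    exact (mul_le_mul_right ih _).trans (val_gaussSum_mul_le _ _ hψ)

section Root

variable {ℓ : ℕ} {ζ : M}

theorem val_one_sub_pow_le (hζ : v ζ = 1) (b : ℕ) : v (1 - ζ ^ b) ≤ v (1 - ζ) := by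
  have h : 1 - ζ ^ b = (∑ i ∈ Finset.range b, ζ ^ i) * (1 - ζ) := (geom_sum_mul_neg ζ b).symm
  rw [h, map_mul]
  refine mul_le_of_le_one_left' (v.map_sum_le fun i _ => ?_)
  rw [map_pow, hζ, one_pow]

theorem val_one_sub_pow_eq (hζ : IsPrimitiveRoot ζ ℓ) (hℓ : ℓ ≠ 0) {b : ℕ} (hb : b.Coprime ℓ) :
    v (1 - ζ ^ b) = v (1 - ζ) := by
  have h1 : v ζ = 1 := val_eq_one_of_pow_eq_one hℓ hζ.pow_eq_one
  apply le_antisymm (val_one_sub_pow_le h1 b)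
  have hb' : v (ζ ^ b) = 1 := by rw [map_pow, h1, one_pow]
  have : NeZero ℓ := ⟨hℓ⟩
  obtain ⟨c, -, hc⟩ := (hζ.pow_of_coprime b hb).eq_pow_of_pow_eq_one hζ.pow_eq_one
  have := val_one_sub_pow_le hb' c
  rwa [hc] at this

theorem val_prime_eq (hℓ : ℓ.Prime) (hζ : IsPrimitiveRoot ζ ℓ) :
    v (ℓ : M) = v (1 - ζ) ^ (ℓ - 1) := by
  obtain ⟨k, rfl⟩ : ∃ k, ℓ = k + 1 := ⟨ℓ - 1, by have := hℓ.pos; omega⟩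
  have h := hζ.prod_one_sub_pow_eq_order
  rw [Nat.cast_succ, ← h, map_prod, Nat.add_sub_cancel]
  refine (Finset.prod_congr rfl fun i hi => ?_).trans (by rw [Finset.prod_const, Finset.card_range])
  refine val_one_sub_pow_eq hζ hℓ.ne_zero ?_
  rw [Nat.coprime_comm, hℓ.coprime_iff_not_dvd]
  intro hd
  have h1 := Nat.le_of_dvd (Nat.succ_pos i) hd
  have h2 := Finset.mem_range.1 hi
  omega

/-- `ζ ^ k ≡ 1 - k π` modulo `π ^ 2` for `π = 1 - ζ`. -/
theorem val_pow_sub_le (hζ : v ζ = 1) (k : ℕ) :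
    v (ζ ^ k - 1 + k * (1 - ζ)) ≤ v (1 - ζ) ^ 2 := by
  induction k with
  | zero => simp
  | succ k ih =>
    have h : ζ ^ (k + 1) - 1 + ((k + 1 : ℕ) : M) * (1 - ζ) =
        ζ * (ζ ^ k - 1 + k * (1 - ζ)) + k * (1 - ζ) ^ 2 := by push_cast; ring
    rw [h]
    refine v.map_add_le ?_ ?_
    · rw [map_mul, hζ, one_mul]; exact ih
    · rw [map_mul, map_pow]
      exact mul_le_of_le_one_left' (val_natCast_le_one k)

end Root

/-- A multiplicative character of a finite field that is additive modulo the maximal ideal of the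
valuation `v`: the values are the Teichmüller representatives of the elements of the field. -/
def IsTeichmuller (v : Valuation M Γ) (ω : MulChar F M) : Prop :=
  ∀ x y : F, v (ω (x + y) - (ω x + ω y)) < 1

namespace IsTeichmuller

variable {ω : MulChar F M} (hω : IsTeichmuller v ω)
include hω

theorem eq_one_of_apply_eq_one {x : F} (hx : ω x = 1) : x = 1 := by
  by_contra h
  have h1 := hω (x - 1) 1
  rw [sub_add_cancel, hx, map_one, sub_add_cancel_right, v.map_neg,
    val_mulChar_of_ne_zero ω (sub_ne_zero.2 h)] at h1
  exact lt_irrefl _ h1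

theorem pow_ne_one {j : ℕ} (h0 : 0 < j) (hj : j < Fintype.card F - 1) : ω ^ j ≠ 1 := by
  classical
  intro h
  obtain ⟨g, hg⟩ := IsCyclic.exists_generator (α := Fˣ)
  have h1 : ω ((g : F) ^ j) = 1 := by
    rw [map_pow, ← MulChar.pow_apply_coe, h, MulChar.one_apply_coe]
  have h2 : g ^ j = 1 := Units.ext (by
    rw [Units.val_pow_eq_pow_val, hω.eq_one_of_apply_eq_one h1, Units.val_one])
  have h3 := Nat.le_of_dvd h0 (orderOf_dvd_of_pow_eq_one h2)
  rw [orderOf_eq_card_of_forall_mem_zpowers hg, Nat.card_eq_fintype_card, Fintype.card_units] at h3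
  omega

omit [Fintype F] in
theorem apply_sum {ι : Type*} (s : Finset ι) (f : ι → F) :
    v (ω (∑ i ∈ s, f i) - ∑ i ∈ s, ω (f i)) < 1 := by
  classical
  induction s using Finset.induction_on with
  | empty => simp [ω.map_zero]
  | insert a s ha ih =>
    rw [Finset.sum_insert ha, Finset.sum_insert ha]
    have := v.map_add_lt (hω (f a) (∑ i ∈ s, f i)) ih
    convert this using 2
    ring

omit [Fintype F] in
theorem apply_natCast (k : ℕ) : v (ω (k : F) - k) < 1 := by
  have := hω.apply_sum (Finset.range k) (fun _ => 1)
  simpa using this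

/-- The first case of Stickelberger's congruence: the Gauss sum of `ω⁻¹` has the same valuation as
`1 - ζ`. The first order term of `∑ ω(a)⁻¹ ζ ^ Tr(a)` is `-(1 - ζ) ∑ ω(a)⁻¹ Tr(a)`, and orthogonality
of characters evaluates this sum to `q - 1`. -/
theorem val_gaussSum_inv {ℓ f : ℕ} {ζ : M} (hF : Fintype.card F = ℓ ^ f) (hq : 2 < ℓ ^ f)
    (hζ : v ζ = 1) (hπ : v (1 - ζ) < 1) (hq1 : v ((Fintype.card F : ℕ) : M) < 1)
    (hπ0 : v (1 - ζ) ≠ 0) {ψ : AddChar F M}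
    (hψ : ∀ a, ∃ k : ℕ, ψ a = ζ ^ k ∧ (k : F) = ∑ i ∈ Finset.range f, a ^ ℓ ^ i) :
    v (gaussSum ω⁻¹ ψ) = v (1 - ζ) := by
  classical
  choose k hk hk' using hψ
  set π := 1 - ζ with hπdef
  have hf : 0 < f := by
    rcases Nat.eq_zero_or_pos f with rfl | h
    · rw [pow_zero] at hq; omega
    · exact h
  have hℓ : 1 < ℓ := by
    by_contra h
    have := Nat.pow_le_one_iff hf.ne' |>.2 (not_lt.1 h)
    omega
  have hω1 : ω⁻¹ ≠ 1 := by
    rw [inv_ne_one, ← pow_one ω]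
    exact hω.pow_ne_one one_pos (by omega)
  -- the coefficient of the linear term
  set B := ∑ a : F, ω⁻¹ a * (k a : M) with hB
  have hB1 : v (B - ((Fintype.card F : ℕ) - 1 : M)) < 1 := by
    have hmain : ∑ a : F, ω⁻¹ a * ∑ i ∈ Finset.range f, ω a ^ ℓ ^ i =
        ((Fintype.card F : ℕ) - 1 : M) := by
      simp_rw [Finset.mul_sum]
      rw [Finset.sum_comm, Finset.sum_eq_single_of_mem 0 (Finset.mem_range.2 hf)]
      · have : ∀ a : F, ω⁻¹ a * ω a ^ ℓ ^ 0 = (1 : MulChar F M) a := by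
          intro a
          rw [pow_zero, pow_one, ← MulChar.mul_apply, inv_mul_cancel]
        simp_rw [this]
        rw [MulChar.sum_one_eq_card_units, Fintype.card_units, Nat.cast_sub Fintype.card_pos,
          Nat.cast_one]
      · intro i hi hi0
        have h1 : ℓ ^ i - 1 ≠ 0 := by
          have := Nat.one_lt_pow hi0 hℓ
          omega
        have : ∀ a : F, ω⁻¹ a * ω a ^ ℓ ^ i = (ω ^ (ℓ ^ i - 1)) a := by
          intro a
          obtain ⟨j, hj⟩ : ∃ j, ℓ ^ i = j + 1 := ⟨ℓ ^ i - 1, by omega⟩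
          have hj0 : j ≠ 0 := by omega
          rw [hj, Nat.add_sub_cancel, ← MulChar.pow_apply' ω (Nat.succ_ne_zero j),
            ← MulChar.mul_apply, pow_succ', inv_mul_cancel_left]
        simp_rw [this]
        apply MulChar.sum_eq_zero_of_ne_one
        apply hω.pow_ne_one (Nat.pos_of_ne_zero h1)
        rw [hF]
        have := Nat.pow_lt_pow_right hℓ (Finset.mem_range.1 hi)
        omega
    rw [← hmain, hB, ← Finset.sum_sub_distrib]
    refine v.map_sum_lt one_ne_zero fun a _ => ?_
    rw [← mul_sub, map_mul]
    refine mul_lt_of_le_one_of_lt (val_mulChar_le_one _ _) ?_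
    have h1 := hω.apply_natCast (k a)
    rw [hk'] at h1
    have h2 := hω.apply_sum (Finset.range f) (fun i => a ^ ℓ ^ i)
    have h3 := v.map_sub_lt h2 h1
    convert h3 using 2
    simp_rw [map_pow]
    ring
  have hB2 : v B = 1 := by
    have h1 : v ((Fintype.card F : ℕ) - 1 : M) = 1 := by
      rw [v.map_sub_swap, v.map_one_sub_of_lt hq1]
    have h2 := v.map_add_eq_of_lt_right (x := B - ((Fintype.card F : ℕ) - 1 : M))
      (y := ((Fintype.card F : ℕ) - 1 : M)) (by rw [h1]; exact hB1)
    rw [sub_add_cancel, h1] at h2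
    exact h2
  have hg : gaussSum ω⁻¹ ψ = ∑ a, ω⁻¹ a * (ζ ^ k a - 1 + k a * π) + -(π * B) := by
    have h0 := MulChar.sum_eq_zero_of_ne_one hω1
    rw [gaussSum, hB, Finset.mul_sum, ← Finset.sum_neg_distrib, ← Finset.sum_add_distrib,
      ← sub_zero (∑ a, ω⁻¹ a * ψ a), ← h0, ← Finset.sum_sub_distrib]
    refine Finset.sum_congr rfl fun a _ => ?_
    rw [hk a]
    ring
  have hle : v (∑ a, ω⁻¹ a * (ζ ^ k a - 1 + k a * π)) ≤ v π ^ 2 := by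
    refine v.map_sum_le fun a _ => ?_
    rw [map_mul]
    exact mul_le_of_le_one_of_le (val_mulChar_le_one _ _) (val_pow_sub_le hζ _)
  have hlt : v π ^ 2 < v (-(π * B)) := by
    rw [v.map_neg, map_mul, hB2, mul_one, sq]
    exact mul_lt_of_lt_one_left (zero_lt_iff.2 hπ0) hπ
  rw [hg, v.map_add_eq_of_lt_right (hle.trans_lt hlt), v.map_neg, map_mul, hB2, mul_one]

end IsTeichmuller

theorem gaussSum_pow_char {ℓ : ℕ} (hℓ : ℓ.Prime) [CharP F ℓ] (χ : MulChar F M) {ψ : AddChar F M}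
    (hψ : ∀ a, ψ (a ^ ℓ) = ψ a) : gaussSum (χ ^ ℓ) ψ = gaussSum χ ψ := by
  have : Fact ℓ.Prime := ⟨hℓ⟩
  rw [gaussSum, gaussSum]
  refine Fintype.sum_bijective (fun a : F => a ^ ℓ) (bijective_frobenius F ℓ) _ _ fun a => ?_
  rw [hψ, map_pow, MulChar.pow_apply' χ hℓ.ne_zero]

theorem gaussSum_pow_char_pow {ℓ : ℕ} (hℓ : ℓ.Prime) [CharP F ℓ] (χ : MulChar F M) {ψ : AddChar F M}
    (hψ : ∀ a, ψ (a ^ ℓ) = ψ a) (i : ℕ) : gaussSum (χ ^ ℓ ^ i) ψ = gaussSum χ ψ := by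
  induction i with
  | zero => rw [pow_zero, pow_one]
  | succ i ih => rw [pow_succ, pow_mul, gaussSum_pow_char hℓ _ hψ, ih]

/-- Stickelberger's theorem at one prime: the Gauss sum of `ω ^ (-k)` has the valuation of
`(1 - ζ) ^ D`, where `D` is the sum of the digits of `k` in base `ℓ`. -/
theorem IsTeichmuller.val_gaussSum_inv_pow [CharZero M] {ω : MulChar F M} (hω : IsTeichmuller v ω)
    {ℓ f : ℕ} (hℓ : ℓ.Prime) [CharP F ℓ] {ζ : M} (hζ : IsPrimitiveRoot ζ ℓ)
    (hF : Fintype.card F = ℓ ^ f) (hq : 2 < ℓ ^ f) (hvℓ : v (ℓ : M) < 1) {ψ : AddChar F M}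
    (hψ : ∀ a, ∃ k : ℕ, ψ a = ζ ^ k ∧ (k : F) = ∑ i ∈ Finset.range f, a ^ ℓ ^ i)
    (hψ1 : ψ.IsPrimitive) (c : ℕ → ℕ) (hc : ∀ i ∈ Finset.range f, c i ≤ ℓ - 1)
    (hk : ω ^ (∑ i ∈ Finset.range f, c i * ℓ ^ i) ≠ 1) :
    v (gaussSum (ω⁻¹ ^ (∑ i ∈ Finset.range f, c i * ℓ ^ i)) ψ) =
      v (1 - ζ) ^ (∑ i ∈ Finset.range f, c i) := by
  have hf : f ≠ 0 := by
    rintro rfl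
    rw [pow_zero] at hq; omega
  have hζ1 : v ζ = 1 := val_eq_one_of_pow_eq_one hℓ.ne_zero hζ.pow_eq_one
  have hp := val_prime_eq (v := v) hℓ hζ
  have hℓ1 : ℓ - 1 ≠ 0 := by have := hℓ.one_lt; omega
  have hπ : v (1 - ζ) < 1 := by
    rw [hp] at hvℓ
    exact (pow_lt_one_iff hℓ1).1 hvℓ
  have hπ0 : v (1 - ζ) ≠ 0 := by
    rw [v.ne_zero_iff, sub_ne_zero]
    rintro rfl
    exact hℓ.ne_one (hζ.eq_orderOf.trans orderOf_one)
  have hψne : ψ ≠ 1 := by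
    have := hψ1 (one_ne_zero)
    rwa [AddChar.mulShift_one] at this
  have hcard : v ((Fintype.card F : ℕ) : M) = v (1 - ζ) ^ (f * (ℓ - 1)) := by
    rw [hF, Nat.cast_pow, map_pow, hp, ← pow_mul, mul_comm]
  have hψfrob : ∀ a, ψ (a ^ ℓ) = ψ a := by
    intro a
    obtain ⟨k, h1, h2⟩ := hψ a
    obtain ⟨k', h1', h2'⟩ := hψ (a ^ ℓ)
    rw [h1, h1']
    have h3 : (k' : F) = k := by
      rw [h2, h2']
      have h4 := Finset.sum_range_succ' (fun i => a ^ ℓ ^ i) f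
      rw [Finset.sum_range_succ, ← hF, FiniteField.pow_card, pow_zero, pow_one] at h4
      rw [add_right_cancel h4]
      refine Finset.sum_congr rfl fun i _ => ?_
      rw [← pow_mul, pow_succ']
    rw [CharP.natCast_eq_natCast F ℓ] at h3
    rw [← pow_mod_orderOf, ← hζ.eq_orderOf, h3, hζ.eq_orderOf, pow_mod_orderOf]
  have hbase := hω.val_gaussSum_inv hF hq hζ1 hπ
    (by rw [hcard]; exact pow_lt_one₀ zero_le hπ (mul_ne_zero hf hℓ1)) hπ0 hψ
  -- one inequality for each exponent
  have key : ∀ d : ℕ → ℕ, v (1 - ζ) ^ (∑ i ∈ Finset.range f, d i) ≤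
      v (gaussSum (ω⁻¹ ^ (∑ i ∈ Finset.range f, d i * ℓ ^ i)) ψ) := by
    intro d
    rw [← Finset.prod_pow_eq_pow_sum, ← Finset.prod_pow_eq_pow_sum]
    refine le_trans ?_ (prod_val_gaussSum_le _ _ hψne)
    refine Finset.prod_le_prod' fun i _ => ?_
    rw [mul_comm, pow_mul, ← hbase, ← gaussSum_pow_char_pow hℓ ω⁻¹ hψfrob i]
    exact val_gaussSum_pow_le _ hψne _
  -- the complementary exponent gives the inverse character
  set k := ∑ i ∈ Finset.range f, c i * ℓ ^ i with hkdef
  set k' := ∑ i ∈ Finset.range f, (ℓ - 1 - c i) * ℓ ^ i with hk'def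
  have hsum : k + k' = Fintype.card F - 1 := by
    have h1 := geom_sum_mul_add (ℓ - 1) f
    rw [Nat.sub_add_cancel hℓ.one_le, Finset.sum_mul] at h1
    rw [hkdef, hk'def, ← Finset.sum_add_distrib, hF, ← h1, Nat.add_sub_cancel]
    refine Finset.sum_congr rfl fun i hi => ?_
    rw [← add_mul, Nat.add_sub_cancel' (hc i hi), mul_comm]
  have hsum' : ∑ i ∈ Finset.range f, c i + ∑ i ∈ Finset.range f, (ℓ - 1 - c i) = f * (ℓ - 1) := by
    rw [← Finset.sum_add_distrib, Finset.sum_congr rfl (fun i hi => by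
      have := hc i hi
      exact (show c i + (ℓ - 1 - c i) = ℓ - 1 by omega)), Finset.sum_const, Finset.card_range,
      smul_eq_mul]
  have hinv : ω⁻¹ ^ k' = (ω⁻¹ ^ k)⁻¹ := by
    rw [eq_inv_iff_mul_eq_one, ← pow_add, add_comm, hsum]
    apply MulChar.ext
    intro a
    rw [MulChar.pow_apply_coe, ← map_pow, FiniteField.pow_card_sub_one_eq_one _ a.ne_zero, map_one,
      MulChar.one_apply_coe]
  have hne : ω⁻¹ ^ k ≠ 1 := by rwa [inv_pow, inv_ne_one]
  have hprod : v (gaussSum (ω⁻¹ ^ k) ψ) * v (gaussSum (ω⁻¹ ^ k') ψ) =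
      v (1 - ζ) ^ (f * (ℓ - 1)) := by
    have h1 := gaussSum_mul_gaussSum_eq_card hne hψ1
    have h2 := mul_gaussSum_inv_eq_gaussSum (ω⁻¹ ^ k)⁻¹ ψ
    rw [hinv, ← h2, map_mul, val_mulChar_of_ne_zero _ (neg_ne_zero.2 one_ne_zero), one_mul,
      ← map_mul, h1, hcard]
  apply le_antisymm _ (key c)
  have h1 := key (fun i => ℓ - 1 - c i)
  rw [← hsum', pow_add] at hprod
  by_contra hlt
  rw [not_le] at hlt
  have h2 := lt_of_lt_of_le (zero_lt_iff.2 (pow_ne_zero _ hπ0)) h1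
  have h3 := (mul_le_mul_right h1 _).trans_lt (mul_lt_mul_of_pos_right hlt h2)
  rw [← hprod] at h3
  exact lt_irrefl _ h3

end LocalGauss

end WeilJacobi

/-! ### Stickelberger's theorem for the valuation at a prime -/

namespace WeilJacobi

section Teichmuller

open IsDedekindDomain

attribute [local instance] residueField residueFintype

variable {K : Type*} [Field K] [NumberField K] {M : Type*} [Field M] [Algebra K M]

/-- The `w`-adic valuation of `K` is dominated by a valuation of any extension field. -/
theorem exists_valuationSubring_le (w : HeightOneSpectrum (𝓞 K)) (M : Type*) [Field M]
    [Algebra K M] : ∃ A : ValuationSubring M, ∀ x : K,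
      (w.valuation K x ≤ 1 → A.valuation (algebraMap K M x) ≤ 1) ∧
      (w.valuation K x < 1 → A.valuation (algebraMap K M x) < 1) := by
  obtain ⟨A, hA⟩ := LocalSubring.exists_le_valuationSubring
    ((w.valuation K).valuationSubring.toLocalSubring.map (algebraMap K M))
  obtain ⟨h1, h2⟩ := LocalSubring.le_def.1 hA
  refine ⟨A, fun x => ?_⟩
  have hle : ∀ x : K, w.valuation K x ≤ 1 → A.valuation (algebraMap K M x) ≤ 1 := by
    intro x hx
    rw [A.valuation_le_one_iff]
    exact h1 (Subring.mem_map.2 ⟨x, hx, rfl⟩)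
  refine ⟨hle x, fun hx => ?_⟩
  refine lt_of_le_of_ne (hle x hx.le) fun h => ?_
  have hmem : algebraMap K M x ∈
      ((w.valuation K).valuationSubring.toLocalSubring.map (algebraMap K M)).toSubring :=
    Subring.mem_map.2 ⟨x, hx.le, rfl⟩
  have hu : IsUnit (Subring.inclusion h1 ⟨_, hmem⟩) := by
    have := (A.valuation_eq_one_iff (Subring.inclusion h1 ⟨_, hmem⟩)).2 h
    exact this
  have := (isUnit_map_iff (Subring.inclusion h1) _).1 hu
  obtain ⟨⟨y, hy⟩, hxy⟩ := this.exists_right_inv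
  obtain ⟨y', hy', rfl⟩ := Subring.mem_map.1 hy
  have hxy' : algebraMap K M x * algebraMap K M y' = 1 := congrArg Subtype.val hxy
  rw [← map_mul, ← map_one (algebraMap K M)] at hxy'
  have h3 := congrArg (w.valuation K) ((algebraMap K M).injective hxy')
  rw [map_mul, map_one] at h3
  have h4 : w.valuation K x * w.valuation K y' < 1 := mul_lt_one_of_lt_of_le hx hy'
  exact h4.ne h3

variable {Γ : Type*} [LinearOrderedCommGroupWithZero Γ] {v : Valuation M Γ}

theorem eq_of_val_sub_lt_one {N : ℕ} (hN : v (N : M) = 1) {x y : M} (hx : x ^ N = 1)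
    (hy : y ^ N = 1) (hxy : v (x - y) < 1) : x = y := by
  have hN0 : N ≠ 0 := by
    rintro rfl
    simp at hN
  have hy0 : y ≠ 0 := by
    rintro rfl
    rw [zero_pow hN0] at hy
    exact zero_ne_one hy
  have hvy := val_eq_one_of_pow_eq_one (v := v) hN0 hy
  set u := x / y with hu
  have hvu : v (u - 1) < 1 := by
    have : u - 1 = (x - y) / y := by rw [hu]; field_simp
    rwa [this, map_div₀, hvy, div_one]
  have huN : u ^ N = 1 := by rw [hu, div_pow, hx, hy, div_one]
  by_contra hne
  have hu1 : u - 1 ≠ 0 := by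
    rw [sub_ne_zero, hu, ne_eq, div_eq_one_iff_eq hy0]
    exact hne
  have hg : ∑ i ∈ Finset.range N, u ^ i = 0 := by
    have := geom_sum_mul u N
    rw [huN, sub_self] at this
    exact (mul_eq_zero.1 this).resolve_right hu1
  have h1 : v (∑ i ∈ Finset.range N, (u ^ i - 1)) < 1 := by
    refine v.map_sum_lt one_ne_zero fun i _ => ?_
    rw [← geom_sum_mul, map_mul]
    refine mul_lt_of_le_one_of_lt (v.map_sum_le fun j _ => ?_) hvu
    rw [map_pow, val_eq_one_of_pow_eq_one hN0 huN, one_pow]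
  rw [Finset.sum_sub_distrib, hg, Finset.sum_const, Finset.card_range, nsmul_eq_mul, mul_one,
    zero_sub, v.map_neg, hN] at h1
  exact lt_irrefl _ h1

theorem val_card_sub_one {q : ℕ} (hq : 0 < q) (h : v (q : M) < 1) : v ((q - 1 : ℕ) : M) = 1 := by
  rw [Nat.cast_sub hq, Nat.cast_one, v.map_sub_swap, v.map_one_sub_of_lt h]

variable {w : HeightOneSpectrum (𝓞 K)}

/-- The residue field at `w` has a Teichmüller character with values in every algebraically closed
field with a valuation that dominates `w`. -/
theorem exists_teichmuller [IsAlgClosed M] [CharZero M]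
    (h1 : ∀ x : 𝓞 K, v (algebraMap K M x) ≤ 1)
    (h2 : ∀ x : 𝓞 K, x ∈ w.asIdeal → v (algebraMap K M x) < 1) :
    ∃ ω : MulChar (𝓞 K ⧸ w.asIdeal) M,
      ∀ x : 𝓞 K, v (ω (Ideal.Quotient.mk w.asIdeal x) - algebraMap K M x) < 1 := by
  classical
  set q := Fintype.card (𝓞 K ⧸ w.asIdeal) with hq
  have hq1 : 1 < q := Fintype.one_lt_card
  have hvq : v (q : M) < 1 := by
    have := h2 (q : 𝓞 K) (by
      rw [← Ideal.Quotient.eq_zero_iff_mem, map_natCast, hq, Nat.cast_card_eq_zero])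
    simpa using this
  have hN := val_card_sub_one (by omega) hvq
  have hN0 : q - 1 ≠ 0 := by omega
  have key : ∀ a : (𝓞 K ⧸ w.asIdeal)ˣ, ∃ y : M, y ^ (q - 1) = 1 ∧
      ∀ x : 𝓞 K, Ideal.Quotient.mk w.asIdeal x = a → v (y - algebraMap K M x) < 1 := by
    intro a
    obtain ⟨x, hx⟩ := Ideal.Quotient.mk_surjective (I := w.asIdeal) (a : 𝓞 K ⧸ w.asIdeal)
    have hxN : v (algebraMap K M x ^ (q - 1) - 1) < 1 := by
      have := h2 (x ^ (q - 1) - 1) (by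
        rw [← Ideal.Quotient.eq_zero_iff_mem, map_sub, map_pow, hx, map_one,
          FiniteField.pow_card_sub_one_eq_one _ a.ne_zero, sub_self])
      simpa using this
    have : NeZero ((q - 1 : ℕ) : M) := ⟨Nat.cast_ne_zero.2 hN0⟩
    obtain ⟨η, hη⟩ := HasEnoughRootsOfUnity.exists_primitiveRoot M (q - 1)
    have hprod := hη.pow_sub_pow_eq_prod_sub_mul (algebraMap K M x) 1 (Nat.pos_of_ne_zero hN0)
    rw [one_pow] at hprod
    rw [hprod, map_prod] at hxN
    obtain ⟨y, hy, hy'⟩ : ∃ y ∈ Polynomial.nthRootsFinset (q - 1) (1 : M),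
        v (algebraMap K M x - y * 1) < 1 := by
      by_contra hcon
      push Not at hcon
      exact absurd hxN (not_lt.2 (Finset.one_le_prod' fun y hy => hcon y hy))
    refine ⟨y, (Polynomial.mem_nthRootsFinset (Nat.pos_of_ne_zero hN0) _).1 hy, fun x' hx' => ?_⟩
    have h3 := h2 (x - x') (by
      rw [← Ideal.Quotient.eq_zero_iff_mem, map_sub, hx, hx', sub_self])
    rw [mul_one, v.map_sub_swap] at hy'
    have := v.map_add_lt hy' h3
    convert this using 2
    simp
  choose y hy hy' using key
  have huniq : ∀ (a : (𝓞 K ⧸ w.asIdeal)ˣ) (u : M), u ^ (q - 1) = 1 →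
      (∃ x : 𝓞 K, Ideal.Quotient.mk w.asIdeal x = a ∧ v (u - algebraMap K M x) < 1) → u = y a := by
    rintro a u hu ⟨x, hx, hux⟩
    refine eq_of_val_sub_lt_one hN hu (hy a) ?_
    have := v.map_sub_lt hux (hy' a x hx)
    convert this using 2
    ring
  let Y : (𝓞 K ⧸ w.asIdeal)ˣ →* M :=
    { toFun := y
      map_one' := (huniq 1 1 (one_pow _) ⟨1, by simp, by simp⟩).symm
      map_mul' := fun a b => by
        symm
        apply huniq
        · rw [mul_pow, hy, hy, one_mul]
        obtain ⟨x, hx⟩ := Ideal.Quotient.mk_surjective (I := w.asIdeal) (a : 𝓞 K ⧸ w.asIdeal)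
        obtain ⟨x', hx'⟩ := Ideal.Quotient.mk_surjective (I := w.asIdeal) (b : 𝓞 K ⧸ w.asIdeal)
        refine ⟨x * x', by rw [map_mul, hx, hx', Units.val_mul], ?_⟩
        have e : y a * y b - algebraMap K M ((x * x' : 𝓞 K) : K) =
            (y a - algebraMap K M x) * y b + algebraMap K M x * (y b - algebraMap K M x') := by
          rw [show ((x * x' : 𝓞 K) : K) = (x : K) * x' from map_mul (algebraMap (𝓞 K) K) x x',
            map_mul]
          ring
        rw [e]
        refine v.map_add_lt ?_ ?_
        · rw [map_mul, val_eq_one_of_pow_eq_one hN0 (hy b), mul_one]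
          exact hy' a x hx
        · rw [map_mul]
          exact mul_lt_of_le_one_of_lt (h1 x) (hy' b x' hx') }
  refine ⟨MulChar.ofUnitHom Y.toHomUnits, fun x => ?_⟩
  by_cases hx : Ideal.Quotient.mk w.asIdeal x = 0
  · rw [hx, MulChar.map_zero, zero_sub, v.map_neg]
    exact h2 x (Ideal.Quotient.eq_zero_iff_mem.1 hx)
  · obtain ⟨a, ha⟩ := (Ne.isUnit hx)
    rw [← ha, MulChar.ofUnitHom_coe]
    exact hy' a x ha.symm

theorem isTeichmuller_of_lift {ω : MulChar (𝓞 K ⧸ w.asIdeal) M}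
    (hω : ∀ x : 𝓞 K, v (ω (Ideal.Quotient.mk w.asIdeal x) - algebraMap K M x) < 1) :
    IsTeichmuller v ω := by
  intro x y
  obtain ⟨x, rfl⟩ := Ideal.Quotient.mk_surjective x
  obtain ⟨y, rfl⟩ := Ideal.Quotient.mk_surjective y
  rw [← map_add]
  have := v.map_sub_lt (hω (x + y)) (v.map_add_lt (hω x) (hω y))
  convert this using 2
  push_cast
  rw [map_add]
  ring

end Teichmuller

section Digits

variable {m ℓ f : ℕ} [NeZero m]

/-- With `r i` the residue of `a ℓ ^ i` modulo `m`, the quotients `ℓ * r i / m` are, in reverse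
order, the digits in base `ℓ` of `a (ℓ ^ f - 1) / m`. -/
theorem exists_digits (hℓ : 0 < ℓ) (hf : m ∣ ℓ ^ f - 1) (a : ZMod m) :
    ∃ c : ℕ → ℕ, (∀ i, c i ≤ ℓ - 1) ∧
      ∑ i ∈ Finset.range f, c i * ℓ ^ i = a.val * ((ℓ ^ f - 1) / m) ∧
      m * ∑ i ∈ Finset.range f, c i =
        (ℓ - 1) * ∑ i ∈ Finset.range f, (a * (ℓ : ZMod m) ^ i).val := by
  have hm : 0 < m := NeZero.pos m
  set r : ℕ → ℕ := fun i => (a * (ℓ : ZMod m) ^ i).val with hr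
  have hstep : ∀ i, ℓ * r i = r (i + 1) + m * (ℓ * r i / m) := by
    intro i
    have : r (i + 1) = (ℓ * r i) % m := by
      rw [hr]
      simp only
      rw [← ZMod.val_natCast, Nat.cast_mul, ZMod.natCast_zmod_val]
      congr 1
      ring
    rw [this, Nat.mod_add_div]
  have hqm : ((ℓ ^ f : ℕ) : ZMod m) = 1 := by
    have h1 : ((ℓ ^ f - 1 : ℕ) : ZMod m) = 0 := (ZMod.natCast_eq_zero_iff _ _).2 hf
    rw [Nat.cast_sub (Nat.one_le_pow _ _ hℓ), sub_eq_zero] at h1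
    rw [h1, Nat.cast_one]
  have hrf : r f = r 0 := by
    simp only [hr]
    rw [← Nat.cast_pow, hqm, pow_zero]
  have hr0 : r 0 = a.val := by simp [hr]
  have htel : ∀ j, ℓ ^ j * r 0 = r j + m * ∑ i ∈ Finset.range j, ℓ * r i / m * ℓ ^ (j - 1 - i) := by
    intro j
    induction j with
    | zero => simp
    | succ j ih =>
      rw [pow_succ', mul_assoc, ih, mul_add, hstep j, Finset.sum_range_succ, Nat.add_sub_cancel,
        Nat.sub_self, pow_zero, mul_one, mul_left_comm, Finset.mul_sum]
      have : ∀ i ∈ Finset.range j, ℓ * (ℓ * r i / m * ℓ ^ (j - 1 - i)) =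
          ℓ * r i / m * ℓ ^ (j - i) := by
        intro i hi
        have := Finset.mem_range.1 hi
        rw [show j - i = j - 1 - i + 1 by omega, pow_succ']
        ring
      rw [Finset.sum_congr rfl this]
      ring
  refine ⟨fun i => ℓ * r (f - 1 - i) / m, fun i => ?_, ?_, ?_⟩
  · apply Nat.le_sub_one_of_lt
    rw [Nat.div_lt_iff_lt_mul hm]
    exact Nat.mul_lt_mul_of_pos_left (ZMod.val_lt _) hℓ
  · have h1 := htel f
    rw [← Finset.sum_range_reflect] at h1
    have h2 : ∀ i ∈ Finset.range f, ℓ * r (f - 1 - i) / m * ℓ ^ (f - 1 - (f - 1 - i)) =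
        ℓ * r (f - 1 - i) / m * ℓ ^ i := by
      intro i hi
      have := Finset.mem_range.1 hi
      rw [show f - 1 - (f - 1 - i) = i by omega]
    rw [Finset.sum_congr rfl h2, hrf, hr0] at h1
    rw [← Nat.mul_div_assoc _ hf]
    symm
    apply Nat.div_eq_of_eq_mul_right hm
    rw [Nat.mul_sub, mul_one, mul_comm, h1, Nat.add_sub_cancel_left]
  · rw [Finset.sum_range_reflect (fun i => ℓ * r i / m) f]
    have h1 : ∑ i ∈ Finset.range f, ℓ * r i =
        ∑ i ∈ Finset.range f, r (i + 1) + m * ∑ i ∈ Finset.range f, ℓ * r i / m := by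
      rw [Finset.mul_sum, ← Finset.sum_add_distrib]
      exact Finset.sum_congr rfl fun i _ => hstep i
    have h2 : ∑ i ∈ Finset.range f, r (i + 1) = ∑ i ∈ Finset.range f, r i := by
      have e1 := Finset.sum_range_succ r f
      have e2 := Finset.sum_range_succ' r f
      rw [hrf] at e1
      omega
    rw [h2, ← Finset.mul_sum] at h1
    rw [Nat.sub_mul, one_mul, h1, Nat.add_sub_cancel_left]

end Digits

section Stickelberger

open IsDedekindDomain

attribute [local instance] residueField residueFintype

variable (p : ℕ) [hp : Fact p.Prime] (n : ℕ) {K : Type*} [Field K] [NumberField K]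
  [IsCyclotomicExtension {p ^ (n + 1)} ℚ K] {M : Type*} [Field M] [Algebra K M]
  {Γ : Type*} [LinearOrderedCommGroupWithZero Γ] {v : Valuation M Γ}

theorem residueChar_spec (w : HeightOneSpectrum (𝓞 K)) (hw : (p : 𝓞 K) ∉ w.asIdeal)
    (x : (𝓞 K ⧸ w.asIdeal)ˣ) :
    residueChar p n w hw x ^ p ^ (n + 1) = 1 ∧
      Ideal.Quotient.mk w.asIdeal (residueChar p n w hw x) =
        ((x⁻¹ ^ ((Nat.card (𝓞 K ⧸ w.asIdeal) - 1) / p ^ (n + 1)) : (𝓞 K ⧸ w.asIdeal)ˣ) :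
          𝓞 K ⧸ w.asIdeal) :=
  (existsUnique_residueChar p n w hw).choose_spec.1 x

theorem residueChar_unique (w : HeightOneSpectrum (𝓞 K)) (hw : (p : 𝓞 K) ∉ w.asIdeal)
    {χ : MulChar (𝓞 K ⧸ w.asIdeal) (𝓞 K)} (h : ∀ x : (𝓞 K ⧸ w.asIdeal)ˣ,
      χ x ^ p ^ (n + 1) = 1 ∧ Ideal.Quotient.mk w.asIdeal (χ x) =
        ((x⁻¹ ^ ((Nat.card (𝓞 K ⧸ w.asIdeal) - 1) / p ^ (n + 1)) : (𝓞 K ⧸ w.asIdeal)ˣ) :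
          𝓞 K ⧸ w.asIdeal)) : χ = residueChar p n w hw :=
  (existsUnique_residueChar p n w hw).choose_spec.2 χ h

theorem residueChar_eq_teichmuller_pow (w : HeightOneSpectrum (𝓞 K)) (hw : (p : 𝓞 K) ∉ w.asIdeal)
    (hvq : v ((Fintype.card (𝓞 K ⧸ w.asIdeal) : ℕ) : M) < 1)
    {ω : MulChar (𝓞 K ⧸ w.asIdeal) M}
    (hω : ∀ x : 𝓞 K, v (ω (Ideal.Quotient.mk w.asIdeal x) - algebraMap K M x) < 1) :
    (residueChar p n w hw).ringHomComp ((algebraMap K M).comp (algebraMap (𝓞 K) K)) =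
      ω⁻¹ ^ ((Fintype.card (𝓞 K ⧸ w.asIdeal) - 1) / p ^ (n + 1)) := by
  classical
  obtain ⟨-, -, -, hd⟩ := exists_residue_root p n w hw
  rw [Nat.card_eq_fintype_card] at hd
  set q := Fintype.card (𝓞 K ⧸ w.asIdeal) with hq
  have hq1 : 1 < q := Fintype.one_lt_card
  apply MulChar.ext
  intro x
  obtain ⟨h1, h2⟩ := residueChar_spec p n w hw x
  refine eq_of_val_sub_lt_one (val_card_sub_one (by omega) hvq) ?_ ?_ ?_
  · obtain ⟨c, hc⟩ := hd
    rw [MulChar.ringHomComp_apply, ← map_pow, hc, pow_mul, h1, one_pow, map_one]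
  · rw [← map_pow, ← Units.val_pow_eq_pow_val, hq, ← Fintype.card_units, pow_card_eq_one,
      Units.val_one, map_one]
  · have h3 := hω (residueChar p n w hw x)
    rw [h2, v.map_sub_swap, Nat.card_eq_fintype_card] at h3
    convert h3 using 2
    congr 1
    rw [MulChar.pow_apply_coe, MulChar.inv_apply, Ring.inverse_unit, Units.val_pow_eq_pow_val,
      map_pow]

theorem residueAddChar_apply {M : Type*} [Field M] (w : HeightOneSpectrum (𝓞 K)) (z : M)
    (hz : z ^ ringChar (𝓞 K ⧸ w.asIdeal) = 1) {f : ℕ}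
    (hf : Fintype.card (𝓞 K ⧸ w.asIdeal) = ringChar (𝓞 K ⧸ w.asIdeal) ^ f)
    (a : 𝓞 K ⧸ w.asIdeal) : ∃ k : ℕ, residueAddChar w z hz a = z ^ k ∧
      (k : 𝓞 K ⧸ w.asIdeal) = ∑ i ∈ Finset.range f, a ^ ringChar (𝓞 K ⧸ w.asIdeal) ^ i := by
  set ℓ := ringChar (𝓞 K ⧸ w.asIdeal) with hℓ
  have hℓp : Fact ℓ.Prime := ⟨ringChar_prime w⟩
  have : NeZero ℓ := ⟨hℓp.out.ne_zero⟩
  let _ : Algebra (ZMod ℓ) (𝓞 K ⧸ w.asIdeal) := ZMod.algebra _ _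
  refine ⟨(Algebra.trace (ZMod ℓ) (𝓞 K ⧸ w.asIdeal) a).val, rfl, ?_⟩
  have h1 := FiniteField.algebraMap_trace_eq_sum_pow (ZMod ℓ) (𝓞 K ⧸ w.asIdeal) a
  have hfr : Module.finrank (ZMod ℓ) (𝓞 K ⧸ w.asIdeal) = f := by
    have h2 := Module.card_eq_pow_finrank (K := ZMod ℓ) (V := 𝓞 K ⧸ w.asIdeal)
    rw [hf, ZMod.card] at h2
    exact (Nat.pow_right_injective hℓp.out.two_le h2).symm
  rw [hfr, Nat.card_zmod] at h1
  rw [← h1, ← map_natCast (algebraMap (ZMod ℓ) (𝓞 K ⧸ w.asIdeal)), ZMod.natCast_zmod_val]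

/-- Stickelberger's theorem: at the prime `w` itself, the `m`-th power of the conjugate of index
`a` of the Gauss sum of `w` has the valuation of `ℓ` to the power `∑ (a ℓ ^ i mod m)`. -/
theorem val_gaussSum_residueChar_pow [IsAlgClosed M] [CharZero M] (w : HeightOneSpectrum (𝓞 K))
    (hw : (p : 𝓞 K) ∉ w.asIdeal) (hp2 : p ≠ 2)
    (h1 : ∀ x : 𝓞 K, v (algebraMap K M x) ≤ 1)
    (h2 : ∀ x : 𝓞 K, x ∈ w.asIdeal → v (algebraMap K M x) < 1) {z : M}
    (hz : IsPrimitiveRoot z (ringChar (𝓞 K ⧸ w.asIdeal))) {f : ℕ}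
    (hf : Fintype.card (𝓞 K ⧸ w.asIdeal) = ringChar (𝓞 K ⧸ w.asIdeal) ^ f)
    (a : (ZMod (p ^ (n + 1)))ˣ) :
    v (gaussSum ((residueChar p n w hw).ringHomComp
      ((algebraMap K M).comp (algebraMap (𝓞 K) K)) ^ a.val.val)
      (residueAddChar w z hz.pow_eq_one)) ^ p ^ (n + 1) =
    v ((ringChar (𝓞 K ⧸ w.asIdeal) : ℕ) : M) ^ ∑ i ∈ Finset.range f,
      ((a : ZMod (p ^ (n + 1))) * (ringChar (𝓞 K ⧸ w.asIdeal) : ZMod (p ^ (n + 1))) ^ i).val := by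
  obtain ⟨-, -, -, hd⟩ := exists_residue_root p n w hw
  rw [Nat.card_eq_fintype_card] at hd
  set ℓ := ringChar (𝓞 K ⧸ w.asIdeal) with hℓ
  have hℓp : ℓ.Prime := ringChar_prime w
  obtain ⟨ω, hω⟩ := exists_teichmuller h1 h2
  have hvℓ : v (ℓ : M) < 1 := by
    have := h2 (ℓ : 𝓞 K) (by
      rw [← Ideal.Quotient.eq_zero_iff_mem, map_natCast, hℓ, ringChar.Nat.cast_ringChar])
    simpa using this
  have hf0 : f ≠ 0 := by
    rintro rfl
    have := Fintype.one_lt_card (α := 𝓞 K ⧸ w.asIdeal)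
    rw [hf, pow_zero] at this
    exact lt_irrefl _ this
  have hvq : v ((Fintype.card (𝓞 K ⧸ w.asIdeal) : ℕ) : M) < 1 := by
    rw [hf, Nat.cast_pow, map_pow]
    exact pow_lt_one₀ zero_le hvℓ hf0
  have hm2 : 2 < p ^ (n + 1) := by
    have h3 := hp.out.two_le
    have h4 := Nat.le_self_pow (Nat.succ_ne_zero n) p
    rw [Nat.succ_eq_add_one] at h4
    omega
  have hq2 : 2 < ℓ ^ f := by
    rw [← hf]
    have h3 : 0 < Fintype.card (𝓞 K ⧸ w.asIdeal) - 1 := by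
      have := Fintype.one_lt_card (α := 𝓞 K ⧸ w.asIdeal)
      omega
    have := Nat.le_of_dvd h3 hd
    omega
  rw [residueChar_eq_teichmuller_pow p n w hw hvq hω, hf]
  rw [hf] at hd
  obtain ⟨c, hc, hk, hD⟩ := exists_digits hℓp.pos hd (a : ZMod (p ^ (n + 1)))
  rw [← pow_mul, mul_comm _ a.val.val, ← hk]
  have hT := isTeichmuller_of_lift hω
  have hk1 : ω ^ (∑ i ∈ Finset.range f, c i * ℓ ^ i) ≠ 1 := by
    have h4 : 0 < (ℓ ^ f - 1) / p ^ (n + 1) :=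
      Nat.div_pos (Nat.le_of_dvd (by omega) hd) (by omega)
    have h3 : 0 < (a : ZMod (p ^ (n + 1))).val := by
      have : Fact (1 < p ^ (n + 1)) := ⟨by omega⟩
      exact Nat.pos_of_ne_zero ((ZMod.val_ne_zero _).2 a.ne_zero)
    apply hT.pow_ne_one
    · rw [hk]
      exact Nat.mul_pos h3 h4
    · rw [hk, hf]
      calc _ < p ^ (n + 1) * ((ℓ ^ f - 1) / p ^ (n + 1)) :=
            Nat.mul_lt_mul_of_pos_right (ZMod.val_lt _) h4
        _ = _ := Nat.mul_div_cancel' hd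
  rw [hT.val_gaussSum_inv_pow hℓp hz hf hq2 hvℓ (residueAddChar_apply w z _ hf)
    (residueAddChar_isPrimitive w z hz) c (fun i _ => hc i) hk1, val_prime_eq hℓp hz, ← pow_mul,
    ← pow_mul, mul_comm _ (p ^ (n + 1)), hD]

end Stickelberger

end WeilJacobi

/-! ### Primes and their Galois conjugates -/

namespace WeilJacobi

section Primes

open IsDedekindDomain
open scoped nonZeroDivisors Pointwise

attribute [local instance] residueField residueFintype

variable {K : Type*} [Field K] [NumberField K]

/-- A prime of `K`, as an element of the group of nonzero fractional ideals. -/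
noncomputable def primeUnit (w : HeightOneSpectrum (𝓞 K)) : (FractionalIdeal (𝓞 K)⁰ K)ˣ :=
  Units.mk0 (w.asIdeal : FractionalIdeal (𝓞 K)⁰ K)
    (FractionalIdeal.coeIdeal_ne_zero.2 w.ne_bot)

theorem primeUnit_mem_idealGroup {p : ℕ} {w : HeightOneSpectrum (𝓞 K)}
    (hw : (p : 𝓞 K) ∉ w.asIdeal) : primeUnit w ∈ idealGroup p K := by
  refine Subgroup.subset_closure ⟨w.asIdeal, ?_, rfl⟩
  rw [Ideal.isCoprime_iff_sup_eq]
  by_contra h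
  have h1 := w.isMaximal.eq_of_le h le_sup_left
  refine hw ?_
  rw [h1]
  exact Ideal.mem_sup_right (Ideal.mem_span_singleton_self _)

/-- The group of fractional ideals prime to `p` is generated by the primes not above `p`. -/
theorem idealGroup_le {p : ℕ} {H : Subgroup (FractionalIdeal (𝓞 K)⁰ K)ˣ}
    (h : ∀ w : HeightOneSpectrum (𝓞 K), (p : 𝓞 K) ∉ w.asIdeal → primeUnit w ∈ H) :
    idealGroup p K ≤ H := by
  rw [idealGroup, Subgroup.closure_le]
  rintro I ⟨𝔞, h𝔞, hI⟩
  have key : ∀ 𝔟 : Ideal (𝓞 K), 𝔟 ≠ 0 → IsCoprime 𝔟 (Ideal.span {(p : 𝓞 K)}) →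
      ∀ J : (FractionalIdeal (𝓞 K)⁰ K)ˣ,
      (J : FractionalIdeal (𝓞 K)⁰ K) = (𝔟 : FractionalIdeal (𝓞 K)⁰ K) → J ∈ H := by
    intro 𝔟
    induction 𝔟 using UniqueFactorizationMonoid.induction_on_prime with
    | h₁ => intro h; exact absurd rfl h
    | h₂ 𝔟 hu =>
      intro _ _ J hJ
      rw [Ideal.isUnit_iff.1 hu, FractionalIdeal.coeIdeal_top, Units.val_eq_one] at hJ
      rw [hJ]
      exact H.one_mem
    | h₃ 𝔟 𝔮 h0 hq ih =>
      intro _ hc J hJ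
      have hc' := IsCoprime.of_mul_left_right hc
      have hcq := IsCoprime.of_mul_left_left hc
      let w : HeightOneSpectrum (𝓞 K) := ⟨𝔮, Ideal.isPrime_of_prime hq, hq.ne_zero⟩
      have hw : (p : 𝓞 K) ∉ w.asIdeal := by
        intro hp
        rw [Ideal.isCoprime_iff_sup_eq] at hcq
        refine w.isPrime.ne_top (top_le_iff.1 (hcq ▸ sup_le le_rfl ?_))
        rwa [Ideal.span_singleton_le_iff_mem]
      have h0' : (𝔟 : FractionalIdeal (𝓞 K)⁰ K) ≠ 0 := FractionalIdeal.coeIdeal_ne_zero.2 h0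
      have : J = primeUnit w * Units.mk0 _ h0' := by
        apply Units.ext
        rw [hJ, FractionalIdeal.coeIdeal_mul]
        rfl
      rw [this]
      exact H.mul_mem (h w hw) (ih h0 hc' _ rfl)
  refine key 𝔞 ?_ h𝔞 I hI
  rintro rfl
  exact I.ne_zero (by rw [hI]; exact FractionalIdeal.coeIdeal_bot)

/-- Two homomorphisms that agree on the primes not above `p` agree on the fractional ideals prime to
`p`. -/
theorem eqOn_idealGroup {p : ℕ} {A : Type*} [Group A]
    {f g : (FractionalIdeal (𝓞 K)⁰ K)ˣ →* A}
    (h : ∀ w : HeightOneSpectrum (𝓞 K), (p : 𝓞 K) ∉ w.asIdeal →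
      f (primeUnit w) = g (primeUnit w)) {I : (FractionalIdeal (𝓞 K)⁰ K)ˣ}
    (hI : I ∈ idealGroup p K) : f I = g I :=
  idealGroup_le (H := f.eqLocus g) h hI

/-- The conjugate `σ(w)` of a prime `w`. -/
noncomputable def galPrime (σ : Gal(K/ℚ)) (w : HeightOneSpectrum (𝓞 K)) :
    HeightOneSpectrum (𝓞 K) where
  asIdeal := σ • w.asIdeal
  isPrime := by have := w.isPrime; infer_instance
  ne_bot := by
    rw [ne_eq, ← Ideal.zero_eq_bot, smul_eq_zero_iff_eq]
    exact w.ne_bot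

theorem mem_galPrime {σ : Gal(K/ℚ)} {w : HeightOneSpectrum (𝓞 K)} {x : 𝓞 K} :
    σ • x ∈ (galPrime σ w).asIdeal ↔ x ∈ w.asIdeal :=
  Ideal.smul_mem_pointwise_smul_iff

theorem natCast_mem_galPrime {σ : Gal(K/ℚ)} {w : HeightOneSpectrum (𝓞 K)} {k : ℕ} :
    (k : 𝓞 K) ∈ (galPrime σ w).asIdeal ↔ (k : 𝓞 K) ∈ w.asIdeal := by
  have h := mem_galPrime (σ := σ) (w := w) (x := (k : 𝓞 K))
  have : σ • (k : 𝓞 K) = k := map_natCast (MulSemiringAction.toRingHom Gal(K/ℚ) (𝓞 K) σ) k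
  rwa [this] at h

theorem not_mem_galPrime (p : ℕ) {w : HeightOneSpectrum (𝓞 K)} (hw : (p : 𝓞 K) ∉ w.asIdeal)
    (σ : Gal(K/ℚ)) : (p : 𝓞 K) ∉ (galPrime σ w).asIdeal :=
  fun h => hw (natCast_mem_galPrime.1 h)

theorem galPrime_mul (σ τ : Gal(K/ℚ)) (w : HeightOneSpectrum (𝓞 K)) :
    galPrime (σ * τ) w = galPrime σ (galPrime τ w) :=
  HeightOneSpectrum.ext (mul_smul σ τ w.asIdeal)

theorem galPrime_one (w : HeightOneSpectrum (𝓞 K)) : galPrime 1 w = w :=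
  HeightOneSpectrum.ext (one_smul _ w.asIdeal)

theorem galFractionalIdeal_primeUnit (σ : Gal(K/ℚ)) (w : HeightOneSpectrum (𝓞 K)) :
    galFractionalIdeal σ (primeUnit w) = primeUnit (galPrime σ w) := by
  apply Units.ext
  ext x
  rw [mem_galFractionalIdeal]
  constructor
  · rintro ⟨y, hy, rfl⟩
    obtain ⟨a, ha, rfl⟩ := (FractionalIdeal.mem_coeIdeal _).1 hy
    exact (FractionalIdeal.mem_coeIdeal _).2 ⟨σ • a, mem_galPrime.2 ha, rfl⟩
  · intro hx
    obtain ⟨a, ha, rfl⟩ := (FractionalIdeal.mem_coeIdeal _).1 hx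
    refine ⟨algebraMap (𝓞 K) K (σ⁻¹ • a), (FractionalIdeal.mem_coeIdeal _).2 ⟨σ⁻¹ • a, ?_, rfl⟩, ?_⟩
    · rwa [← mem_galPrime (σ := σ), smul_inv_smul]
    · change ((σ • σ⁻¹ • a : 𝓞 K) : K) = _
      rw [smul_inv_smul]

/-- The isomorphism between the residue fields at `w` and at `σ(w)`. -/
noncomputable def residueEquiv (σ : Gal(K/ℚ)) (w : HeightOneSpectrum (𝓞 K)) :
    𝓞 K ⧸ w.asIdeal ≃+* 𝓞 K ⧸ (galPrime σ w).asIdeal :=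
  Ideal.quotientEquiv _ _ (MulSemiringAction.toRingEquiv Gal(K/ℚ) (𝓞 K) σ) rfl

theorem residueEquiv_mk (σ : Gal(K/ℚ)) (w : HeightOneSpectrum (𝓞 K)) (x : 𝓞 K) :
    residueEquiv σ w (Ideal.Quotient.mk _ x) = Ideal.Quotient.mk _ (σ • x) := rfl

theorem ringChar_galPrime (σ : Gal(K/ℚ)) (w : HeightOneSpectrum (𝓞 K)) :
    ringChar (𝓞 K ⧸ (galPrime σ w).asIdeal) = ringChar (𝓞 K ⧸ w.asIdeal) := by
  have := ringChar.charP (𝓞 K ⧸ w.asIdeal)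
  have := charP_of_injective_ringHom (f := (residueEquiv σ w).toRingHom)
    (residueEquiv σ w).injective (ringChar (𝓞 K ⧸ w.asIdeal))
  exact (ringChar.eq_iff).2 this

theorem card_galPrime (σ : Gal(K/ℚ)) (w : HeightOneSpectrum (𝓞 K)) :
    Fintype.card (𝓞 K ⧸ (galPrime σ w).asIdeal) = Fintype.card (𝓞 K ⧸ w.asIdeal) :=
  Fintype.card_congr (residueEquiv σ w).symm.toEquiv

theorem exists_card_residue (w : HeightOneSpectrum (𝓞 K)) :
    ∃ f : ℕ, Fintype.card (𝓞 K ⧸ w.asIdeal) = ringChar (𝓞 K ⧸ w.asIdeal) ^ f := by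
  have := ringChar.charP (𝓞 K ⧸ w.asIdeal)
  obtain ⟨f, -, hf⟩ := FiniteField.card (𝓞 K ⧸ w.asIdeal) (ringChar (𝓞 K ⧸ w.asIdeal))
  exact ⟨f, hf⟩

end Primes

/-! ### The Galois action on Gauss sums -/

section Equivariance

open IsDedekindDomain

attribute [local instance] residueField residueFintype

variable (p : ℕ) [hp : Fact p.Prime] (n : ℕ) {K : Type*} [Field K] [NumberField K]
  [IsCyclotomicExtension {p ^ (n + 1)} ℚ K]

theorem residueChar_galPrime (w : HeightOneSpectrum (𝓞 K)) (hw : (p : 𝓞 K) ∉ w.asIdeal)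
    (σ : Gal(K/ℚ)) (a : 𝓞 K ⧸ w.asIdeal) :
    residueChar p n (galPrime σ w) (not_mem_galPrime p hw σ) (residueEquiv σ w a) =
      σ • residueChar p n w hw a := by
  let e := residueEquiv σ w
  let s := MulSemiringAction.toRingHom Gal(K/ℚ) (𝓞 K) σ
  let χ : MulChar (𝓞 K ⧸ (galPrime σ w).asIdeal) (𝓞 K) :=
    { ((residueChar p n w hw).ringHomComp s).toMonoidHom.comp (e.symm : _ →* _) with
      map_nonunit' := fun x hx => by
        refine ((residueChar p n w hw).ringHomComp s).map_nonunit' _ fun h => hx ?_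
        have h1 : IsUnit (e (e.symm x)) := h.map e
        rwa [e.apply_symm_apply] at h1 }
  have hχ : ∀ x, χ x = σ • residueChar p n w hw (e.symm x) := fun x => rfl
  have : χ = residueChar p n (galPrime σ w) (not_mem_galPrime p hw σ) := by
    apply residueChar_unique
    intro x
    obtain ⟨h1, h2⟩ := residueChar_spec p n w hw (Units.map (e.symm : _ →* _) x)
    have h3 : χ x = σ • residueChar p n w hw (Units.map (e.symm : _ →* _) x : (𝓞 K ⧸ w.asIdeal)ˣ) :=
      rfl
    rw [h3]
    refine ⟨by rw [← smul_pow', h1, smul_one], ?_⟩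
    rw [← residueEquiv_mk, h2, Nat.card_eq_fintype_card, Nat.card_eq_fintype_card, card_galPrime,
      ← map_inv, ← map_pow]
    exact e.apply_symm_apply _
  rw [← this, hχ]
  congr 2
  exact e.symm_apply_apply a

theorem residueAddChar_galPrime {M : Type*} [Field M] (w : HeightOneSpectrum (𝓞 K)) (σ : Gal(K/ℚ))
    {x y : M} (hxy : x = y) (hy : y ^ ringChar (𝓞 K ⧸ w.asIdeal) = 1)
    (hx : x ^ ringChar (𝓞 K ⧸ (galPrime σ w).asIdeal) = 1) (a : 𝓞 K ⧸ w.asIdeal) :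
    residueAddChar (galPrime σ w) x hx (residueEquiv σ w a) = residueAddChar w y hy a := by
  subst hxy
  obtain ⟨f, hf⟩ := exists_card_residue w
  obtain ⟨k, h1, h2⟩ := residueAddChar_apply w x hy hf a
  obtain ⟨k', h1', h2'⟩ := residueAddChar_apply (galPrime σ w) x hx (f := f)
    (by rw [card_galPrime, ringChar_galPrime, hf]) (residueEquiv σ w a)
  have := ringChar.charP (𝓞 K ⧸ w.asIdeal)
  have h3 : (k' : 𝓞 K ⧸ w.asIdeal) = k := by
    apply (residueEquiv σ w).injective
    rw [map_natCast, h2', h2, map_sum]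
    simp_rw [map_pow, ringChar_galPrime]
  rw [CharP.natCast_eq_natCast _ (ringChar (𝓞 K ⧸ w.asIdeal))] at h3
  rw [h1, h1', pow_eq_pow_mod k' hy, pow_eq_pow_mod k hy, h3]

/-- The character `χ_w` with values in an extension field of `K`. -/
noncomputable abbrev residueCharIn (L : Type*) [Field L] [Algebra K L]
    (w : HeightOneSpectrum (𝓞 K)) (hw : (p : 𝓞 K) ∉ w.asIdeal) : MulChar (𝓞 K ⧸ w.asIdeal) L :=
  (residueChar p n w hw).ringHomComp ((algebraMap K L).comp (algebraMap (𝓞 K) K))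

variable {L : Type*} [Field L] [Algebra K L]

theorem residueCharIn_pow_eq_one (w : HeightOneSpectrum (𝓞 K)) (hw : (p : 𝓞 K) ∉ w.asIdeal)
    (a : (𝓞 K ⧸ w.asIdeal)ˣ) : residueCharIn p n L w hw a ^ p ^ (n + 1) = 1 := by
  rw [MulChar.ringHomComp_apply, ← map_pow, (residueChar_spec p n w hw a).1, map_one]

variable {z : ℕ → L} (hz : ∀ ℓ : ℕ, ℓ.Prime → ℓ ≠ p → IsPrimitiveRoot (z ℓ) ℓ)

/-- The additive character of the residue field at `w` that belongs to the chosen root of unity. -/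
noncomputable abbrev primeAddChar (w : HeightOneSpectrum (𝓞 K)) (hw : (p : 𝓞 K) ∉ w.asIdeal) :
    AddChar (𝓞 K ⧸ w.asIdeal) L :=
  residueAddChar w (z (ringChar (𝓞 K ⧸ w.asIdeal)))
    (hz _ (ringChar_prime w) (ringChar_ne w hw)).pow_eq_one

/-- An automorphism over `K` multiplies the Gauss sum of `χ ^ j` by the power `j` of a root of unity
that depends only on `χ`. -/
theorem algEquiv_gaussSum_pow (w : HeightOneSpectrum (𝓞 K)) (hw : (p : 𝓞 K) ∉ w.asIdeal)
    (s : L ≃ₐ[K] L) {b : ℕ} (hb : ¬ ringChar (𝓞 K ⧸ w.asIdeal) ∣ b)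
    (hs : s (z (ringChar (𝓞 K ⧸ w.asIdeal))) = z (ringChar (𝓞 K ⧸ w.asIdeal)) ^ b) (j : ℕ) :
    s (gaussSum (residueCharIn p n L w hw ^ j) (primeAddChar p hz w hw)) =
      ((residueCharIn p n L w hw (b : 𝓞 K ⧸ w.asIdeal))⁻¹) ^ j *
        gaussSum (residueCharIn p n L w hw ^ j) (primeAddChar p hz w hw) := by
  have hb0 : (b : 𝓞 K ⧸ w.asIdeal) ≠ 0 := by
    rwa [ne_eq, ringChar.spec]
  obtain ⟨f, hf⟩ := exists_card_residue w
  have hzℓ := hz _ (ringChar_prime w) (ringChar_ne w hw)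
  have h1 : ∀ a, s (primeAddChar p hz w hw a) =
      (primeAddChar p hz w hw).mulShift (b : 𝓞 K ⧸ w.asIdeal) a := by
    intro a
    obtain ⟨k, hk, -⟩ := residueAddChar_apply w _ hzℓ.pow_eq_one hf a
    rw [AddChar.mulShift_apply, ← nsmul_eq_mul, AddChar.map_nsmul_eq_pow, primeAddChar, hk, map_pow,
      hs, pow_right_comm]
  have h2 : ∀ a, s ((residueCharIn p n L w hw ^ j) a) = (residueCharIn p n L w hw ^ j) a := by
    intro a
    by_cases ha : a = 0
    · rw [ha, MulChar.map_zero, map_zero]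
    · obtain ⟨u, rfl⟩ := Ne.isUnit ha
      rw [MulChar.pow_apply_coe, MulChar.ringHomComp_apply, RingHom.comp_apply, map_pow,
        AlgEquiv.commutes]
  have h3 : s (gaussSum (residueCharIn p n L w hw ^ j) (primeAddChar p hz w hw)) =
      gaussSum (residueCharIn p n L w hw ^ j)
        ((primeAddChar p hz w hw).mulShift (b : 𝓞 K ⧸ w.asIdeal)) := by
    rw [gaussSum, gaussSum, map_sum]
    exact Finset.sum_congr rfl fun a _ => by rw [map_mul, h1, h2]
  rw [h3]
  have h4 := gaussSum_mulShift_eq (residueCharIn p n L w hw ^ j) (primeAddChar p hz w hw)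
    (Units.mk0 _ hb0)
  rw [Units.val_mk0] at h4
  rw [h4, MulChar.inv_apply_eq_inv', ← Units.val_mk0 hb0, MulChar.pow_apply_coe, inv_pow]

variable [CharZero L] [IsCyclotomicExtension {m : ℕ | m.Coprime p} K L]

theorem galLift_residueAddChar (w : HeightOneSpectrum (𝓞 K)) (hw : (p : 𝓞 K) ∉ w.asIdeal)
    (σ : Gal(K/ℚ)) (a : 𝓞 K ⧸ w.asIdeal) :
    galLift p n K L σ (primeAddChar p hz w hw a) = primeAddChar p hz w hw a := by
  obtain ⟨f, hf⟩ := exists_card_residue w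
  have hzℓ := hz _ (ringChar_prime w) (ringChar_ne w hw)
  obtain ⟨k, h1, -⟩ := residueAddChar_apply w _ hzℓ.pow_eq_one hf a
  have hmem : z (ringChar (𝓞 K ⧸ w.asIdeal)) ∈ primeToPField p L :=
    IntermediateField.subset_adjoin _ _ ⟨_, (Nat.coprime_primes (ringChar_prime w) hp.out).2
      (ringChar_ne w hw), hzℓ.pow_eq_one⟩
  rw [primeAddChar, h1, map_pow]
  congr 1
  exact (galLift p n K L σ).commutes ⟨_, hmem⟩

/-- `τ(σ(w)) = σ(τ(w))`. -/
theorem primeGaussSum_galPrime (w : HeightOneSpectrum (𝓞 K)) (hw : (p : 𝓞 K) ∉ w.asIdeal)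
    (σ : Gal(K/ℚ)) : primeGaussSum p n hz (galPrime σ w) (not_mem_galPrime p hw σ) =
      galLift p n K L σ (primeGaussSum p n hz w hw) := by
  rw [primeGaussSum, primeGaussSum, map_neg, gaussSum, gaussSum, map_sum]
  congr 1
  symm
  refine Fintype.sum_equiv (residueEquiv σ w).toEquiv _ _ fun a => ?_
  have h1 := galLift_residueAddChar p n hz w hw σ a
  rw [map_mul, h1]
  change _ = residueCharIn p n L _ _ (residueEquiv σ w a) *
    residueAddChar _ _ _ (residueEquiv σ w a)
  rw [residueAddChar_galPrime w σ (by rw [ringChar_galPrime])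
    (hz _ (ringChar_prime w) (ringChar_ne w hw)).pow_eq_one, MulChar.ringHomComp_apply,
    MulChar.ringHomComp_apply, residueChar_galPrime]
  congr 1
  exact galLift_algebraMap p n K L σ _

/-- The conjugates of the Gauss sum of a prime are the Gauss sums of the powers of its character. -/
theorem galLift_primeGaussSum (w : HeightOneSpectrum (𝓞 K)) (hw : (p : 𝓞 K) ∉ w.asIdeal)
    (σ : Gal(K/ℚ)) : galLift p n K L σ (primeGaussSum p n hz w hw) =
      -gaussSum (residueCharIn p n L w hw ^
        (IsCyclotomicExtension.Rat.galEquivZMod (p ^ (n + 1)) K σ).val.val)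
        (primeAddChar p hz w hw) := by
  rw [primeGaussSum, map_neg, gaussSum, gaussSum, map_sum]
  congr 1
  refine Finset.sum_congr rfl fun a _ => ?_
  have h1 := galLift_residueAddChar p n hz w hw σ a
  rw [map_mul, h1]
  congr 1
  by_cases ha : a = 0
  · rw [ha, MulChar.map_zero, MulChar.map_zero, map_zero]
  · obtain ⟨u, rfl⟩ := Ne.isUnit ha
    rw [MulChar.pow_apply_coe, MulChar.ringHomComp_apply, RingHom.comp_apply, galLift_algebraMap,
      IsCyclotomicExtension.Rat.galEquivZMod_apply_of_pow_eq (p ^ (n + 1)) K σ, map_pow]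
    rw [← map_pow, (residueChar_spec p n w hw u).1, map_one]

end Equivariance

end WeilJacobi

/-! ### Modules over an integral group ring -/

namespace WeilJacobi

section GroupRing

variable {G : Type*} [Group G]

theorem single_eq_zsmul (g : G) (c : ℤ) :
    (MonoidAlgebra.single g c : MonoidAlgebra ℤ G) = c • MonoidAlgebra.single g 1 := by
  rw [MonoidAlgebra.smul_single, smul_eq_mul, mul_one]

theorem groupRing_mul_comm [IsMulCommutative G] (x y : MonoidAlgebra ℤ G) : x * y = y * x := by
  induction x using MonoidAlgebra.induction_linear with
  | zero => rw [zero_mul, mul_zero]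
  | add a b ha hb => rw [add_mul, mul_add, ha, hb]
  | single g c =>
    induction y using MonoidAlgebra.induction_linear with
    | zero => rw [zero_mul, mul_zero]
    | add a b ha hb => rw [add_mul, mul_add, ha, hb]
    | single h d =>
      rw [MonoidAlgebra.single_mul_single, MonoidAlgebra.single_mul_single, mul_comm' g h,
        mul_comm c d]

variable [Fintype G]

theorem eq_sum_single {G : Type*} [Fintype G] (δ : MonoidAlgebra ℤ G) :
    δ = ∑ g, MonoidAlgebra.single g (δ.coeff g) := by
  classical
  conv_lhs => rw [← MonoidAlgebra.sum_coeff_single δ]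
  exact Finsupp.sum_fintype _ _ fun g => MonoidAlgebra.single_zero g

theorem groupRing_coeff_mul (x y : MonoidAlgebra ℤ G) (k : G) :
    (x * y).coeff k = ∑ g, x.coeff g * y.coeff (g⁻¹ * k) := by
  conv_lhs => rw [eq_sum_single x]
  rw [Finset.sum_mul, MonoidAlgebra.coeff_sum, Finsupp.finsetSum_apply]
  exact Finset.sum_congr rfl fun g _ => MonoidAlgebra.coeff_single_mul_apply ..

theorem groupRing_smul_eq_sum {V : Type*} [AddCommGroup V] [Module (MonoidAlgebra ℤ G) V]
    (δ : MonoidAlgebra ℤ G) (x : V) :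
    δ • x = ∑ g, δ.coeff g • (MonoidAlgebra.single g (1 : ℤ) • x) := by
  conv_lhs => rw [eq_sum_single δ]
  rw [Finset.sum_smul]
  exact Finset.sum_congr rfl fun g _ => by rw [single_eq_zsmul, smul_assoc]

/-- An element on which the group acts trivially is multiplied by the degree. -/
theorem groupRing_smul_of_fixed {V : Type*} [AddCommGroup V] [Module (MonoidAlgebra ℤ G) V]
    (δ : MonoidAlgebra ℤ G) {x : V} (hx : ∀ g : G, MonoidAlgebra.single g (1 : ℤ) • x = x) :
    δ • x = (∑ g, δ.coeff g) • x := by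
  rw [groupRing_smul_eq_sum, Finset.sum_smul]
  exact Finset.sum_congr rfl fun g _ => by rw [hx]

end GroupRing

section Modules

open scoped nonZeroDivisors

variable {K : Type*} [Field K] [NumberField K]

theorem single_smul_toUnitsModule (σ : Gal(K/ℚ)) (x : Kˣ) :
    MonoidAlgebra.single σ (1 : ℤ) • toUnitsModule K (Additive.ofMul x) =
      toUnitsModule K (Additive.ofMul (σ • x)) := by
  rw [Representation.single_smul, one_smul]
  rfl

variable (p : ℕ) [hp : Fact p.Prime] (n : ℕ) [IsCyclotomicExtension {p ^ (n + 1)} ℚ K]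
  {L : Type*} [Field L] [CharZero L] [Algebra K L] [IsCyclotomicExtension {m : ℕ | m.Coprime p} K L]

theorem single_smul_toBigUnitsModule (σ : Gal(K/ℚ)) (x : Lˣ) :
    MonoidAlgebra.single σ (1 : ℤ) • toBigUnitsModule p n K L (Additive.ofMul x) =
      toBigUnitsModule p n K L (Additive.ofMul (galLift p n K L σ • x)) := by
  rw [Representation.single_smul, one_smul]
  rfl

theorem unitsInclusion_toUnitsModule (x : Kˣ) :
    unitsInclusion p n K L (toUnitsModule K (Additive.ofMul x)) =
      toBigUnitsModule p n K L (Additive.ofMul (Units.map (algebraMap K L : K →* L) x)) :=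
  rfl

theorem unitsInclusion_injective : Function.Injective (unitsInclusion p n K L) := by
  rw [injective_iff_map_eq_zero]
  intro x hx
  obtain ⟨y, rfl⟩ := (toUnitsModule K).surjective x
  obtain ⟨y, rfl⟩ := Additive.ofMul.surjective y
  rw [unitsInclusion_toUnitsModule, EmbeddingLike.map_eq_zero_iff, ofMul_eq_zero] at hx
  have : y = 1 := Units.map_injective (f := (algebraMap K L : K →* L))
    (algebraMap K L).injective (by rw [hx, map_one])
  rw [this, ofMul_one, map_zero]

theorem homInclusion_apply (f : HomSmall p K) (I : Additive (idealGroup p K)) :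
    homInclusion p n K L f I = unitsInclusion p n K L (f I) := rfl

theorem homInclusion_injective : Function.Injective (homInclusion p n K L) := by
  intro f g h
  refine AddMonoidHom.ext fun I => ?_
  refine unitsInclusion_injective p n (L := L) ?_
  rw [← homInclusion_apply, ← homInclusion_apply, h]

end Modules

/-! ### Divisors as elements of the group ring -/

section Divisors

open IsDedekindDomain
open scoped nonZeroDivisors Pointwise

variable {K : Type*} [Field K] [NumberField K]

/-- The group of nonzero fractional ideals is generated by the primes. -/
theorem closure_primeUnit :
    Subgroup.closure (Set.range (primeUnit (K := K))) = ⊤ := by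
  set H := Subgroup.closure (Set.range (primeUnit (K := K)))
  have h1 : idealGroup 1 K ≤ H := idealGroup_le fun w _ => Subgroup.subset_closure ⟨w, rfl⟩
  have h2 : ∀ (𝔞 : Ideal (𝓞 K)) (I : (FractionalIdeal (𝓞 K)⁰ K)ˣ),
      (I : FractionalIdeal (𝓞 K)⁰ K) = 𝔞 → I ∈ H := by
    refine fun 𝔞 I hI => h1 (Subgroup.subset_closure ⟨𝔞, ?_, hI⟩)
    rw [Nat.cast_one, Ideal.span_singleton_one, ← Ideal.one_eq_top]
    exact isCoprime_one_right
  rw [eq_top_iff]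
  rintro I -
  obtain ⟨a, 𝔞, ha, h⟩ := FractionalIdeal.exists_eq_spanSingleton_mul (I : FractionalIdeal (𝓞 K)⁰ K)
  have ha' : algebraMap (𝓞 K) K a ≠ 0 :=
    (map_ne_zero_iff _ (FaithfulSMul.algebraMap_injective (𝓞 K) K)).2 ha
  let A := toPrincipalIdeal (𝓞 K) K (Units.mk0 _ ha')
  have hA : A ∈ H := by
    refine h2 (Ideal.span {a}) _ ?_
    rw [coe_toPrincipalIdeal, FractionalIdeal.coeIdeal_span_singleton]
    rfl
  have hB : A * I ∈ H := by
    refine h2 𝔞 _ ?_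
    rw [Units.val_mul, h, coe_toPrincipalIdeal, ← mul_assoc,
      FractionalIdeal.spanSingleton_mul_spanSingleton, Units.val_mk0, mul_inv_cancel₀ ha',
      FractionalIdeal.spanSingleton_one, one_mul]
  exact (H.mul_mem_cancel_left hA).1 hB

theorem hom_ext_primeUnit {A : Type*} [Group A] {f g : (FractionalIdeal (𝓞 K)⁰ K)ˣ →* A}
    (h : ∀ w, f (primeUnit w) = g (primeUnit w)) : f = g := by
  refine MonoidHom.eq_of_eqOn_dense closure_primeUnit ?_
  rintro _ ⟨w, rfl⟩
  exact h w

/-- The exponent of `v` in a fractional ideal, as a homomorphism. -/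
noncomputable def countHom (v : HeightOneSpectrum (𝓞 K)) :
    (FractionalIdeal (𝓞 K)⁰ K)ˣ →* Multiplicative ℤ where
  toFun I := Multiplicative.ofAdd (FractionalIdeal.count K v (I : FractionalIdeal (𝓞 K)⁰ K))
  map_one' := by rw [Units.val_one, FractionalIdeal.count_one, ofAdd_zero]
  map_mul' I J := by
    rw [Units.val_mul, FractionalIdeal.count_mul K v I.ne_zero J.ne_zero, ofAdd_add]

theorem galPrime_injective (σ : Gal(K/ℚ)) : Function.Injective (galPrime (K := K) σ) := by
  intro v w h
  rw [← galPrime_one v, ← galPrime_one w, ← inv_mul_cancel σ, galPrime_mul, galPrime_mul, h]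

theorem count_galFractionalIdeal (σ : Gal(K/ℚ)) (v : HeightOneSpectrum (𝓞 K))
    (I : (FractionalIdeal (𝓞 K)⁰ K)ˣ) :
    FractionalIdeal.count K (galPrime σ v) (galFractionalIdeal σ I : FractionalIdeal (𝓞 K)⁰ K) =
      FractionalIdeal.count K v (I : FractionalIdeal (𝓞 K)⁰ K) := by
  classical
  have : (countHom (galPrime σ v)).comp (galFractionalIdeal σ) = countHom v := by
    refine hom_ext_primeUnit fun w => ?_
    rw [MonoidHom.comp_apply, galFractionalIdeal_primeUnit]
    refine congrArg Multiplicative.ofAdd ?_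
    rw [primeUnit, primeUnit, Units.val_mk0, Units.val_mk0, FractionalIdeal.count_maximal,
      FractionalIdeal.count_maximal]
    simp only [(galPrime_injective σ).eq_iff]
  exact Multiplicative.ofAdd.injective (DFunLike.congr_fun this I)

theorem galFractionalIdeal_toPrincipalIdeal (σ : Gal(K/ℚ)) (x : Kˣ) :
    galFractionalIdeal σ (toPrincipalIdeal (𝓞 K) K x) = toPrincipalIdeal (𝓞 K) K (σ • x) := by
  apply Units.ext
  ext y
  rw [mem_galFractionalIdeal, coe_toPrincipalIdeal, coe_toPrincipalIdeal]
  simp only [FractionalIdeal.mem_spanSingleton]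
  constructor
  · rintro ⟨_, ⟨a, rfl⟩, rfl⟩
    refine ⟨σ • a, ?_⟩
    rw [Algebra.smul_def, Algebra.smul_def, map_mul]
    rfl
  · rintro ⟨a, rfl⟩
    refine ⟨_, ⟨σ⁻¹ • a, rfl⟩, ?_⟩
    rw [Algebra.smul_def, Algebra.smul_def, map_mul]
    congr 1
    change ((σ • σ⁻¹ • a : 𝓞 K) : K) = _
    rw [smul_inv_smul]

/-- The part of a fractional ideal at the conjugates of the prime `v`, as the element
`∑ g, ord_{g(v)}(I) g` of the group ring. -/
noncomputable def idealOrd (v : HeightOneSpectrum (𝓞 K)) :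
    Additive (FractionalIdeal (𝓞 K)⁰ K)ˣ →+ MonoidAlgebra ℤ Gal(K/ℚ) where
  toFun I := ∑ g, MonoidAlgebra.single g
    (FractionalIdeal.count K (galPrime g v) (I.toMul : FractionalIdeal (𝓞 K)⁰ K))
  map_zero' := by
    refine Finset.sum_eq_zero fun g _ => ?_
    rw [toMul_zero, Units.val_one, FractionalIdeal.count_one, MonoidAlgebra.single_zero]
  map_add' I J := by
    rw [← Finset.sum_add_distrib]
    refine Finset.sum_congr rfl fun g _ => ?_
    rw [toMul_add, Units.val_mul, FractionalIdeal.count_mul K _ (Units.ne_zero _) (Units.ne_zero _),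
      MonoidAlgebra.single_add]

theorem coeff_idealOrd (v : HeightOneSpectrum (𝓞 K)) (I : (FractionalIdeal (𝓞 K)⁰ K)ˣ)
    (g : Gal(K/ℚ)) : (idealOrd v (Additive.ofMul I)).coeff g =
      FractionalIdeal.count K (galPrime g v) (I : FractionalIdeal (𝓞 K)⁰ K) := by
  classical
  change (∑ g, MonoidAlgebra.single g
    (FractionalIdeal.count K (galPrime g v) (I : FractionalIdeal (𝓞 K)⁰ K))).coeff g = _
  rw [MonoidAlgebra.coeff_sum, Finsupp.finsetSum_apply]
  simp only [MonoidAlgebra.coeff_single, Finsupp.single_apply]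
  rw [Finset.sum_ite_eq' Finset.univ g, if_pos (Finset.mem_univ g)]

theorem idealOrd_galFractionalIdeal (v : HeightOneSpectrum (𝓞 K)) (σ : Gal(K/ℚ))
    (I : (FractionalIdeal (𝓞 K)⁰ K)ˣ) :
    idealOrd v (Additive.ofMul (galFractionalIdeal σ I)) =
      MonoidAlgebra.single σ 1 * idealOrd v (Additive.ofMul I) := by
  apply MonoidAlgebra.coeff_injective
  ext g
  rw [MonoidAlgebra.coeff_single_mul_apply, coeff_idealOrd, coeff_idealOrd, one_mul,
    ← count_galFractionalIdeal σ (galPrime (σ⁻¹ * g) v) I, ← galPrime_mul, mul_inv_cancel_left]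

/-- The divisor of an element of `Kˣ` at the conjugates of `v`, as a `ℤ[G]`-linear map to the group
ring. -/
noncomputable def unitsOrd (v : HeightOneSpectrum (𝓞 K)) :
    UnitsModule K →ₗ[MonoidAlgebra ℤ Gal(K/ℚ)] MonoidAlgebra ℤ Gal(K/ℚ) :=
  MonoidAlgebra.equivariantOfLinearOfComm
    ((idealOrd v).comp ((MonoidHom.toAdditive (toPrincipalIdeal (𝓞 K) K)).comp
      (toUnitsModule K).symm.toAddMonoidHom)).toIntLinearMap (by
    intro σ x
    obtain ⟨x, rfl⟩ := (toUnitsModule K).surjective x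
    obtain ⟨x, rfl⟩ := Additive.ofMul.surjective x
    rw [single_smul_toUnitsModule]
    change idealOrd v (Additive.ofMul (toPrincipalIdeal (𝓞 K) K (σ • x))) =
      MonoidAlgebra.single σ 1 * idealOrd v (Additive.ofMul (toPrincipalIdeal (𝓞 K) K x))
    rw [← galFractionalIdeal_toPrincipalIdeal, idealOrd_galFractionalIdeal])

theorem unitsOrd_toUnitsModule (v : HeightOneSpectrum (𝓞 K)) (x : Kˣ) :
    unitsOrd v (toUnitsModule K (Additive.ofMul x)) =
      idealOrd v (Additive.ofMul (toPrincipalIdeal (𝓞 K) K x)) := rfl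

theorem count_eq_neg_log_valuation (v : HeightOneSpectrum (𝓞 K)) (x : Kˣ) :
    v.valuation K (x : K) = WithZero.exp (-FractionalIdeal.count K v
      (toPrincipalIdeal (𝓞 K) K x : FractionalIdeal (𝓞 K)⁰ K)) := by
  have key : ∀ a : 𝓞 K, ∀ ha : algebraMap (𝓞 K) K a ≠ 0, v.valuation K (algebraMap (𝓞 K) K a) =
      WithZero.exp (-FractionalIdeal.count K v
        (toPrincipalIdeal (𝓞 K) K (Units.mk0 _ ha) : FractionalIdeal (𝓞 K)⁰ K)) := by
    intro a ha
    have ha' : a ≠ 0 := by rintro rfl; exact ha (map_zero _)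
    rw [HeightOneSpectrum.valuation_of_algebraMap, HeightOneSpectrum.intValuation_if_neg _ ha',
      coe_toPrincipalIdeal, Units.val_mk0, ← FractionalIdeal.coeIdeal_span_singleton,
      FractionalIdeal.count_coe K v (by rwa [ne_eq, Ideal.zero_eq_bot, Ideal.span_singleton_eq_bot])]
  obtain ⟨a, b, hb, h⟩ := IsFractionRing.div_surjective (A := 𝓞 K) (x : K)
  have hb0 : algebraMap (𝓞 K) K b ≠ 0 := IsFractionRing.to_map_ne_zero_of_mem_nonZeroDivisors hb
  have ha0 : algebraMap (𝓞 K) K a ≠ 0 := by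
    intro h0
    rw [h0, zero_div] at h
    exact x.ne_zero h.symm
  have hx : x = Units.mk0 _ ha0 * (Units.mk0 _ hb0)⁻¹ := by
    apply Units.ext
    rw [← h, div_eq_mul_inv]
    rfl
  rw [hx, Units.val_mul, map_mul, Units.val_inv_eq_inv_val, map_inv₀, Units.val_mk0, Units.val_mk0,
    key a ha0, key b hb0, map_mul, map_inv, Units.val_mul,
    FractionalIdeal.count_mul K v (Units.ne_zero _) (Units.ne_zero _), Units.val_inv_eq_inv_val,
    FractionalIdeal.count_inv, ← WithZero.exp_neg, ← WithZero.exp_add]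
  congr 1
  ring

end Divisors

end WeilJacobi

/-! ### The homomorphism `τ` -/

namespace WeilJacobi

section Generation

open IsDedekindDomain
open scoped nonZeroDivisors

variable (p : ℕ) {K : Type*} [Field K] [NumberField K]

/-- A homomorphism on the fractional ideals prime to `p` is determined by its values on primes. -/
theorem addHom_ext_primeUnit {A : Type*} [AddGroup A] {f g : Additive (idealGroup p K) →+ A}
    (h : ∀ (w : HeightOneSpectrum (𝓞 K)) (hw : (p : 𝓞 K) ∉ w.asIdeal),
      f (Additive.ofMul ⟨primeUnit w, primeUnit_mem_idealGroup hw⟩) =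
        g (Additive.ofMul ⟨primeUnit w, primeUnit_mem_idealGroup hw⟩)) : f = g := by
  refine AddMonoidHom.ext fun I => ?_
  obtain ⟨⟨I, hI⟩, rfl⟩ := Additive.ofMul.surjective I
  let H : Subgroup (FractionalIdeal (𝓞 K)⁰ K)ˣ :=
    ((AddMonoidHom.toMultiplicativeRight f).eqLocus
      (AddMonoidHom.toMultiplicativeRight g)).map (idealGroup p K).subtype
  have hH : idealGroup p K ≤ H := by
    refine idealGroup_le fun w hw => ?_
    exact ⟨⟨primeUnit w, primeUnit_mem_idealGroup hw⟩,
      congrArg Multiplicative.ofAdd (h w hw), rfl⟩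
  obtain ⟨⟨J, hJ⟩, h1, h2⟩ := hH hI
  have h2' : J = I := h2
  subst h2'
  exact Multiplicative.ofAdd.injective h1

/-- The values at primes decide whether a homomorphism takes values in a subgroup. -/
theorem forall_mem_of_primeUnit {A : Type*} [AddCommGroup A] {f : Additive (idealGroup p K) →+ A}
    {B : AddSubgroup A}
    (h : ∀ (w : HeightOneSpectrum (𝓞 K)) (hw : (p : 𝓞 K) ∉ w.asIdeal),
      f (Additive.ofMul ⟨primeUnit w, primeUnit_mem_idealGroup hw⟩) ∈ B)
    (I : Additive (idealGroup p K)) : f I ∈ B := by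
  have : (QuotientAddGroup.mk' B).comp f = 0 :=
    addHom_ext_primeUnit p fun w hw => (QuotientAddGroup.eq_zero_iff _).2 (h w hw)
  exact (QuotientAddGroup.eq_zero_iff _).1 (DFunLike.congr_fun this I)

end Generation

section Tau

open IsDedekindDomain
open scoped nonZeroDivisors

attribute [local instance] residueField residueFintype

variable (p : ℕ) [hp : Fact p.Prime] (n : ℕ) {K : Type*} [Field K] [NumberField K]
  [IsCyclotomicExtension {p ^ (n + 1)} ℚ K] {L : Type*} [Field L] [CharZero L] [Algebra K L]
  {z : ℕ → L} (hz : ∀ ℓ : ℕ, ℓ.Prime → ℓ ≠ p → IsPrimitiveRoot (z ℓ) ℓ)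

theorem tauAll_primeUnit (w : HeightOneSpectrum (𝓞 K)) (hw : (p : 𝓞 K) ∉ w.asIdeal) :
    tauAll p n hz (primeUnit w) =
      Units.mk0 (primeGaussSum p n hz w hw) (primeGaussSum_ne_zero p n hz w hw) := by
  refine (finprod_eq_single _ w fun v hv => ?_).trans ?_
  · rw [primeUnit, Units.val_mk0, FractionalIdeal.count_maximal_coprime K v hv.symm, zpow_zero]
  · rw [primeUnit, Units.val_mk0, FractionalIdeal.count_self, zpow_one, dif_pos hw]

theorem val_tauAll_primeUnit (w : HeightOneSpectrum (𝓞 K)) (hw : (p : 𝓞 K) ∉ w.asIdeal) :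
    (tauAll p n hz (primeUnit w) : L) = primeGaussSum p n hz w hw := by
  rw [tauAll_primeUnit p n hz w hw, Units.val_mk0]

variable [IsCyclotomicExtension {m : ℕ | m.Coprime p} K L]

/-- The homomorphism `τ` is equivariant on the fractional ideals prime to `p`. -/
theorem tauAll_galFractionalIdeal (σ : Gal(K/ℚ)) {I : (FractionalIdeal (𝓞 K)⁰ K)ˣ}
    (hI : I ∈ idealGroup p K) :
    tauAll p n hz (galFractionalIdeal σ I) = galLift p n K L σ • tauAll p n hz I := by
  refine eqOn_idealGroup (f := (tauAll p n hz).comp (galFractionalIdeal σ))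
    (g := (MulDistribMulAction.toMonoidHom Lˣ (galLift p n K L σ)).comp (tauAll p n hz))
    (fun w hw => ?_) hI
  rw [MonoidHom.comp_apply, galFractionalIdeal_primeUnit]
  apply Units.ext
  rw [val_tauAll_primeUnit p n hz _ (not_mem_galPrime p hw σ), primeGaussSum_galPrime p n hz w hw,
    ← val_tauAll_primeUnit p n hz w hw]
  rfl

theorem tau_galIdeal (σ : Gal(K/ℚ)) (I : idealGroup p K) :
    tau p n K hz (Additive.ofMul (galIdeal p σ I)) =
      MonoidAlgebra.single σ (1 : ℤ) • tau p n K hz (Additive.ofMul I) := by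
  change toBigUnitsModule p n K L (Additive.ofMul (tauAll p n hz (galFractionalIdeal σ I))) =
    MonoidAlgebra.single σ (1 : ℤ) • toBigUnitsModule p n K L (Additive.ofMul (tauAll p n hz (I : (FractionalIdeal (𝓞 K)⁰ K)ˣ)))
  rw [single_smul_toBigUnitsModule, tauAll_galFractionalIdeal p n hz σ I.2]

/-- Every multiple of `τ` is equivariant. -/
theorem smul_tau_galIdeal (δ : MonoidAlgebra ℤ Gal(K/ℚ)) (σ : Gal(K/ℚ)) (I : idealGroup p K) :
    (δ • tau p n K hz) (Additive.ofMul (galIdeal p σ I)) =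
      MonoidAlgebra.single σ (1 : ℤ) • (δ • tau p n K hz) (Additive.ofMul I) := by
  have := IsCyclotomicExtension.isMulCommutative {p ^ (n + 1)} ℚ K
  rw [AddMonoidHom.smul_apply, AddMonoidHom.smul_apply, tau_galIdeal, ← mul_smul, ← mul_smul,
    groupRing_mul_comm]

/-- A homomorphism to `Kˣ` that becomes a multiple of `τ` is equivariant. -/
theorem mem_equivariantHom {δ : MonoidAlgebra ℤ Gal(K/ℚ)} {f : HomSmall p K}
    (hf : homInclusion p n K L f = δ • tau p n K hz) : f ∈ equivariantHom p n K := by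
  intro σ I
  apply unitsInclusion_injective p n (L := L)
  rw [map_smul, ← homInclusion_apply, ← homInclusion_apply, hf, smul_tau_galIdeal]

end Tau

section Norm

open IsDedekindDomain
open scoped nonZeroDivisors

attribute [local instance] residueField residueFintype

variable (p : ℕ) [hp : Fact p.Prime] (n : ℕ) (K : Type*) [Field K] [NumberField K]
  [IsCyclotomicExtension {p ^ (n + 1)} ℚ K]

/-- The automorphism `σ_{-1}` of `K`, that is, complex conjugation. -/
noncomputable def conjAut : Gal(K/ℚ) :=
  (IsCyclotomicExtension.Rat.galEquivZMod (p ^ (n + 1)) K).symm (-1)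

theorem galEquivZMod_conjAut :
    IsCyclotomicExtension.Rat.galEquivZMod (p ^ (n + 1)) K (conjAut p n K) = -1 :=
  MulEquiv.apply_symm_apply _ _

theorem conjAut_mul_self : conjAut p n K * conjAut p n K = 1 := by
  rw [conjAut, ← map_mul, neg_mul_neg, one_mul, map_one]

theorem conjAut_inv : (conjAut p n K)⁻¹ = conjAut p n K :=
  inv_eq_of_mul_eq_one_left (conjAut_mul_self p n K)

variable {K} {L : Type*} [Field L] [Algebra K L]

theorem residueCharIn_neg_one (hp2 : p ≠ 2) (w : HeightOneSpectrum (𝓞 K))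
    (hw : (p : 𝓞 K) ∉ w.asIdeal) : residueCharIn p n L w hw (-1) = 1 := by
  have h1 : residueCharIn p n L w hw (-1) ^ p ^ (n + 1) = 1 := by
    have := residueCharIn_pow_eq_one p n (L := L) w hw (-1)
    rwa [Units.val_neg, Units.val_one] at this
  have h2 : residueCharIn p n L w hw (-1) ^ 2 = 1 := by
    rw [← map_pow, neg_one_sq, map_one]
  have h3 : Nat.Coprime 2 (p ^ (n + 1)) :=
    ((Nat.coprime_primes Nat.prime_two hp.out).2 hp2.symm).pow_right _
  have h4 := orderOf_dvd_of_pow_eq_one h1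
  have h5 := orderOf_dvd_of_pow_eq_one h2
  have h6 := Nat.eq_one_of_dvd_coprimes h3 h5 h4
  rwa [orderOf_eq_one_iff] at h6

variable {z : ℕ → L} (hz : ∀ ℓ : ℕ, ℓ.Prime → ℓ ≠ p → IsPrimitiveRoot (z ℓ) ℓ)
  [CharZero L] [IsCyclotomicExtension {m : ℕ | m.Coprime p} K L]

/-- The Gauss sum times its complex conjugate is the number of elements of the residue field. -/
theorem primeGaussSum_mul_conj (hp2 : p ≠ 2) (w : HeightOneSpectrum (𝓞 K))
    (hw : (p : 𝓞 K) ∉ w.asIdeal) :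
    primeGaussSum p n hz w hw * galLift p n K L (conjAut p n K) (primeGaussSum p n hz w hw) =
      (Fintype.card (𝓞 K ⧸ w.asIdeal) : L) := by
  have hm : 1 < p ^ (n + 1) := Nat.one_lt_pow (Nat.succ_ne_zero n) hp.out.one_lt
  have hinv : residueCharIn p n L w hw ^ (-1 : (ZMod (p ^ (n + 1)))ˣ).val.val =
      (residueCharIn p n L w hw)⁻¹ := by
    have h1 : (-1 : (ZMod (p ^ (n + 1)))ˣ).val.val + 1 = p ^ (n + 1) := by
      obtain ⟨k, hk⟩ : ∃ k, p ^ (n + 1) = k + 1 := ⟨p ^ (n + 1) - 1, by omega⟩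
      rw [Units.val_neg, Units.val_one]
      generalize p ^ (n + 1) = q at hk
      subst hk
      rw [ZMod.val_neg_one]
    refine eq_inv_of_mul_eq_one_left ?_
    rw [← pow_succ, h1]
    ext a
    rw [MulChar.pow_apply_coe, residueCharIn_pow_eq_one, MulChar.one_apply_coe]
  rw [galLift_primeGaussSum, galEquivZMod_conjAut, hinv, primeGaussSum, neg_mul_neg]
  have hne : residueCharIn p n L w hw ≠ 1 := by
    rw [MulChar.ringHomComp_ne_one_iff]
    · exact residueChar_ne_one p n w hw
    · exact (algebraMap K L).injective.comp RingOfIntegers.coe_injective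
  have hinv2 : (residueCharIn p n L w hw)⁻¹ (-1) = 1 := by
    have h0 : (-1 : 𝓞 K ⧸ w.asIdeal) = ((-1 : (𝓞 K ⧸ w.asIdeal)ˣ) : 𝓞 K ⧸ w.asIdeal) := by
      rw [Units.val_neg, Units.val_one]
    rw [MulChar.inv_apply_eq_inv', residueCharIn_neg_one p n hp2 w hw, inv_one]
  have h := gaussSum_mul_gaussSum_eq_card hne
    (residueAddChar_isPrimitive w _ (hz _ (ringChar_prime w) (ringChar_ne w hw)))
  have h2 := mul_gaussSum_inv_eq_gaussSum (residueCharIn p n L w hw)⁻¹ (primeAddChar p hz w hw)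
  rw [hinv2, one_mul] at h2
  rw [h2] at h
  exact h

/-- `τ` times its complex conjugate is the absolute norm. -/
theorem tau_add_conj (hp2 : p ≠ 2) (I : idealGroup p K) :
    tau p n K hz (Additive.ofMul I) +
        MonoidAlgebra.single (conjAut p n K) (1 : ℤ) • tau p n K hz (Additive.ofMul I) =
      unitsInclusion p n K L (toUnitsModule K (Additive.ofMul
        (Units.map (algebraMap ℚ K : ℚ →* K) (Units.map
          (FractionalIdeal.absNorm (R := 𝓞 K) (K := K) : FractionalIdeal (𝓞 K)⁰ K →* ℚ)
            (I : (FractionalIdeal (𝓞 K)⁰ K)ˣ))))) := by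
  change toBigUnitsModule p n K L (Additive.ofMul (tauAll p n hz (I : (FractionalIdeal (𝓞 K)⁰ K)ˣ))) +
    MonoidAlgebra.single (conjAut p n K) (1 : ℤ) •
      toBigUnitsModule p n K L (Additive.ofMul (tauAll p n hz (I : (FractionalIdeal (𝓞 K)⁰ K)ˣ))) = _
  rw [single_smul_toBigUnitsModule, unitsInclusion_toUnitsModule, ← map_add, ← ofMul_mul]
  congr 2
  refine eqOn_idealGroup
    (f := tauAll p n hz * (MulDistribMulAction.toMonoidHom Lˣ
      (galLift p n K L (conjAut p n K))).comp (tauAll p n hz))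
    (g := ((Units.map (algebraMap K L : K →* L)).comp
      (Units.map (algebraMap ℚ K : ℚ →* K))).comp
        (Units.map (FractionalIdeal.absNorm (R := 𝓞 K) (K := K) : FractionalIdeal (𝓞 K)⁰ K →* ℚ)))
    (fun w hw => ?_) I.2
  apply Units.ext
  have h1 := primeGaussSum_mul_conj p n hz hp2 w hw
  rw [← val_tauAll_primeUnit p n hz w hw] at h1
  refine Eq.trans h1 ?_
  change _ = algebraMap K L (algebraMap ℚ K (FractionalIdeal.absNorm
    (w.asIdeal : FractionalIdeal (𝓞 K)⁰ K)))
  rw [FractionalIdeal.coeIdeal_absNorm, map_natCast, map_natCast, Ideal.absNorm_apply,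
    Submodule.cardQuot_apply, Nat.card_eq_fintype_card]

end Norm

end WeilJacobi

/-! ### The multiples of `τ` with values in `Kˣ` -/

namespace WeilJacobi

section ResidueDegree

open IsDedekindDomain

attribute [local instance] residueField residueFintype

variable {K : Type*} [Field K]

theorem natCast_mem_iff (w : HeightOneSpectrum (𝓞 K)) (k : ℕ) :
    (k : 𝓞 K) ∈ w.asIdeal ↔ ringChar (𝓞 K ⧸ w.asIdeal) ∣ k := by
  rw [← ringChar.spec, ← map_natCast (Ideal.Quotient.mk w.asIdeal), Ideal.Quotient.eq_zero_iff_mem]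

theorem liesOver_ringChar (w : HeightOneSpectrum (𝓞 K)) :
    w.asIdeal.LiesOver (Ideal.span {(ringChar (𝓞 K ⧸ w.asIdeal) : ℤ)}) := by
  refine ⟨?_⟩
  ext k
  rw [Ideal.mem_span_singleton, Ideal.mem_comap, eq_intCast, ← Ideal.Quotient.eq_zero_iff_mem,
    map_intCast]
  have := ringChar.charP (𝓞 K ⧸ w.asIdeal)
  exact (CharP.intCast_eq_zero_iff (𝓞 K ⧸ w.asIdeal) _ k).symm

variable [NumberField K]

/-- The residue degree of a prime above `ℓ` is the order of `ℓ` modulo `m`. -/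
theorem card_residue_eq_pow_orderOf (m : ℕ) [NeZero m] [IsCyclotomicExtension {m} ℚ K]
    (w : HeightOneSpectrum (𝓞 K)) (hw : (m : 𝓞 K) ∉ w.asIdeal) :
    Fintype.card (𝓞 K ⧸ w.asIdeal) =
      ringChar (𝓞 K ⧸ w.asIdeal) ^ orderOf (ringChar (𝓞 K ⧸ w.asIdeal) : ZMod m) := by
  have := liesOver_ringChar w
  have : Fact (ringChar (𝓞 K ⧸ w.asIdeal)).Prime := ⟨ringChar_prime w⟩
  have h := Ideal.absNorm_pow_inertiaDeg (Ideal.span {(ringChar (𝓞 K ⧸ w.asIdeal) : ℤ)}) w.asIdeal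
  rw [natCast_mem_iff] at hw
  rw [IsCyclotomicExtension.Rat.inertiaDeg_eq_of_not_dvd (m := m) (ringChar (𝓞 K ⧸ w.asIdeal)) K _
    hw] at h
  rw [← Nat.card_eq_fintype_card, ← Submodule.cardQuot_apply, ← Ideal.absNorm_apply, ← h]
  simp

/-- There is a prime of degree one with a residue field of characteristic prime to `m`, by
Dirichlet's theorem on primes in arithmetic progressions. -/
theorem exists_prime_residue_degree_one (m : ℕ) [NeZero m] [IsCyclotomicExtension {m} ℚ K] :
    ∃ w : HeightOneSpectrum (𝓞 K), (m : 𝓞 K) ∉ w.asIdeal ∧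
      Fintype.card (𝓞 K ⧸ w.asIdeal) = ringChar (𝓞 K ⧸ w.asIdeal) ∧
      (ringChar (𝓞 K ⧸ w.asIdeal) : ZMod m) = 1 := by
  obtain ⟨ℓ, hℓ, hm, h1⟩ := Nat.exists_prime_gt_modEq_one m (NeZero.ne m)
  have hprime : (Ideal.span {(ℓ : ℤ)}).IsPrime :=
    (Ideal.span_singleton_prime (Nat.cast_ne_zero.2 hℓ.ne_zero)).2 (Nat.prime_iff_prime_int.1 hℓ)
  have hbot : Ideal.span {(ℓ : ℤ)} ≠ ⊥ := by
    rw [ne_eq, Ideal.span_singleton_eq_bot]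
    exact Nat.cast_ne_zero.2 hℓ.ne_zero
  have hmax : (Ideal.span {(ℓ : ℤ)}).IsMaximal := hprime.isMaximal hbot
  obtain ⟨Q, hQ, hQℓ⟩ :=
    Ideal.exists_maximal_ideal_liesOver_of_isIntegral (S := 𝓞 K) (Ideal.span {(ℓ : ℤ)})
  let w : HeightOneSpectrum (𝓞 K) := ⟨Q, hQ.isPrime, Ideal.ne_bot_of_liesOver_of_ne_bot hbot Q⟩
  have hwℓ : (ℓ : 𝓞 K) ∈ w.asIdeal := by
    have : (ℓ : ℤ) ∈ Q.under ℤ := by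
      rw [← hQℓ.over]; exact Ideal.mem_span_singleton_self _
    rw [Ideal.mem_comap] at this
    simpa using this
  have hc : ringChar (𝓞 K ⧸ w.asIdeal) = ℓ :=
    (Nat.prime_dvd_prime_iff_eq (ringChar_prime w) hℓ).1 ((natCast_mem_iff w ℓ).1 hwℓ)
  have hm' : (m : 𝓞 K) ∉ w.asIdeal := by
    rw [natCast_mem_iff, hc]
    exact fun h => absurd (Nat.le_of_dvd (NeZero.pos m) h) (not_le.2 hm)
  have h1' : (ringChar (𝓞 K ⧸ w.asIdeal) : ZMod m) = 1 := by
    rw [hc]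
    have := (ZMod.natCast_eq_natCast_iff ℓ 1 m).2 h1
    rwa [Nat.cast_one] at this
  refine ⟨w, hm', ?_, h1'⟩
  rw [card_residue_eq_pow_orderOf m w hm', h1', orderOf_one, pow_one]

end ResidueDegree

section CoefficientIdeal

variable (p : ℕ) [hp : Fact p.Prime] (n : ℕ) (K : Type*) [Field K] [NumberField K]
  [IsCyclotomicExtension {p ^ (n + 1)} ℚ K]

/-- The ring homomorphism `ℤ[G] → ℤ/p ^ (n + 1)` through which `ℤ[G]` acts on the
`p ^ (n + 1)`-th roots of unity. -/
noncomputable def cyclotomicHom : MonoidAlgebra ℤ Gal(K/ℚ) →ₐ[ℤ] ZMod (p ^ (n + 1)) :=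
  MonoidAlgebra.lift ℤ (ZMod (p ^ (n + 1))) Gal(K/ℚ) ((Units.coeHom _).comp
    (IsCyclotomicExtension.Rat.galEquivZMod (p ^ (n + 1)) K).toMonoidHom)

theorem cyclotomicHom_single (σ : Gal(K/ℚ)) (c : ℤ) :
    cyclotomicHom p n K (MonoidAlgebra.single σ c) =
      c * (IsCyclotomicExtension.Rat.galEquivZMod (p ^ (n + 1)) K σ : ZMod (p ^ (n + 1))) := by
  rw [cyclotomicHom, MonoidAlgebra.lift_single, zsmul_eq_mul]
  rfl

theorem cyclotomicHom_eq_intCast (δ : MonoidAlgebra ℤ Gal(K/ℚ)) :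
    cyclotomicHom p n K δ = ((∑ g, δ.coeff g *
      ((IsCyclotomicExtension.Rat.galEquivZMod (p ^ (n + 1)) K g).val.val : ℤ) : ℤ) :
        ZMod (p ^ (n + 1))) := by
  conv_lhs => rw [eq_sum_single δ]
  rw [map_sum, Int.cast_sum]
  refine Finset.sum_congr rfl fun g _ => ?_
  rw [cyclotomicHom_single, Int.cast_mul, Int.cast_natCast, ZMod.natCast_zmod_val]

theorem single_sub_single_mem_stickelbergerCoeffIdeal (g : Gal(K/ℚ)) {t : ℤ}
    (ht : (t : ZMod (p ^ (n + 1))) = IsCyclotomicExtension.Rat.galEquivZMod (p ^ (n + 1)) K g) :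
    (MonoidAlgebra.single 1 t - MonoidAlgebra.single g 1 : MonoidAlgebra ℤ Gal(K/ℚ)) ∈
      stickelbergerCoeffIdeal p n K := by
  have hu : IsCoprime t ((p ^ (n + 1) : ℕ) : ℤ) := by
    rw [isCoprime_comm, ← ZMod.coe_int_isUnit_iff_isCoprime, ht]
    exact Units.isUnit _
  have hcop : IsCoprime t (p : ℤ) := by
    rw [Nat.cast_pow] at hu
    exact hu.of_isCoprime_of_dvd_right (dvd_pow_self _ (Nat.succ_ne_zero n))
  refine Ideal.subset_span ⟨t, hcop, ?_⟩
  congr 2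
  rw [sigma, MulEquiv.eq_symm_apply]
  ext
  rw [ZMod.coe_unitOfIsCoprime, ht]

/-- `S'` is the annihilator in `ℤ[G]` of the `p ^ (n + 1)`-th roots of unity. -/
theorem mem_stickelbergerCoeffIdeal_iff (δ : MonoidAlgebra ℤ Gal(K/ℚ)) :
    δ ∈ stickelbergerCoeffIdeal p n K ↔ cyclotomicHom p n K δ = 0 := by
  constructor
  · intro h
    have : stickelbergerCoeffIdeal p n K ≤ RingHom.ker (cyclotomicHom p n K) := by
      rw [stickelbergerCoeffIdeal, Ideal.span_le]
      rintro _ ⟨t, ht, rfl⟩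
      rw [SetLike.mem_coe, RingHom.mem_ker, map_sub, cyclotomicHom_single, cyclotomicHom_single,
        map_one, sigma, MulEquiv.apply_symm_apply, ZMod.coe_unitOfIsCoprime, Units.val_one,
        Int.cast_one, mul_one, one_mul, sub_self]
    exact this h
  · intro h
    set S := stickelbergerCoeffIdeal p n K
    rw [cyclotomicHom_eq_intCast, ZMod.intCast_zmod_eq_zero_iff_dvd] at h
    obtain ⟨k, hk⟩ := h
    -- `p ^ (n + 1) = (1 + p ^ (n + 1)) - 1` lies in `S'`, as `σ_t = 1` for `t = 1 + p ^ (n + 1)`.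
    have hm : (MonoidAlgebra.single 1 ((p ^ (n + 1) : ℕ) : ℤ) : MonoidAlgebra ℤ Gal(K/ℚ)) ∈ S := by
      have := single_sub_single_mem_stickelbergerCoeffIdeal p n K 1
        (t := 1 + ((p ^ (n + 1) : ℕ) : ℤ)) (by
          rw [map_one, Units.val_one, Int.cast_add, Int.cast_one, Int.cast_natCast,
            ZMod.natCast_self, add_zero])
      rwa [MonoidAlgebra.single_add, add_sub_cancel_left] at this
    have h2 : δ = MonoidAlgebra.single 1 k * MonoidAlgebra.single 1 ((p ^ (n + 1) : ℕ) : ℤ) -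
        ∑ g, MonoidAlgebra.single 1 (δ.coeff g) * (MonoidAlgebra.single 1
          ((IsCyclotomicExtension.Rat.galEquivZMod (p ^ (n + 1)) K g).val.val : ℤ) -
            MonoidAlgebra.single g 1) := by
      conv_lhs => rw [eq_sum_single δ]
      simp_rw [mul_sub, MonoidAlgebra.single_mul_single, one_mul, mul_one]
      rw [Finset.sum_sub_distrib, mul_comm k, ← hk]
      have : ∀ f : Gal(K/ℚ) → ℤ, (MonoidAlgebra.single 1 (∑ g, f g) : MonoidAlgebra ℤ Gal(K/ℚ)) =
          ∑ g, MonoidAlgebra.single 1 (f g) :=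
        fun f => map_sum (MonoidAlgebra.singleAddHom (1 : Gal(K/ℚ))) f Finset.univ
      rw [this, sub_sub_cancel]
    rw [h2]
    refine S.sub_mem (S.mul_mem_left _ hm) (S.sum_mem fun g _ => S.mul_mem_left _ ?_)
    refine single_sub_single_mem_stickelbergerCoeffIdeal p n K g ?_
    rw [Int.cast_natCast, ZMod.natCast_zmod_val]

end CoefficientIdeal

section Rationality

open IsDedekindDomain
open scoped nonZeroDivisors

attribute [local instance] residueField residueFintype

variable (p : ℕ) [hp : Fact p.Prime] (n : ℕ) {K : Type*} [Field K] [NumberField K]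
  [IsCyclotomicExtension {p ^ (n + 1)} ℚ K] {L : Type*} [Field L] [CharZero L] [Algebra K L]
  {z : ℕ → L} (hz : ∀ ℓ : ℕ, ℓ.Prime → ℓ ≠ p → IsPrimitiveRoot (z ℓ) ℓ)
  [IsCyclotomicExtension {m : ℕ | m.Coprime p} K L]

/-- The ideal `w`, prime to `p`, as an element of the additive group of ideals. -/
noncomputable abbrev addPrime (w : HeightOneSpectrum (𝓞 K)) (hw : (p : 𝓞 K) ∉ w.asIdeal) :
    Additive (idealGroup p K) :=
  Additive.ofMul ⟨primeUnit w, primeUnit_mem_idealGroup hw⟩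

theorem smul_tau_addPrime (δ : MonoidAlgebra ℤ Gal(K/ℚ)) (w : HeightOneSpectrum (𝓞 K))
    (hw : (p : 𝓞 K) ∉ w.asIdeal) :
    (δ • tau p n K hz) (addPrime p w hw) = toBigUnitsModule p n K L (Additive.ofMul
      (∏ g, (galLift p n K L g • tauAll p n hz (primeUnit w)) ^ δ.coeff g)) := by
  rw [AddMonoidHom.smul_apply, groupRing_smul_eq_sum, ofMul_prod, map_sum]
  refine Finset.sum_congr rfl fun g _ => ?_
  rw [ofMul_zpow, map_zsmul, ← single_smul_toBigUnitsModule]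
  rfl

/-- An automorphism over `K` multiplies `τ(w) ^ δ` by a power of a root of unity; the exponent
represents the image of `δ` in `ℤ/p ^ (n + 1)`. -/
theorem algEquiv_tau_pow (δ : MonoidAlgebra ℤ Gal(K/ℚ)) (w : HeightOneSpectrum (𝓞 K))
    (hw : (p : 𝓞 K) ∉ w.asIdeal) (s : L ≃ₐ[K] L) {b : ℕ} (hb : ¬ ringChar (𝓞 K ⧸ w.asIdeal) ∣ b)
    (hs : s (z (ringChar (𝓞 K ⧸ w.asIdeal))) = z (ringChar (𝓞 K ⧸ w.asIdeal)) ^ b) :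
    s ((∏ g, (galLift p n K L g • tauAll p n hz (primeUnit w)) ^ δ.coeff g : Lˣ) : L) =
      (residueCharIn p n L w hw (b : 𝓞 K ⧸ w.asIdeal))⁻¹ ^ (∑ g, δ.coeff g *
        ((IsCyclotomicExtension.Rat.galEquivZMod (p ^ (n + 1)) K g).val.val : ℤ)) *
      ((∏ g, (galLift p n K L g • tauAll p n hz (primeUnit w)) ^ δ.coeff g : Lˣ) : L) := by
  have hb0 : (b : 𝓞 K ⧸ w.asIdeal) ≠ 0 := by
    rwa [ne_eq, ringChar.spec]
  have hu : residueCharIn p n L w hw (b : 𝓞 K ⧸ w.asIdeal) ≠ 0 :=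
    ((Ne.isUnit hb0).map (residueCharIn p n L w hw)).ne_zero
  have h1 : ∀ g, s ((galLift p n K L g • tauAll p n hz (primeUnit w) : Lˣ) : L) =
      (residueCharIn p n L w hw (b : 𝓞 K ⧸ w.asIdeal))⁻¹ ^
        (IsCyclotomicExtension.Rat.galEquivZMod (p ^ (n + 1)) K g).val.val *
      ((galLift p n K L g • tauAll p n hz (primeUnit w) : Lˣ) : L) := by
    intro g
    have h2 : ((galLift p n K L g • tauAll p n hz (primeUnit w) : Lˣ) : L) =
        galLift p n K L g (primeGaussSum p n hz w hw) := by
      rw [← val_tauAll_primeUnit p n hz w hw]; rfl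
    rw [h2, galLift_primeGaussSum, map_neg, algEquiv_gaussSum_pow p n hz w hw s hb hs, mul_neg]
  have h3 : ∀ (S : Finset Gal(K/ℚ)), (∏ g ∈ S,
      (residueCharIn p n L w hw (b : 𝓞 K ⧸ w.asIdeal))⁻¹ ^ (δ.coeff g *
        ((IsCyclotomicExtension.Rat.galEquivZMod (p ^ (n + 1)) K g).val.val : ℤ))) =
      (residueCharIn p n L w hw (b : 𝓞 K ⧸ w.asIdeal))⁻¹ ^ (∑ g ∈ S, δ.coeff g *
        ((IsCyclotomicExtension.Rat.galEquivZMod (p ^ (n + 1)) K g).val.val : ℤ)) := by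
    classical
    intro S
    induction S using Finset.induction_on with
    | empty => rw [Finset.prod_empty, Finset.sum_empty, zpow_zero]
    | insert a S ha ih =>
      rw [Finset.prod_insert ha, Finset.sum_insert ha, zpow_add₀ (inv_ne_zero hu), ih]
  rw [← h3, Units.coe_prod, map_prod, ← Finset.prod_mul_distrib]
  refine Finset.prod_congr rfl fun g _ => ?_
  rw [Units.val_zpow_eq_zpow_val, map_zpow₀, h1, mul_zpow, mul_comm (δ.coeff g), zpow_mul,
    zpow_natCast]

theorem exists_apply_eq_pow {K L : Type*} [Field K] [Field L] [Algebra K L] {x : L} {ℓ : ℕ}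
    (hℓ : ℓ.Prime) (h : IsPrimitiveRoot x ℓ) (s : L ≃ₐ[K] L) : ∃ b : ℕ, ¬ ℓ ∣ b ∧ s x = x ^ b := by
  have : NeZero ℓ := ⟨hℓ.ne_zero⟩
  obtain ⟨b, -, hb⟩ := h.eq_pow_of_pow_eq_one
    (by rw [← map_pow, h.pow_eq_one, map_one] : s x ^ ℓ = 1)
  refine ⟨b, ?_, hb.symm⟩
  rintro ⟨c, rfl⟩
  rw [pow_mul, h.pow_eq_one, one_pow, ← map_one s] at hb
  exact hℓ.ne_one (h.eq_orderOf.trans (by rw [← s.injective hb, orderOf_one]))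

theorem mem_range_unitsInclusion_of_fixed (x : Lˣ) (hx : ∀ s : L ≃ₐ[K] L, s (x : L) = x) :
    toBigUnitsModule p n K L (Additive.ofMul x) ∈
      (unitsInclusion p n K L).toAddMonoidHom.range := by
  have := IsCyclotomicExtension.isGalois {m : ℕ | m.Coprime p} K L
  obtain ⟨y, hy⟩ := (InfiniteGalois.mem_range_algebraMap_iff_fixed (k := K) (x : L)).2 hx
  have hy0 : y ≠ 0 := by
    rintro rfl
    rw [map_zero] at hy
    exact x.ne_zero hy.symm
  refine ⟨toUnitsModule K (Additive.ofMul (Units.mk0 y hy0)), ?_⟩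
  refine (unitsInclusion_toUnitsModule p n (L := L) _).trans ?_
  congr 2
  exact Units.ext hy

/-- The multiples of `τ` by elements of `S'` take values in `Kˣ`. -/
theorem exists_homInclusion_eq {δ : MonoidAlgebra ℤ Gal(K/ℚ)}
    (hδ : δ ∈ stickelbergerCoeffIdeal p n K) :
    ∃ f : HomSmall p K, homInclusion p n K L f = δ • tau p n K hz := by
  rw [mem_stickelbergerCoeffIdeal_iff, cyclotomicHom_eq_intCast,
    ZMod.intCast_zmod_eq_zero_iff_dvd] at hδ
  obtain ⟨k, hk⟩ := hδ
  have hr : ∀ I, (δ • tau p n K hz) I ∈ (unitsInclusion p n K L).toAddMonoidHom.range := by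
    refine forall_mem_of_primeUnit p fun w hw => ?_
    change (δ • tau p n K hz) (addPrime p w hw) ∈ _
    rw [smul_tau_addPrime]
    refine mem_range_unitsInclusion_of_fixed p n _ fun s => ?_
    obtain ⟨b, hb, hs⟩ := exists_apply_eq_pow (ringChar_prime w)
      (hz _ (ringChar_prime w) (ringChar_ne w hw)) s
    rw [algEquiv_tau_pow p n hz δ w hw s hb hs, hk, zpow_mul, zpow_natCast, inv_pow]
    have hb0 : (b : 𝓞 K ⧸ w.asIdeal) ≠ 0 := by
      rwa [ne_eq, ringChar.spec]
    rw [← Units.val_mk0 hb0, residueCharIn_pow_eq_one, inv_one, one_zpow, one_mul]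
  have hinj : Function.Injective (unitsInclusion p n K L).toAddMonoidHom :=
    unitsInclusion_injective p n
  refine ⟨(AddMonoidHom.ofInjective hinj).symm.toAddMonoidHom.comp
    ((δ • tau p n K hz).codRestrict _ hr), ?_⟩
  refine AddMonoidHom.ext fun I => ?_
  have := (AddMonoidHom.ofInjective hinj).apply_symm_apply ⟨_, hr I⟩
  exact congrArg Subtype.val this

end Rationality

end WeilJacobi

/-! ### Multiples of `τ` outside `S'` -/

namespace WeilJacobi

section Disjoint

variable {K : Type*} [Field K] [NumberField K]

theorem algebraMap_mem_primeToPField (k : ℕ) [IsCyclotomicExtension {k} ℚ K] {M : Type*} [Field M]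
    [CharZero M] [Algebra K M] {ℓ : ℕ} (hℓ : k.Coprime ℓ) (x : K) :
    algebraMap K M x ∈ primeToPField ℓ M := by
  have hx := IsCyclotomicExtension.adjoin_roots (S := {k}) (A := ℚ) (B := K) x
  induction hx using Algebra.adjoin_induction with
  | mem x hx =>
    obtain ⟨m, hm, hm0, hx⟩ := hx
    rw [Set.mem_singleton_iff] at hm
    subst hm
    exact IntermediateField.subset_adjoin _ _ ⟨_, hℓ, by rw [← map_pow, hx, map_one]⟩
  | algebraMap r =>
    rw [← IsScalarTower.algebraMap_apply ℚ K M]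
    exact IntermediateField.algebraMap_mem _ r
  | add x y _ _ hx hy => rw [map_add]; exact add_mem hx hy
  | mul x y _ _ hx hy => rw [map_mul]; exact mul_mem hx hy

/-- The `ℓ`-th cyclotomic polynomial stays irreducible over the field of `k`-th roots of unity, for
a prime `ℓ` that does not divide `k`. -/
theorem irreducible_cyclotomic_of_coprime (k : ℕ) [IsCyclotomicExtension {k} ℚ K] {ℓ : ℕ}
    (hℓ : ℓ.Prime) (hc : k.Coprime ℓ) :
    Irreducible (Polynomial.cyclotomic ℓ K) := by
  have : NeZero ℓ := ⟨hℓ.ne_zero⟩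
  have hroots : ∀ m : ℕ, m ≠ 0 → ∃ ν : AlgebraicClosure K, IsPrimitiveRoot ν m := by
    intro m hm
    have : NeZero m := ⟨hm⟩
    exact HasEnoughRootsOfUnity.exists_primitiveRoot (AlgebraicClosure K) m
  obtain ⟨μ, hμ⟩ := hroots ℓ hℓ.ne_zero
  have h := irreducible_cyclotomic_primeToPField (p := ℓ) (fun m hm => hm.symm)
    (fun m _ hm => hroots m hm) hℓ.ne_one hμ hℓ.ne_zero
  refine Polynomial.Monic.irreducible_of_irreducible_map
    ((algebraMap K (AlgebraicClosure K)).codRestrict (primeToPField ℓ (AlgebraicClosure K))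
      (algebraMap_mem_primeToPField k hc)) _ (Polynomial.cyclotomic.monic _ _) ?_
  rwa [Polynomial.map_cyclotomic]

theorem exists_algEquiv_apply_eq_pow (k : ℕ) [IsCyclotomicExtension {k} ℚ K] {L : Type*} [Field L]
    [Algebra K L] [Normal K L] {ℓ : ℕ} (hℓ : ℓ.Prime) (hc : k.Coprime ℓ) {x : L} (hx : IsPrimitiveRoot x ℓ) {b : ℕ} (hb : ¬ ℓ ∣ b) :
    ∃ s : L ≃ₐ[K] L, s x = x ^ b := by
  have key : ∀ y : L, IsPrimitiveRoot y ℓ → Polynomial.cyclotomic ℓ K = minpoly K y := by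
    intro y hy
    refine minpoly.eq_of_irreducible_of_monic
      (irreducible_cyclotomic_of_coprime k hℓ hc) ?_ (Polynomial.cyclotomic.monic _ _)
    rw [Polynomial.aeval_def, ← Polynomial.eval_map, Polynomial.map_cyclotomic]
    exact hy.isRoot_cyclotomic hℓ.pos
  have hxb : IsPrimitiveRoot (x ^ b) ℓ :=
    hx.pow_of_coprime b ((Nat.coprime_comm.1 ((Nat.Prime.coprime_iff_not_dvd hℓ).2 hb)))
  refine minpoly.exists_algEquiv_of_root (Algebra.IsAlgebraic.isAlgebraic (x ^ b)) ?_
  rw [← key _ hxb, key x hx, minpoly.aeval]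

end Disjoint

section Converse

open IsDedekindDomain

attribute [local instance] residueField residueFintype

variable (p : ℕ) [hp : Fact p.Prime] (n : ℕ) {K : Type*} [Field K] [NumberField K]
  [IsCyclotomicExtension {p ^ (n + 1)} ℚ K]

/-- A generator of the residue field goes to a primitive root of unity under `χ_w`. -/
theorem isPrimitiveRoot_residueChar (w : HeightOneSpectrum (𝓞 K)) (hw : (p : 𝓞 K) ∉ w.asIdeal)
    {g : (𝓞 K ⧸ w.asIdeal)ˣ} (hg : ∀ x, x ∈ Subgroup.zpowers g) :
    IsPrimitiveRoot (residueChar p n w hw g) (p ^ (n + 1)) := by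
  obtain ⟨-, -, -, c, hc⟩ := exists_residue_root p n w hw
  obtain ⟨h1, h2⟩ := residueChar_spec p n w hw g
  refine ⟨h1, fun k hk => ?_⟩
  have hpos : 0 < Nat.card (𝓞 K ⧸ w.asIdeal) - 1 := by
    have := Finite.one_lt_card (α := 𝓞 K ⧸ w.asIdeal)
    omega
  have hc0 : 0 < c := by
    rw [hc] at hpos
    exact Nat.pos_of_mul_pos_left hpos
  rw [hc, Nat.mul_div_cancel_left _ (NeZero.pos _)] at h2
  have h3 : (g⁻¹ ^ c) ^ k = 1 := by
    apply Units.ext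
    rw [Units.val_pow_eq_pow_val, ← h2, ← map_pow, hk, map_one, Units.val_one]
  rw [← pow_mul, inv_pow, inv_eq_one, ← orderOf_dvd_iff_pow_eq_one,
    orderOf_eq_card_of_forall_mem_zpowers hg, Nat.card_units, hc, mul_comm] at h3
  exact Nat.dvd_of_mul_dvd_mul_left hc0 h3

variable {L : Type*} [Field L] [CharZero L] [Algebra K L]
  {z : ℕ → L} (hz : ∀ ℓ : ℕ, ℓ.Prime → ℓ ≠ p → IsPrimitiveRoot (z ℓ) ℓ)
  [IsCyclotomicExtension {m : ℕ | m.Coprime p} K L]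

/-- Only the multiples of `τ` by elements of `S'` take values in `Kˣ`: at a prime of degree one the
Galois group of `L/K` multiplies the Gauss sum by primitive `p ^ (n + 1)`-th roots of unity. -/
theorem mem_stickelbergerCoeffIdeal_of_homInclusion_eq {δ : MonoidAlgebra ℤ Gal(K/ℚ)}
    {f : HomSmall p K} (hf : homInclusion p n K L f = δ • tau p n K hz) :
    δ ∈ stickelbergerCoeffIdeal p n K := by
  obtain ⟨w, hw', hcard, -⟩ := exists_prime_residue_degree_one (K := K) (p ^ (n + 1))
  have hw : (p : 𝓞 K) ∉ w.asIdeal := by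
    intro h
    apply hw'
    rw [Nat.cast_pow]
    exact w.asIdeal.pow_mem_of_mem h _ (Nat.succ_pos n)
  have := ringChar.charP (𝓞 K ⧸ w.asIdeal)
  have : NeZero (ringChar (𝓞 K ⧸ w.asIdeal)) := ⟨(ringChar_prime w).ne_zero⟩
  have := IsCyclotomicExtension.isGalois {m : ℕ | m.Coprime p} K L
  obtain ⟨g, hg⟩ := IsCyclic.exists_generator (α := (𝓞 K ⧸ w.asIdeal)ˣ)
  obtain ⟨b, hb⟩ : ∃ b : ℕ, (b : 𝓞 K ⧸ w.asIdeal) = g := by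
    let e := ZMod.ringEquiv (𝓞 K ⧸ w.asIdeal) hcard
    refine ⟨(e.symm g).val, ?_⟩
    rw [← map_natCast e, ZMod.natCast_zmod_val, e.apply_symm_apply]
  have hb' : ¬ ringChar (𝓞 K ⧸ w.asIdeal) ∣ b := by
    rw [← ringChar.spec, hb]
    exact g.ne_zero
  obtain ⟨s, hs⟩ := exists_algEquiv_apply_eq_pow (K := K) (p ^ (n + 1)) (ringChar_prime w)
    (((Nat.coprime_primes hp.out (ringChar_prime w)).2 (ringChar_ne w hw).symm).pow_left _) (hz _ (ringChar_prime w) (ringChar_ne w hw)) hb'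
  have h1 := algEquiv_tau_pow p n hz δ w hw s hb' hs
  have h2 := smul_tau_addPrime p n hz δ w hw
  rw [← hf, homInclusion_apply] at h2
  obtain ⟨x, hx⟩ := (toUnitsModule K).surjective (f (addPrime p w hw))
  obtain ⟨x, rfl⟩ := Additive.ofMul.surjective x
  rw [← hx, unitsInclusion_toUnitsModule] at h2
  have h3 := Additive.ofMul.injective ((toBigUnitsModule p n K L).injective h2)
  rw [← h3] at h1
  have h4 : s ((Units.map (algebraMap K L : K →* L) x : Lˣ) : L) =
      (Units.map (algebraMap K L : K →* L) x : Lˣ) := s.commutes (x : K)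
  rw [h4, eq_comm, mul_eq_right₀ (Units.ne_zero _), hb, inv_zpow, inv_eq_one,
    MulChar.ringHomComp_apply] at h1
  have hprim := (isPrimitiveRoot_residueChar p n w hw hg).map_of_injective
    (f := (algebraMap K L).comp (algebraMap (𝓞 K) K))
    ((algebraMap K L).injective.comp RingOfIntegers.coe_injective)
  rw [mem_stickelbergerCoeffIdeal_iff, cyclotomicHom_eq_intCast, ZMod.intCast_zmod_eq_zero_iff_dvd]
  exact (hprim.zpow_eq_one_iff_dvd _).1 h1

end Converse

end WeilJacobi

/-! ### Stickelberger's theorem -/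

namespace WeilJacobi

section Unramified

open IsDedekindDomain

variable {K : Type*} [Field K] [NumberField K]

theorem valuation_ringChar (m : ℕ) [NeZero m] [IsCyclotomicExtension {m} ℚ K]
    (w : HeightOneSpectrum (𝓞 K)) (hw : (m : 𝓞 K) ∉ w.asIdeal) :
    w.valuation K ((ringChar (𝓞 K ⧸ w.asIdeal) : ℕ) : K) = WithZero.exp (-1 : ℤ) := by
  set ℓ := ringChar (𝓞 K ⧸ w.asIdeal) with hℓ
  have := liesOver_ringChar w
  have hprime : Fact ℓ.Prime := ⟨ringChar_prime w⟩
  have hℓ0 : (ℓ : 𝓞 K) ≠ 0 := Nat.cast_ne_zero.2 hprime.out.ne_zero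
  rw [natCast_mem_iff] at hw
  have h1 := IsCyclotomicExtension.Rat.ramificationIdx_eq_of_not_dvd (m := m) ℓ K w.asIdeal hw
  have hmap : (Ideal.span {(ℓ : ℤ)}).map (algebraMap ℤ (𝓞 K)) = Ideal.span {(ℓ : 𝓞 K)} := by
    rw [Ideal.map_span, Set.image_singleton, map_natCast]
  have h0 : (Ideal.span {(ℓ : ℤ)}).map (algebraMap ℤ (𝓞 K)) ≠ ⊥ := by
    rwa [hmap, ne_eq, Ideal.span_singleton_eq_bot]
  rw [Ideal.IsDedekindDomain.ramificationIdx_eq_multiplicity (Ideal.span {(ℓ : ℤ)}) w.asIdeal h0,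
    hmap] at h1
  have hfin : FiniteMultiplicity w.asIdeal (Ideal.span {(ℓ : 𝓞 K)}) := by
    refine FiniteMultiplicity.of_prime_left w.prime ?_
    rwa [ne_eq, Ideal.zero_eq_bot, Ideal.span_singleton_eq_bot]
  have hval : w.intValuation (ℓ : 𝓞 K) = w.valuation K (ℓ : K) := by
    rw [← map_natCast (algebraMap (𝓞 K) K)]
    exact (HeightOneSpectrum.valuation_of_algebraMap w _).symm
  have hle : w.valuation K (ℓ : K) ≤ WithZero.exp (-1 : ℤ) := by
    have h2 : (ℓ : 𝓞 K) ∈ w.asIdeal ^ 1 := by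
      rw [pow_one, natCast_mem_iff]
    rw [← HeightOneSpectrum.intValuation_le_pow_iff_mem, hval] at h2
    exact_mod_cast h2
  have hnle : ¬ w.valuation K (ℓ : K) ≤ WithZero.exp (-2 : ℤ) := by
    intro h3
    have h2 : ¬ w.asIdeal ^ 2 ∣ Ideal.span {(ℓ : 𝓞 K)} :=
      hfin.not_pow_dvd_of_multiplicity_lt (by rw [h1]; norm_num)
    rw [← HeightOneSpectrum.intValuation_le_pow_iff_dvd, hval] at h2
    exact h2 (by exact_mod_cast h3)
  have hne : w.valuation K (ℓ : K) ≠ 0 :=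
    (Valuation.ne_zero_iff _).2 (Nat.cast_ne_zero.2 hprime.out.ne_zero)
  obtain ⟨k, hk⟩ : ∃ k : ℤ, w.valuation K (ℓ : K) = WithZero.exp k :=
    ⟨WithZero.log (w.valuation K (ℓ : K)), (WithZero.exp_log hne).symm⟩
  rw [hk, WithZero.exp_le_exp] at hle hnle
  rw [hk]
  congr 1
  omega

end Unramified

section Theta

variable (p : ℕ) [hp : Fact p.Prime] (n : ℕ) (K : Type*) [Field K] [NumberField K]
  [IsCyclotomicExtension {p ^ (n + 1)} ℚ K]

/-- The integral multiple `p ^ (n + 1) θ` of the Stickelberger element. -/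
noncomputable def integralStickelberger : MonoidAlgebra ℤ Gal(K/ℚ) :=
  ∑ g, MonoidAlgebra.single g
    (((IsCyclotomicExtension.Rat.galEquivZMod (p ^ (n + 1)) K g)⁻¹.val.val : ℕ) : ℤ)

theorem coeff_integralStickelberger (g : Gal(K/ℚ)) : (integralStickelberger p n K).coeff g =
    (((IsCyclotomicExtension.Rat.galEquivZMod (p ^ (n + 1)) K g)⁻¹.val.val : ℕ) : ℤ) := by
  classical
  rw [integralStickelberger, MonoidAlgebra.coeff_sum, Finsupp.finsetSum_apply]
  simp only [MonoidAlgebra.coeff_single, Finsupp.single_apply]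
  rw [Finset.sum_ite_eq' Finset.univ g, if_pos (Finset.mem_univ g)]

end Theta

section Comparison

open IsDedekindDomain

variable {K : Type*} [Field K] [NumberField K] {M : Type*} [Field M] [Algebra K M]

theorem val_algebraMap_eq_one {w : HeightOneSpectrum (𝓞 K)} {A : ValuationSubring M}
    (hA : ∀ x : K, (w.valuation K x ≤ 1 → A.valuation (algebraMap K M x) ≤ 1) ∧
      (w.valuation K x < 1 → A.valuation (algebraMap K M x) < 1)) {x : K} :
    A.valuation (algebraMap K M x) = 1 ↔ w.valuation K x = 1 := by
  have inv : ∀ y : K, A.valuation (algebraMap K M y⁻¹) = (A.valuation (algebraMap K M y))⁻¹ := by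
    intro y
    rw [map_inv₀, map_inv₀]
  constructor
  · intro h
    rcases lt_trichotomy (w.valuation K x) 1 with h1 | h1 | h1
    · exact absurd h ((hA x).2 h1).ne
    · exact h1
    · have h2 := (hA x⁻¹).2 (by rw [map_inv₀]; exact inv_lt_one_of_one_lt₀ h1)
      rw [inv, h, inv_one] at h2
      exact absurd h2 (lt_irrefl _)
  · intro h
    refine le_antisymm ((hA x).1 h.le) ?_
    have h2 := (hA x⁻¹).1 (by rw [map_inv₀, h, inv_one])
    rw [inv] at h2
    have h0 : A.valuation (algebraMap K M x) ≠ 0 := by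
      rw [Valuation.ne_zero_iff, map_ne_zero]
      rintro rfl
      rw [map_zero] at h
      exact zero_ne_one h
    exact (inv_le_one₀ (zero_lt_iff.2 h0)).1 h2

/-- If `y` has `w`-adic valuation `1`, the exponent of `w` in `x` can be read off from any valuation
that extends the `w`-adic one. -/
theorem count_eq_of_val_eq {w : HeightOneSpectrum (𝓞 K)} {A : ValuationSubring M}
    (hA : ∀ x : K, (w.valuation K x ≤ 1 → A.valuation (algebraMap K M x) ≤ 1) ∧
      (w.valuation K x < 1 → A.valuation (algebraMap K M x) < 1)) {y : K}
    (hy : w.valuation K y = WithZero.exp (-1 : ℤ)) {x : Kˣ} {N : ℕ}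
    (h : A.valuation (algebraMap K M x) = A.valuation (algebraMap K M y) ^ N) :
    FractionalIdeal.count K w
      (toPrincipalIdeal (𝓞 K) K x : FractionalIdeal (nonZeroDivisors (𝓞 K)) K) = N := by
  have hy0 : y ≠ 0 := by
    rintro rfl
    rw [map_zero] at hy
    exact WithZero.exp_ne_zero hy.symm
  have hv0 : A.valuation (algebraMap K M y) ≠ 0 := by
    rwa [Valuation.ne_zero_iff, map_ne_zero]
  have h1 : A.valuation (algebraMap K M (x / y ^ N)) = 1 := by
    rw [map_div₀, map_div₀, h, map_pow, map_pow, div_self (pow_ne_zero _ hv0)]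
  rw [val_algebraMap_eq_one hA, map_div₀, map_pow, hy, div_eq_one_iff_eq
    (pow_ne_zero _ WithZero.exp_ne_zero), count_eq_neg_log_valuation, ← WithZero.exp_nsmul] at h1
  have h2 := WithZero.exp_injective h1
  rw [nsmul_eq_mul] at h2
  linarith

end Comparison

end WeilJacobi

namespace WeilJacobi

section Stabilizer

open IsDedekindDomain
open scoped Pointwise

variable {K : Type*} [Field K] [NumberField K] (m : ℕ)

theorem ringChar_coprime (w : HeightOneSpectrum (𝓞 K)) (hw : (m : 𝓞 K) ∉ w.asIdeal) :
    (ringChar (𝓞 K ⧸ w.asIdeal)).Coprime m := by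
  rw [natCast_mem_iff] at hw
  exact (Nat.Prime.coprime_iff_not_dvd (ringChar_prime w)).2 hw

variable [NeZero m] [IsCyclotomicExtension {m} ℚ K]

/-- The decomposition group of a prime above `ℓ` corresponds to the powers of `ℓ` modulo `m`. -/
theorem eq_galPrime_iff (w : HeightOneSpectrum (𝓞 K)) (hw : (m : 𝓞 K) ∉ w.asIdeal)
    (s : Gal(K/ℚ)) : w = galPrime s w ↔ IsCyclotomicExtension.Rat.galEquivZMod m K s ∈
      Subgroup.zpowers (ZMod.unitOfCoprime _ (ringChar_coprime m w hw)) := by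
  have : Fact (ringChar (𝓞 K ⧸ w.asIdeal)).Prime := ⟨ringChar_prime w⟩
  have := liesOver_ringChar w
  have := w.isMaximal
  rw [← IsCyclotomicExtension.Rat.galEquivZMod_stabilizer m K (ringChar (𝓞 K ⧸ w.asIdeal)) w.asIdeal
    (ringChar_coprime m w hw)]
  have h1 : w = galPrime s w ↔ s ∈ MulAction.stabilizer Gal(K/ℚ) w.asIdeal := by
    rw [MulAction.mem_stabilizer_iff, HeightOneSpectrum.ext_iff, eq_comm]
    rfl
  rw [h1]
  constructor
  · intro h
    exact ⟨s, h, rfl⟩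
  · rintro ⟨t, ht, hts⟩
    rwa [← (IsCyclotomicExtension.Rat.galEquivZMod m K).injective hts]

theorem sum_stabilizer (w : HeightOneSpectrum (𝓞 K)) (hw : (m : 𝓞 K) ∉ w.asIdeal)
    [DecidableEq (HeightOneSpectrum (𝓞 K))] (F : ZMod m → ℤ) :
    (∑ s : Gal(K/ℚ), if w = galPrime s w then
      F (IsCyclotomicExtension.Rat.galEquivZMod m K s : ZMod m) else 0) =
    ∑ i ∈ Finset.range (orderOf (ringChar (𝓞 K ⧸ w.asIdeal) : ZMod m)),
      F ((ringChar (𝓞 K ⧸ w.asIdeal) : ZMod m) ^ i) := by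
  classical
  have hmem := eq_galPrime_iff m w hw
  set u := ZMod.unitOfCoprime _ (ringChar_coprime m w hw) with hu
  simp_rw [hmem]
  refine ((IsCyclotomicExtension.Rat.galEquivZMod m K).toEquiv.sum_comp
    (fun x : (ZMod m)ˣ => if x ∈ Subgroup.zpowers u then F (x : ZMod m) else 0)).trans ?_
  rw [← Finset.sum_filter]
  have himg : (Finset.univ.filter fun x => x ∈ Subgroup.zpowers u) =
      (Finset.range (orderOf u)).image (fun i => u ^ i) := by
    ext x
    rw [image_range_orderOf]
    simp
  rw [himg, Finset.sum_image (fun i hi j hj h => pow_injOn_Iio_orderOf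
    (Set.mem_Iio.2 (Finset.mem_range.1 hi)) (Set.mem_Iio.2 (Finset.mem_range.1 hj)) h),
    ← orderOf_units]
  exact Finset.sum_congr rfl fun i _ => by
    rw [Units.val_pow_eq_pow_val, hu, ZMod.coe_unitOfCoprime]

end Stabilizer

section Stickelberger

open IsDedekindDomain
open scoped nonZeroDivisors Pointwise

attribute [local instance] residueField residueFintype

variable {K : Type*} [Field K]

theorem pow_prime_not_mem (p : ℕ) {w : HeightOneSpectrum (𝓞 K)} (hw : (p : 𝓞 K) ∉ w.asIdeal)
    (k : ℕ) : ((p ^ k : ℕ) : 𝓞 K) ∉ w.asIdeal := by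
  rw [Nat.cast_pow]
  exact fun h => hw (w.isPrime.mem_of_pow_mem k h)

variable [NumberField K]

theorem map_residueAddChar {L M : Type*} [Field L] [Field M] (φ : L →+* M)
    (w : HeightOneSpectrum (𝓞 K)) {x : L} (hx : x ^ ringChar (𝓞 K ⧸ w.asIdeal) = 1)
    (hx' : φ x ^ ringChar (𝓞 K ⧸ w.asIdeal) = 1) (a : 𝓞 K ⧸ w.asIdeal) :
    φ (residueAddChar w x hx a) = residueAddChar w (φ x) hx' a :=
  map_pow φ _ _

variable (p : ℕ) [hp : Fact p.Prime] (n : ℕ) [IsCyclotomicExtension {p ^ (n + 1)} ℚ K] {L : Type*} [Field L] [CharZero L] [Algebra K L]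
  {z : ℕ → L} (hz : ∀ ℓ : ℕ, ℓ.Prime → ℓ ≠ p → IsPrimitiveRoot (z ℓ) ℓ)

variable [IsCyclotomicExtension {m : ℕ | m.Coprime p} K L]

/-- The exponent of `w` in the conjugates of the power `p ^ (n + 1)` of the Gauss sum of `w`. -/
theorem count_smul_self (hp2 : p ≠ 2) (w : HeightOneSpectrum (𝓞 K)) (hw : (p : 𝓞 K) ∉ w.asIdeal)
    {x : Kˣ} (hx : algebraMap K L x = primeGaussSum p n hz w hw ^ p ^ (n + 1)) (g : Gal(K/ℚ)) :
    FractionalIdeal.count K w (toPrincipalIdeal (𝓞 K) K (g • x) : FractionalIdeal (𝓞 K)⁰ K) =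
      ∑ i ∈ Finset.range (orderOf (ringChar (𝓞 K ⧸ w.asIdeal) : ZMod (p ^ (n + 1)))),
        (((IsCyclotomicExtension.Rat.galEquivZMod (p ^ (n + 1)) K g : ZMod (p ^ (n + 1))) *
          (ringChar (𝓞 K ⧸ w.asIdeal) : ZMod (p ^ (n + 1))) ^ i).val : ℤ) := by
  obtain ⟨A, hA⟩ := exists_valuationSubring_le w (AlgebraicClosure L)
  set ℓ := ringChar (𝓞 K ⧸ w.asIdeal) with hℓ
  have hm := pow_prime_not_mem p hw (n + 1)
  have hv := valuation_ringChar (p ^ (n + 1)) w hm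
  have hf := card_residue_eq_pow_orderOf (p ^ (n + 1)) w hm
  have h1 : ∀ y : 𝓞 K, A.valuation (algebraMap K (AlgebraicClosure L) y) ≤ 1 := fun y =>
    (hA y).1 (w.valuation_le_one y)
  have h2 : ∀ y : 𝓞 K, y ∈ w.asIdeal → A.valuation (algebraMap K (AlgebraicClosure L) y) < 1 :=
    fun y hy => (hA y).2 ((w.valuation_lt_one_iff_mem y).2 hy)
  have hzℓ := hz _ (ringChar_prime w) (ringChar_ne w hw)
  have hzM : IsPrimitiveRoot (algebraMap L (AlgebraicClosure L) (z ℓ)) ℓ :=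
    hzℓ.map_of_injective (algebraMap L (AlgebraicClosure L)).injective
  have key := val_gaussSum_residueChar_pow p n w hw hp2 h1 h2 hzM hf
    (IsCyclotomicExtension.Rat.galEquivZMod (p ^ (n + 1)) K g)
  rw [← Nat.cast_sum]
  refine count_eq_of_val_eq hA hv ?_
  rw [map_natCast, ← key, ← map_pow]
  have h3 : algebraMap K L ((g • x : Kˣ) : K) =
      (-gaussSum (residueCharIn p n L w hw ^
        (IsCyclotomicExtension.Rat.galEquivZMod (p ^ (n + 1)) K g).val.val)
        (primeAddChar p hz w hw)) ^ p ^ (n + 1) := by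
    rw [← galLift_primeGaussSum, ← map_pow, ← hx, galLift_algebraMap]
    rfl
  have h4 : algebraMap L (AlgebraicClosure L) (gaussSum (residueCharIn p n L w hw ^
        (IsCyclotomicExtension.Rat.galEquivZMod (p ^ (n + 1)) K g).val.val)
        (primeAddChar p hz w hw)) = gaussSum (residueCharIn p n (AlgebraicClosure L) w hw ^
        (IsCyclotomicExtension.Rat.galEquivZMod (p ^ (n + 1)) K g).val.val)
        (residueAddChar w _ hzM.pow_eq_one) := by
    rw [gaussSum, gaussSum, map_sum]
    refine Finset.sum_congr rfl fun a _ => ?_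
    rw [map_mul, map_residueAddChar _ w _ hzM.pow_eq_one]
    congr 1
    by_cases ha : a = 0
    · rw [ha, MulChar.map_zero, MulChar.map_zero, map_zero]
    · obtain ⟨u, rfl⟩ := Ne.isUnit ha
      rw [MulChar.pow_apply_coe, MulChar.pow_apply_coe, map_pow, MulChar.ringHomComp_apply,
        MulChar.ringHomComp_apply, RingHom.comp_apply, RingHom.comp_apply,
        ← IsScalarTower.algebraMap_apply]
  rw [IsScalarTower.algebraMap_apply K L (AlgebraicClosure L), h3, map_pow, map_neg, h4, map_pow,
    Valuation.map_neg, map_pow]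

/-- The Gauss sum of `w` is a unit at the primes of other residue characteristics. -/
theorem count_eq_zero_of_ringChar_ne (hp2 : p ≠ 2) (w : HeightOneSpectrum (𝓞 K))
    (hw : (p : 𝓞 K) ∉ w.asIdeal) {x : Kˣ}
    (hx : algebraMap K L x = primeGaussSum p n hz w hw ^ p ^ (n + 1)) {u : HeightOneSpectrum (𝓞 K)}
    (hu : ringChar (𝓞 K ⧸ u.asIdeal) ≠ ringChar (𝓞 K ⧸ w.asIdeal)) :
    FractionalIdeal.count K u (toPrincipalIdeal (𝓞 K) K x : FractionalIdeal (𝓞 K)⁰ K) = 0 := by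
  obtain ⟨A, hA⟩ := exists_valuationSubring_le u L
  obtain ⟨f, hf⟩ := exists_card_residue w
  have hℓ : ((ringChar (𝓞 K ⧸ w.asIdeal) : ℕ) : 𝓞 K) ∉ u.asIdeal := by
    rw [natCast_mem_iff, Nat.prime_dvd_prime_iff_eq (ringChar_prime u) (ringChar_prime w)]
    exact hu
  have hval : u.valuation K ((ringChar (𝓞 K ⧸ w.asIdeal) : ℕ) : K) = 1 := by
    refine le_antisymm ?_ (not_lt.1 fun h => hℓ ?_)
    · rw [← map_natCast (algebraMap (𝓞 K) K)]
      exact u.valuation_le_one (K := K) ((ringChar (𝓞 K ⧸ w.asIdeal) : ℕ) : 𝓞 K)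
    · rw [← map_natCast (algebraMap (𝓞 K) K)] at h
      exact (u.valuation_lt_one_iff_mem (K := K) _).1 h
  have h1 : A.valuation (primeGaussSum p n hz w hw) ≤ 1 := by
    rw [primeGaussSum, Valuation.map_neg]
    exact val_gaussSum_le_one _ _
  have h2 : A.valuation (galLift p n K L (conjAut p n K) (primeGaussSum p n hz w hw)) ≤ 1 := by
    rw [galLift_primeGaussSum, Valuation.map_neg]
    exact val_gaussSum_le_one _ _
  have h3 : A.valuation (primeGaussSum p n hz w hw) *
      A.valuation (galLift p n K L (conjAut p n K) (primeGaussSum p n hz w hw)) = 1 := by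
    rw [← map_mul, primeGaussSum_mul_conj p n hz hp2, hf, Nat.cast_pow, map_pow,
      ← map_natCast (algebraMap K L), (val_algebraMap_eq_one hA).2 hval, one_pow]
  have h4 : A.valuation (primeGaussSum p n hz w hw) = 1 :=
    le_antisymm h1 (by rw [← h3]; exact mul_le_of_le_one_right' h2)
  have h5 : u.valuation K (x : K) = 1 := by
    rw [← val_algebraMap_eq_one hA, hx, map_pow, h4, one_pow]
  rw [count_eq_neg_log_valuation, ← WithZero.exp_zero] at h5
  have := WithZero.exp_injective h5
  linarith

/-- Stickelberger's factorization of the Gauss sum of a prime `w`. -/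
theorem count_primeGaussSum_pow (hp2 : p ≠ 2) (w : HeightOneSpectrum (𝓞 K))
    (hw : (p : 𝓞 K) ∉ w.asIdeal) {x : Kˣ}
    (hx : algebraMap K L x = primeGaussSum p n hz w hw ^ p ^ (n + 1)) (u : HeightOneSpectrum (𝓞 K)) :
    FractionalIdeal.count K u (toPrincipalIdeal (𝓞 K) K x : FractionalIdeal (𝓞 K)⁰ K) =
      ∑ k, (integralStickelberger p n K).coeff k * FractionalIdeal.count K (galPrime k⁻¹ u)
        (primeUnit w : FractionalIdeal (𝓞 K)⁰ K) := by
  classical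
  have := IsCyclotomicExtension.isMulCommutative {p ^ (n + 1)} ℚ K
  have := IsCyclotomicExtension.isGalois {p ^ (n + 1)} ℚ K
  by_cases hu : ringChar (𝓞 K ⧸ u.asIdeal) = ringChar (𝓞 K ⧸ w.asIdeal)
  · have h1 := liesOver_ringChar w
    have h2 := liesOver_ringChar u
    rw [hu] at h2
    have := w.isPrime
    have := u.isPrime
    obtain ⟨σ, hσ⟩ := Ideal.exists_smul_eq_of_isGaloisGroup
      (Ideal.span {(ringChar (𝓞 K ⧸ w.asIdeal) : ℤ)}) w.asIdeal u.asIdeal Gal(K/ℚ)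
    have hσ' : galPrime σ w = u := HeightOneSpectrum.ext hσ
    rw [← hσ', ← smul_inv_smul σ x, ← galFractionalIdeal_toPrincipalIdeal, count_galFractionalIdeal,
      count_smul_self p n hz hp2 w hw hx, ← sum_stabilizer (p ^ (n + 1)) w
        (pow_prime_not_mem p hw _) fun y =>
          (((IsCyclotomicExtension.Rat.galEquivZMod (p ^ (n + 1)) K σ⁻¹ : ZMod (p ^ (n + 1))) *
            y).val : ℤ)]
    rw [← ((Equiv.inv Gal(K/ℚ)).trans (Equiv.mulRight σ)).sum_comp]
    refine Finset.sum_congr rfl fun k _ => ?_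
    have h3 : ((Equiv.inv Gal(K/ℚ)).trans (Equiv.mulRight σ)) k = k⁻¹ * σ := rfl
    rw [h3, ← galPrime_mul, primeUnit, Units.val_mk0, FractionalIdeal.count_maximal, mul_ite,
      mul_one, mul_zero, coeff_integralStickelberger, ← Units.val_mul, ← map_mul, ← map_inv,
      mul_comm' k⁻¹ σ, inv_mul_cancel_left]
  · rw [count_eq_zero_of_ringChar_ne p n hz hp2 w hw hx hu, eq_comm]
    refine Finset.sum_eq_zero fun k _ => ?_
    rw [primeUnit, Units.val_mk0, FractionalIdeal.count_maximal_coprime, mul_zero]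
    rintro rfl
    exact hu (ringChar_galPrime _ _).symm

/-- Stickelberger's theorem: the divisor of `τ(I) ^ (p ^ (n + 1))` is the one of `I`, multiplied by
`p ^ (n + 1) θ`. -/
theorem unitsOrd_apply (hp2 : p ≠ 2) {T : HomSmall p K} (hT : homInclusion p n K L T =
      (MonoidAlgebra.single 1 ((p ^ (n + 1) : ℕ) : ℤ) : MonoidAlgebra ℤ Gal(K/ℚ)) • tau p n K hz)
    (v : HeightOneSpectrum (𝓞 K)) (I : idealGroup p K) :
    unitsOrd v (T (Additive.ofMul I)) = integralStickelberger p n K *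
      idealOrd v (Additive.ofMul (I : (FractionalIdeal (𝓞 K)⁰ K)ˣ)) := by
  have : (unitsOrd v).toAddMonoidHom.comp T =
      (AddMonoidHom.mulLeft (integralStickelberger p n K)).comp
        ((idealOrd v).comp (MonoidHom.toAdditive (idealGroup p K).subtype)) := by
    refine addHom_ext_primeUnit p fun w hw => ?_
    obtain ⟨x, hx⟩ := (toUnitsModule K).surjective (T (addPrime p w hw))
    obtain ⟨x, rfl⟩ := Additive.ofMul.surjective x
    have h1 : algebraMap K L x = primeGaussSum p n hz w hw ^ p ^ (n + 1) := by
      have h2 := DFunLike.congr_fun hT (addPrime p w hw)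
      rw [homInclusion_apply, ← hx, unitsInclusion_toUnitsModule, AddMonoidHom.smul_apply,
        Representation.single_smul, map_one, natCast_zsmul] at h2
      have h3 : Units.map (algebraMap K L : K →* L) x = tauAll p n hz (primeUnit w) ^ p ^ (n + 1) :=
        h2
      rw [← val_tauAll_primeUnit p n hz w hw, ← Units.val_pow_eq_pow_val, ← h3]
      rfl
    apply MonoidAlgebra.coeff_injective
    ext g
    change (unitsOrd v (T (addPrime p w hw))).coeff g =
      (integralStickelberger p n K * idealOrd v (Additive.ofMul (primeUnit w))).coeff g
    rw [← hx, unitsOrd_toUnitsModule, coeff_idealOrd, count_primeGaussSum_pow p n hz hp2 w hw h1,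
      groupRing_coeff_mul]
    exact Finset.sum_congr rfl fun k _ => by rw [coeff_idealOrd, galPrime_mul]
  exact DFunLike.congr_fun this (Additive.ofMul I)

end Stickelberger

end WeilJacobi

/-! ### Multiples of `τ` belong to the Weil module -/

namespace WeilJacobi

section Conjugation

variable (p : ℕ) [hp : Fact p.Prime] (n : ℕ) {K : Type*} [Field K] [NumberField K]
  [IsCyclotomicExtension {p ^ (n + 1)} ℚ K]

theorem embedding_conjAut (φ : K →+* ℂ) (x : K) :
    φ (conjAut p n K x) = starRingEnd ℂ (φ x) := by
  have hx := IsCyclotomicExtension.adjoin_roots (S := {p ^ (n + 1)}) (A := ℚ) (B := K) x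
  induction hx using Algebra.adjoin_induction with
  | mem x hx =>
    obtain ⟨m, hm, hm0, hx⟩ := hx
    rw [Set.mem_singleton_iff] at hm
    subst hm
    have h1 : (-1 : (ZMod (p ^ (n + 1)))ˣ).val.val + 1 = p ^ (n + 1) := by
      obtain ⟨k, hk⟩ : ∃ k, p ^ (n + 1) = k + 1 :=
        ⟨p ^ (n + 1) - 1, by have := NeZero.pos (p ^ (n + 1)); omega⟩
      rw [Units.val_neg, Units.val_one]
      generalize p ^ (n + 1) = q at hk
      subst hk
      rw [ZMod.val_neg_one]
    have h2 : φ x ^ p ^ (n + 1) = 1 := by rw [← map_pow, hx, map_one]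
    have h3 : ‖φ x‖ = 1 := Complex.norm_eq_one_of_pow_eq_one h2 (NeZero.ne _)
    have h4 : φ x ≠ 0 := by
      intro h0
      rw [h0, norm_zero] at h3
      exact zero_ne_one h3
    rw [IsCyclotomicExtension.Rat.galEquivZMod_apply_of_pow_eq (p ^ (n + 1)) K _ hx,
      galEquivZMod_conjAut, map_pow]
    apply mul_right_cancel₀ h4
    rw [← pow_succ, h1, h2, ← Complex.normSq_eq_conj_mul_self, Complex.normSq_eq_norm_sq, h3]
    norm_num
  | algebraMap r => rw [eq_ratCast, map_ratCast, map_ratCast, map_ratCast]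
  | add x y _ _ hx hy => simp only [map_add, hx, hy]
  | mul x y _ _ hx hy => simp only [map_mul, hx, hy]

end Conjugation

section Stickelberger

variable (p : ℕ) [hp : Fact p.Prime] (n : ℕ) (K : Type*) [Field K] [NumberField K]
  [IsCyclotomicExtension {p ^ (n + 1)} ℚ K]

/-- `S' θ` lies in `ℤ[G]`. -/
theorem exists_mul_integralStickelberger {δ : MonoidAlgebra ℤ Gal(K/ℚ)}
    (hδ : δ ∈ stickelbergerCoeffIdeal p n K) : ∃ β : MonoidAlgebra ℤ Gal(K/ℚ),
      δ * integralStickelberger p n K = MonoidAlgebra.single 1 ((p ^ (n + 1) : ℕ) : ℤ) * β := by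
  rw [mem_stickelbergerCoeffIdeal_iff, cyclotomicHom_eq_intCast] at hδ
  have h : ∀ k, ((p ^ (n + 1) : ℕ) : ℤ) ∣ (δ * integralStickelberger p n K).coeff k := by
    intro k
    rw [← ZMod.intCast_zmod_eq_zero_iff_dvd, groupRing_coeff_mul]
    have := congrArg (fun x => x *
      ((IsCyclotomicExtension.Rat.galEquivZMod (p ^ (n + 1)) K k)⁻¹.val)) hδ
    simp only [zero_mul] at this
    rw [← this, Int.cast_sum, Int.cast_sum, Finset.sum_mul]
    refine Finset.sum_congr rfl fun g _ => ?_
    rw [coeff_integralStickelberger, Int.cast_mul, Int.cast_mul, Int.cast_natCast, Int.cast_natCast,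
      ZMod.natCast_zmod_val, ZMod.natCast_zmod_val, map_mul, map_inv, mul_inv_rev, inv_inv,
      mul_comm _ (IsCyclotomicExtension.Rat.galEquivZMod (p ^ (n + 1)) K g), Units.val_mul,
      mul_assoc]
  choose c hc using h
  refine ⟨∑ k, MonoidAlgebra.single k (c k), ?_⟩
  rw [eq_sum_single (δ * integralStickelberger p n K), Finset.mul_sum]
  refine Finset.sum_congr rfl fun k _ => ?_
  rw [MonoidAlgebra.single_mul_single, one_mul, hc]

theorem integralStickelberger_add_conj :
    integralStickelberger p n K +
        MonoidAlgebra.single (conjAut p n K) 1 * integralStickelberger p n K =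
      MonoidAlgebra.single 1 ((p ^ (n + 1) : ℕ) : ℤ) * ∑ g, MonoidAlgebra.single g 1 := by
  classical
  apply MonoidAlgebra.coeff_injective
  ext k
  rw [MonoidAlgebra.coeff_add, Finsupp.add_apply, MonoidAlgebra.coeff_single_mul_apply,
    MonoidAlgebra.coeff_single_mul_apply, one_mul, inv_one, one_mul, MonoidAlgebra.coeff_sum,
    Finsupp.finsetSum_apply]
  simp only [MonoidAlgebra.coeff_single, Finsupp.single_apply]
  rw [Finset.sum_ite_eq' Finset.univ k, if_pos (Finset.mem_univ k), mul_one,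
    coeff_integralStickelberger, coeff_integralStickelberger, conjAut_inv, map_mul,
    galEquivZMod_conjAut, neg_one_mul, inv_neg, Units.val_neg]
  set c := (IsCyclotomicExtension.Rat.galEquivZMod (p ^ (n + 1)) K k)⁻¹
  have hm : 1 < p ^ (n + 1) := Nat.one_lt_pow (Nat.succ_ne_zero n) hp.out.one_lt
  have : Fact (1 < p ^ (n + 1)) := ⟨hm⟩
  have hc : NeZero (c : ZMod (p ^ (n + 1))) := ⟨c.ne_zero⟩
  rw [ZMod.val_neg_of_ne_zero, Nat.cast_sub (ZMod.val_lt _).le]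
  ring

end Stickelberger

section Weil

open IsDedekindDomain
open scoped nonZeroDivisors

variable {K : Type*} [Field K] [NumberField K]

theorem toUnitsModule_norm [IsGalois ℚ K] (α : Kˣ) :
    (∑ g : Gal(K/ℚ), MonoidAlgebra.single g (1 : ℤ)) • toUnitsModule K (Additive.ofMul α) =
      toUnitsModule K (Additive.ofMul (Units.map (algebraMap ℚ K : ℚ →* K)
        (Units.map (Algebra.norm ℚ : K →* ℚ) α))) := by
  rw [Finset.sum_smul]
  simp_rw [single_smul_toUnitsModule]
  rw [← map_sum, ← ofMul_prod]
  congr 2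
  apply Units.ext
  rw [Units.coe_prod]
  exact (Algebra.norm_eq_prod_automorphisms ℚ (α : K)).symm

variable (p : ℕ) [hp : Fact p.Prime] (n : ℕ) [IsCyclotomicExtension {p ^ (n + 1)} ℚ K]

/-- A unit of `K` whose absolute values are all `1`, up to a torsion factor, is a root of unity. -/
theorem exists_nsmul_eq_zero {u : UnitsModule K} (h1 : ∀ v, unitsOrd v u = 0)
    (h2 : 2 • (u + MonoidAlgebra.single (conjAut p n K) (1 : ℤ) • u) = 0) :
    ∃ N : ℕ, 0 < N ∧ N • u = 0 := by
  obtain ⟨x, rfl⟩ := (toUnitsModule K).surjective u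
  obtain ⟨x, rfl⟩ := Additive.ofMul.surjective x
  rw [single_smul_toUnitsModule, ← map_add, ← ofMul_mul, ← map_nsmul, ← ofMul_pow,
    EmbeddingLike.map_eq_zero_iff, ofMul_eq_zero, Units.ext_iff] at h2
  have hint : IsIntegral ℤ (x : K) := by
    have : (x : K) ∈ (algebraMap (𝓞 K) K).range := by
      refine HeightOneSpectrum.mem_integers_of_valuation_le_one K _ fun v => ?_
      have h3 := congrArg (fun y : MonoidAlgebra ℤ Gal(K/ℚ) => y.coeff 1) (h1 v)
      simp only [unitsOrd_toUnitsModule, coeff_idealOrd, galPrime_one, MonoidAlgebra.coeff_zero,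
        Finsupp.zero_apply] at h3
      rw [count_eq_neg_log_valuation, h3, neg_zero, WithZero.exp_zero]
    obtain ⟨y, hy⟩ := this
    rw [← hy]
    exact y.2
  have habs : ∀ φ : K →+* ℂ, ‖φ x‖ = 1 := by
    intro φ
    have h3 := congrArg φ h2
    have h4 : φ (((x * conjAut p n K • x) ^ 2 : Kˣ) : K) =
        (φ x * starRingEnd ℂ (φ x)) ^ 2 := by
      rw [← embedding_conjAut p n, ← map_mul, ← map_pow]
      rfl
    rw [h4, Units.val_one, map_one] at h3
    have h5 := congrArg norm h3
    rw [norm_pow, norm_mul, RCLike.norm_conj, norm_one, ← pow_two, ← pow_mul] at h5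
    exact (pow_eq_one_iff_of_nonneg (norm_nonneg _) (by norm_num)).1 h5
  obtain ⟨N, hN, h⟩ := Embeddings.pow_eq_one_of_norm_eq_one K ℂ hint habs
  refine ⟨N, hN, ?_⟩
  rw [← map_nsmul, ← ofMul_pow, EmbeddingLike.map_eq_zero_iff, ofMul_eq_zero]
  exact Units.ext (by rw [Units.val_pow_eq_pow_val, h, Units.val_one])

theorem mem_rootsOfUnity_of_nsmul_eq_zero (hp2 : p ≠ 2) {u : UnitsModule K} {N : ℕ} (hN : 0 < N)
    (hu : N • u = 0) :
    ((toUnitsModule K).symm u).toMul ∈ rootsOfUnity (2 * p ^ (n + 1)) K := by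
  obtain ⟨x, rfl⟩ := (toUnitsModule K).surjective u
  obtain ⟨x, rfl⟩ := Additive.ofMul.surjective x
  rw [← map_nsmul, ← ofMul_pow, EmbeddingLike.map_eq_zero_iff, ofMul_eq_zero, Units.ext_iff] at hu
  have hfin : IsOfFinOrder (x : K) := isOfFinOrder_iff_pow_eq_one.2 ⟨N, hN, hu⟩
  have hζ := IsCyclotomicExtension.zeta_spec (p ^ (n + 1)) ℚ K
  have hodd : Odd (p ^ (n + 1)) := (hp.out.odd_of_ne_two hp2).pow
  obtain ⟨r, hr⟩ := IsPrimitiveRoot.exists_neg_pow_of_isOfFinOrder hodd hζ hfin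
  rw [AddEquiv.symm_apply_apply, toMul_ofMul, mem_rootsOfUnity']
  rw [hr, ← pow_mul, mul_comm r, mul_assoc, pow_mul, neg_sq, ← pow_mul, mul_left_comm, pow_mul,
    hζ.pow_eq_one, one_pow]

variable {L : Type*} [Field L] [CharZero L] [Algebra K L]
  {z : ℕ → L} (hz : ∀ ℓ : ℕ, ℓ.Prime → ℓ ≠ p → IsPrimitiveRoot (z ℓ) ℓ)
  [IsCyclotomicExtension {m : ℕ | m.Coprime p} K L]

/-- On principal ideals, `τ ^ (p ^ (n + 1))` differs from the operation of `p ^ (n + 1) θ` on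
generators by roots of unity. -/
theorem exists_nsmul_sub_eq_zero (hp2 : p ≠ 2) {T : HomSmall p K} (hT : homInclusion p n K L T =
      (MonoidAlgebra.single 1 ((p ^ (n + 1) : ℕ) : ℤ) : MonoidAlgebra ℤ Gal(K/ℚ)) • tau p n K hz)
    {I : idealGroup p K} {α : Kˣ} (hα : toPrincipalIdeal (𝓞 K) K α = I) :
    ∃ N : ℕ, 0 < N ∧ N • (T (Additive.ofMul I) -
      integralStickelberger p n K • toUnitsModule K (Additive.ofMul α)) = 0 := by
  have := IsCyclotomicExtension.isMulCommutative {p ^ (n + 1)} ℚ K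
  have := IsCyclotomicExtension.isGalois {p ^ (n + 1)} ℚ K
  apply exists_nsmul_eq_zero p n
  · intro v
    rw [map_sub, unitsOrd_apply p n hz hp2 hT, map_smul, unitsOrd_toUnitsModule, hα, smul_eq_mul,
      sub_self]
  · set c : MonoidAlgebra ℤ Gal(K/ℚ) := MonoidAlgebra.single 1 ((p ^ (n + 1) : ℕ) : ℤ)
    have h1 : T (Additive.ofMul I) +
        MonoidAlgebra.single (conjAut p n K) (1 : ℤ) • T (Additive.ofMul I) =
        c • toUnitsModule K (Additive.ofMul (Units.map (algebraMap ℚ K : ℚ →* K) (Units.map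
          (FractionalIdeal.absNorm (R := 𝓞 K) (K := K) : FractionalIdeal (𝓞 K)⁰ K →* ℚ)
            (I : (FractionalIdeal (𝓞 K)⁰ K)ˣ)))) := by
      apply unitsInclusion_injective p n (L := L)
      rw [map_smul, ← tau_add_conj p n hz hp2, map_add, map_smul, ← homInclusion_apply, hT,
        AddMonoidHom.smul_apply, smul_add, smul_smul, smul_smul, groupRing_mul_comm c]
    have h2 : ∀ a : UnitsModule K, integralStickelberger p n K • a +
        MonoidAlgebra.single (conjAut p n K) (1 : ℤ) • integralStickelberger p n K • a =
        c • (∑ g : Gal(K/ℚ), MonoidAlgebra.single g (1 : ℤ)) • a := by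
      intro a
      rw [smul_smul, smul_smul, ← add_smul, integralStickelberger_add_conj p n K]
    have h3 : FractionalIdeal.absNorm
      ((I : (FractionalIdeal (𝓞 K)⁰ K)ˣ) : FractionalIdeal (𝓞 K)⁰ K) =
        |Algebra.norm ℚ (α : K)| := by
      rw [← hα, coe_toPrincipalIdeal, FractionalIdeal.absNorm_span_singleton]
    have h4 : Units.map (FractionalIdeal.absNorm (R := 𝓞 K) (K := K) :
        FractionalIdeal (𝓞 K)⁰ K →* ℚ) (I : (FractionalIdeal (𝓞 K)⁰ K)ˣ) ^ 2 =
        Units.map (Algebra.norm ℚ : K →* ℚ) α ^ 2 := by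
      apply Units.ext
      rw [Units.val_pow_eq_pow_val, Units.val_pow_eq_pow_val]
      change FractionalIdeal.absNorm
        ((I : (FractionalIdeal (𝓞 K)⁰ K)ˣ) : FractionalIdeal (𝓞 K)⁰ K) ^ 2 =
          Algebra.norm ℚ (α : K) ^ 2
      rw [h3, sq_abs]
    have h5 : ∀ q : ℚˣ,
        2 • toUnitsModule K (Additive.ofMul (Units.map (algebraMap ℚ K : ℚ →* K) q)) =
          toUnitsModule K (Additive.ofMul (Units.map (algebraMap ℚ K : ℚ →* K) (q ^ 2))) := by
      intro q
      rw [map_pow, ofMul_pow, map_nsmul]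
    rw [smul_sub, sub_add_sub_comm, h1, h2, toUnitsModule_norm, ← smul_sub, smul_comm,
      nsmul_sub, h5, h5, h4, sub_self, smul_zero]

/-- The multiples of `τ` with values in `Kˣ` belong to the Weil module. -/
theorem mem_weilModule (hp2 : p ≠ 2) {δ : MonoidAlgebra ℤ Gal(K/ℚ)} {f : HomSmall p K}
    (hf : homInclusion p n K L f = δ • tau p n K hz) : f ∈ weilModule p n K := by
  have := IsCyclotomicExtension.isMulCommutative {p ^ (n + 1)} ℚ K
  set c : MonoidAlgebra ℤ Gal(K/ℚ) := MonoidAlgebra.single 1 ((p ^ (n + 1) : ℕ) : ℤ) with hc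
  have hcS : c ∈ stickelbergerCoeffIdeal p n K := by
    rw [mem_stickelbergerCoeffIdeal_iff, hc, cyclotomicHom_single, Int.cast_natCast,
      ZMod.natCast_self, zero_mul]
  obtain ⟨T, hT⟩ := exists_homInclusion_eq p n hz hcS
  have hδ := mem_stickelbergerCoeffIdeal_of_homInclusion_eq p n hz hf
  obtain ⟨β, hβ⟩ := exists_mul_integralStickelberger p n K hδ
  have hfT : c • f = δ • T := by
    apply homInclusion_injective p n (L := L)
    rw [map_smul, map_smul, hf, hT, smul_smul, smul_smul, groupRing_mul_comm]
  refine ⟨mem_equivariantHom p n hz hf, β, fun I α hα => ?_⟩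
  obtain ⟨N, hN, h⟩ := exists_nsmul_sub_eq_zero p n hz hp2 hT hα
  have h1 : c • (f (Additive.ofMul I) - β • toUnitsModule K (Additive.ofMul α)) =
      δ • (T (Additive.ofMul I) -
        integralStickelberger p n K • toUnitsModule K (Additive.ofMul α)) := by
    rw [smul_sub, smul_sub, smul_smul, smul_smul, ← hβ, ← AddMonoidHom.smul_apply,
      ← AddMonoidHom.smul_apply, hfT]
  have h2 : ∀ y : UnitsModule K, c • y = (p ^ (n + 1)) • y := by
    intro y
    rw [hc, single_eq_zsmul, smul_assoc, ← MonoidAlgebra.one_def, one_smul, natCast_zsmul]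
  refine mem_rootsOfUnity_of_nsmul_eq_zero p n hp2 (N := N * p ^ (n + 1))
    (Nat.mul_pos hN (NeZero.pos _)) ?_
  rw [mul_smul, ← h2, h1, smul_comm, h, smul_zero]

end Weil

end WeilJacobi

/-! ### The annihilators of `τ` and of the Stickelberger element -/

namespace WeilJacobi

section Characters

variable (p : ℕ) [hp : Fact p.Prime] (n : ℕ) (K : Type*) [Field K] [NumberField K]
  [IsCyclotomicExtension {p ^ (n + 1)} ℚ K]

/-- The extension of a Dirichlet character, as a character of `G`, to the group ring. -/
noncomputable def groupRingChar (χ : DirichletCharacter ℂ (p ^ (n + 1))) :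
    MonoidAlgebra ℤ Gal(K/ℚ) →ₐ[ℤ] ℂ :=
  MonoidAlgebra.lift ℤ ℂ Gal(K/ℚ) (χ.toMonoidHom.comp ((Units.coeHom _).comp
    (IsCyclotomicExtension.Rat.galEquivZMod (p ^ (n + 1)) K).toMonoidHom))

theorem groupRingChar_single (χ : DirichletCharacter ℂ (p ^ (n + 1))) (g : Gal(K/ℚ)) (c : ℤ) :
    groupRingChar p n K χ (MonoidAlgebra.single g c) =
      c * χ (IsCyclotomicExtension.Rat.galEquivZMod (p ^ (n + 1)) K g : ZMod (p ^ (n + 1))) := by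
  rw [groupRingChar, MonoidAlgebra.lift_single, zsmul_eq_mul]
  rfl

theorem groupRingChar_eq_sum (χ : DirichletCharacter ℂ (p ^ (n + 1)))
    (δ : MonoidAlgebra ℤ Gal(K/ℚ)) : groupRingChar p n K χ δ = ∑ g, (δ.coeff g : ℂ) *
      χ (IsCyclotomicExtension.Rat.galEquivZMod (p ^ (n + 1)) K g : ZMod (p ^ (n + 1))) := by
  conv_lhs => rw [eq_sum_single δ]
  rw [map_sum]
  exact Finset.sum_congr rfl fun g _ => groupRingChar_single p n K χ g _

/-- The characters separate the elements of the group ring. -/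
theorem eq_zero_of_groupRingChar_eq_zero {ε : MonoidAlgebra ℤ Gal(K/ℚ)}
    (h : ∀ χ, groupRingChar p n K χ ε = 0) : ε = 0 := by
  classical
  apply MonoidAlgebra.coeff_injective
  ext k
  set κ := IsCyclotomicExtension.Rat.galEquivZMod (p ^ (n + 1)) K
  have h1 : ∑ χ : DirichletCharacter ℂ (p ^ (n + 1)),
      χ ((κ k : ZMod (p ^ (n + 1))))⁻¹ * groupRingChar p n K χ ε = 0 :=
    Finset.sum_eq_zero fun χ _ => by rw [h, mul_zero]
  simp_rw [groupRingChar_eq_sum, Finset.mul_sum] at h1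
  rw [Finset.sum_comm] at h1
  have h2 : ∀ g, ∑ χ : DirichletCharacter ℂ (p ^ (n + 1)),
      χ ((κ k : ZMod (p ^ (n + 1))))⁻¹ * ((ε.coeff g : ℂ) * χ (κ g : ZMod (p ^ (n + 1)))) =
      if k = g then (ε.coeff g : ℂ) * ((p ^ (n + 1)).totient : ℂ) else 0 := by
    intro g
    simp_rw [mul_left_comm _ (ε.coeff g : ℂ)]
    rw [← Finset.mul_sum, DirichletCharacter.sum_char_inv_mul_char_eq ℂ (Units.isUnit (κ k)),
      mul_ite, mul_zero]
    simp only [Units.val_inj, κ.injective.eq_iff]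
  rw [Finset.sum_congr rfl fun g _ => h2 g, Finset.sum_ite_eq Finset.univ k,
    if_pos (Finset.mem_univ k), mul_eq_zero] at h1
  rcases h1 with h1 | h1
  · exact_mod_cast h1
  · exact absurd h1 (Nat.cast_ne_zero.2 (Nat.totient_pos.2 (NeZero.pos _)).ne')

theorem groupRingChar_integralStickelberger (χ : DirichletCharacter ℂ (p ^ (n + 1))) :
    groupRingChar p n K χ (integralStickelberger p n K) =
      ∑ a : ZMod (p ^ (n + 1)), χ⁻¹ a * (a.val : ℂ) := by
  rw [groupRingChar_eq_sum]
  refine Fintype.sum_of_injective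
    (fun g => (((IsCyclotomicExtension.Rat.galEquivZMod (p ^ (n + 1)) K g)⁻¹ :
      (ZMod (p ^ (n + 1)))ˣ) : ZMod (p ^ (n + 1)))) ?_ _ _ ?_ ?_
  · intro g h hgh
    exact (IsCyclotomicExtension.Rat.galEquivZMod (p ^ (n + 1)) K).injective
      (inv_injective (Units.ext hgh))
  · intro a ha
    rw [MulChar.map_nonunit, zero_mul]
    rintro ⟨u, rfl⟩
    exact ha ⟨(IsCyclotomicExtension.Rat.galEquivZMod (p ^ (n + 1)) K).symm u⁻¹, by
      dsimp only
      rw [MulEquiv.apply_symm_apply, inv_inv]⟩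
  · intro g
    rw [coeff_integralStickelberger, MulChar.inv_apply, Ring.inverse_unit, inv_inv, mul_comm,
      Int.cast_natCast]

/-- Annihilators of the Stickelberger element are annihilated by the odd characters, because these
do not vanish on the Stickelberger element. -/
theorem groupRingChar_eq_zero_of_odd {δ : MonoidAlgebra ℤ Gal(K/ℚ)}
    (hδ : δ * integralStickelberger p n K = 0) {χ : DirichletCharacter ℂ (p ^ (n + 1))}
    (hχ : χ.Odd) : groupRingChar p n K χ δ = 0 := by
  have h1 := congrArg (groupRingChar p n K χ) hδ
  rw [map_mul, map_zero, groupRingChar_integralStickelberger, mul_eq_zero] at h1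
  refine h1.resolve_right (sum_char_mul_val_ne_zero ?_)
  have h2 : χ (-1) = -1 := hχ
  change χ⁻¹ (-1) = -1
  rw [MulChar.inv_apply_eq_inv, h2]
  simp

/-- Annihilators of the Stickelberger element are invariant under complex conjugation. -/
theorem single_conjAut_mul {δ : MonoidAlgebra ℤ Gal(K/ℚ)}
    (hδ : δ * integralStickelberger p n K = 0) :
    MonoidAlgebra.single (conjAut p n K) 1 * δ = δ := by
  rw [← sub_eq_zero]
  refine eq_zero_of_groupRingChar_eq_zero p n K fun χ => ?_
  rw [map_sub, map_mul, groupRingChar_single, galEquivZMod_conjAut, Int.cast_one, one_mul,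
    Units.val_neg, Units.val_one]
  rcases χ.even_or_odd with h | h
  · have h2 : χ (-1) = 1 := h
    rw [h2, one_mul, sub_self]
  · rw [groupRingChar_eq_zero_of_odd p n K hδ h, mul_zero, sub_self]

theorem sum_coeff_mul {G : Type*} [Group G] [Fintype G] (x y : MonoidAlgebra ℤ G) :
    ∑ g, (x * y).coeff g = (∑ g, x.coeff g) * ∑ g, y.coeff g := by
  simp_rw [groupRing_coeff_mul]
  rw [Finset.sum_comm, Finset.sum_mul]
  refine Finset.sum_congr rfl fun g _ => ?_
  rw [← Finset.mul_sum]
  congr 1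
  exact Fintype.sum_equiv (Equiv.mulLeft g⁻¹) _ _ fun _ => rfl

theorem sum_coeff_eq_zero {δ : MonoidAlgebra ℤ Gal(K/ℚ)}
    (hδ : δ * integralStickelberger p n K = 0) : ∑ g, δ.coeff g = 0 := by
  have h1 := sum_coeff_mul δ (integralStickelberger p n K)
  rw [hδ, MonoidAlgebra.coeff_zero, eq_comm] at h1
  simp only [Finsupp.zero_apply, Finset.sum_const_zero, mul_eq_zero] at h1
  refine h1.resolve_right (ne_of_gt ?_)
  refine Finset.sum_pos' (fun g _ => ?_) ⟨1, Finset.mem_univ _, ?_⟩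
  · rw [coeff_integralStickelberger]
    exact Nat.cast_nonneg _
  · have : Fact (1 < p ^ (n + 1)) := ⟨Nat.one_lt_pow (Nat.succ_ne_zero n) hp.out.one_lt⟩
    rw [coeff_integralStickelberger, map_one, inv_one, Units.val_one, ZMod.val_one]
    exact Int.one_pos

/-- An element invariant under complex conjugation is a multiple of `1 + σ_{-1}`: exactly one of
`a` and `-a` is represented below `p ^ (n + 1) / 2`. -/
theorem exists_add_conjAut_mul (hp2 : p ≠ 2) {δ : MonoidAlgebra ℤ Gal(K/ℚ)}
    (hδ : MonoidAlgebra.single (conjAut p n K) 1 * δ = δ) : ∃ δ' : MonoidAlgebra ℤ Gal(K/ℚ),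
      δ = δ' + MonoidAlgebra.single (conjAut p n K) 1 * δ' := by
  classical
  set κ := IsCyclotomicExtension.Rat.galEquivZMod (p ^ (n + 1)) K
  refine ⟨∑ g, MonoidAlgebra.single g
    (if 2 * (κ g : ZMod (p ^ (n + 1))).val < p ^ (n + 1) then δ.coeff g else 0), ?_⟩
  set δ' : MonoidAlgebra ℤ Gal(K/ℚ) := ∑ g, MonoidAlgebra.single g
    (if 2 * (κ g : ZMod (p ^ (n + 1))).val < p ^ (n + 1) then δ.coeff g else 0) with hδ'
  have hcoeff : ∀ g, δ'.coeff g =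
      if 2 * (κ g : ZMod (p ^ (n + 1))).val < p ^ (n + 1) then δ.coeff g else 0 := by
    intro g
    rw [hδ', MonoidAlgebra.coeff_sum, Finsupp.finsetSum_apply]
    simp only [MonoidAlgebra.coeff_single, Finsupp.single_apply]
    rw [Finset.sum_ite_eq' Finset.univ g, if_pos (Finset.mem_univ g)]
  have hconj : ∀ g, δ.coeff (conjAut p n K * g) = δ.coeff g := by
    intro g
    conv_rhs => rw [← hδ]
    rw [MonoidAlgebra.coeff_single_mul_apply, one_mul, conjAut_inv]
  apply MonoidAlgebra.coeff_injective
  ext g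
  have hκ : κ (conjAut p n K * g) = -κ g := by
    rw [map_mul, galEquivZMod_conjAut, neg_one_mul]
  have : Fact (1 < p ^ (n + 1)) := ⟨Nat.one_lt_pow (Nat.succ_ne_zero n) hp.out.one_lt⟩
  have : NeZero (κ g : ZMod (p ^ (n + 1))) := ⟨(κ g).ne_zero⟩
  rw [MonoidAlgebra.coeff_add, Finsupp.add_apply, MonoidAlgebra.coeff_single_mul_apply, one_mul,
    conjAut_inv, hcoeff, hcoeff, hconj, hκ, Units.val_neg, ZMod.val_neg_of_ne_zero]
  have hlt := ZMod.val_lt (κ g : ZMod (p ^ (n + 1)))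
  have hodd : Odd (p ^ (n + 1)) := (hp.out.odd_of_ne_two hp2).pow
  obtain ⟨r, hr⟩ := hodd
  split_ifs <;> omega

end Characters

section Annihilator

open IsDedekindDomain
open scoped nonZeroDivisors

attribute [local instance] residueField residueFintype

variable (p : ℕ) [hp : Fact p.Prime] (n : ℕ) {K : Type*} [Field K] [NumberField K]
  [IsCyclotomicExtension {p ^ (n + 1)} ℚ K] {L : Type*} [Field L] [CharZero L] [Algebra K L]
  {z : ℕ → L} (hz : ∀ ℓ : ℕ, ℓ.Prime → ℓ ≠ p → IsPrimitiveRoot (z ℓ) ℓ)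
  [IsCyclotomicExtension {m : ℕ | m.Coprime p} K L]

theorem smul_tau_eq_zero (hp2 : p ≠ 2) {δ : MonoidAlgebra ℤ Gal(K/ℚ)}
    (hδ : δ * integralStickelberger p n K = 0) : δ • tau p n K hz = 0 := by
  have hcomm := IsCyclotomicExtension.isMulCommutative {p ^ (n + 1)} ℚ K
  obtain ⟨δ', hδ'⟩ := exists_add_conjAut_mul p n K hp2 (single_conjAut_mul p n K hδ)
  have hdeg : ∑ g, δ'.coeff g = 0 := by
    have h1 := sum_coeff_eq_zero p n K hδ
    have h2 : δ = (1 + MonoidAlgebra.single (conjAut p n K) 1) * δ' := by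
      rw [add_mul, one_mul, ← hδ']
    classical
    have h3 : ∑ g, (1 + MonoidAlgebra.single (conjAut p n K) 1 : MonoidAlgebra ℤ Gal(K/ℚ)).coeff g =
        2 := by
      simp only [MonoidAlgebra.coeff_add, Finsupp.add_apply, MonoidAlgebra.one_def,
        MonoidAlgebra.coeff_single, Finsupp.single_apply, Finset.sum_add_distrib,
        Finset.sum_ite_eq, Finset.mem_univ, if_true]
      norm_num
    rw [h2, sum_coeff_mul, h3] at h1
    omega
  refine AddMonoidHom.ext fun I => ?_
  obtain ⟨I, rfl⟩ := Additive.ofMul.surjective I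
  have h4 := tau_add_conj p n hz hp2 I
  rw [AddMonoidHom.smul_apply, AddMonoidHom.zero_apply, hδ', add_smul,
    groupRing_mul_comm _ δ', mul_smul, ← smul_add, h4, ← map_smul,
    groupRing_smul_of_fixed, hdeg, zero_smul, map_zero]
  intro g
  rw [single_smul_toUnitsModule]
  congr 2
  apply Units.ext
  exact g.commutes _

theorem mul_integralStickelberger_eq_zero (hp2 : p ≠ 2) {δ : MonoidAlgebra ℤ Gal(K/ℚ)}
    (hδ : δ • tau p n K hz = 0) : δ * integralStickelberger p n K = 0 := by
  have hcomm := IsCyclotomicExtension.isMulCommutative {p ^ (n + 1)} ℚ K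
  set c : MonoidAlgebra ℤ Gal(K/ℚ) := MonoidAlgebra.single 1 ((p ^ (n + 1) : ℕ) : ℤ) with hc
  have hcS : c ∈ stickelbergerCoeffIdeal p n K := by
    rw [mem_stickelbergerCoeffIdeal_iff, hc, cyclotomicHom_single, Int.cast_natCast,
      ZMod.natCast_self, zero_mul]
  obtain ⟨T, hT⟩ := exists_homInclusion_eq p n hz hcS
  have hδT : δ • T = 0 := by
    apply homInclusion_injective p n (L := L)
    rw [map_smul, hT, smul_smul, groupRing_mul_comm, mul_smul, hδ, smul_zero, map_zero]
  -- At a prime of degree one all conjugates are distinct, so that its divisor is `1`.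
  obtain ⟨w, hw', -, h1⟩ := exists_prime_residue_degree_one (K := K) (p ^ (n + 1))
  have hw : (p : 𝓞 K) ∉ w.asIdeal := by
    intro h
    apply hw'
    rw [Nat.cast_pow]
    exact w.asIdeal.pow_mem_of_mem h _ (Nat.succ_pos n)
  have hone : idealOrd w (Additive.ofMul (primeUnit w)) = 1 := by
    classical
    apply MonoidAlgebra.coeff_injective
    ext g
    rw [coeff_idealOrd, primeUnit, Units.val_mk0, FractionalIdeal.count_maximal,
      MonoidAlgebra.one_def, MonoidAlgebra.coeff_single, Finsupp.single_apply]
    refine if_congr ?_ rfl rfl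
    have h2 : ZMod.unitOfCoprime _ (ringChar_coprime (p ^ (n + 1)) w hw') = 1 := by
      ext
      rw [ZMod.coe_unitOfCoprime, h1, Units.val_one]
    rw [eq_galPrime_iff (p ^ (n + 1)) w hw', h2, Subgroup.zpowers_one_eq_bot, Subgroup.mem_bot,
      MulEquiv.map_eq_one_iff, eq_comm]
  have h3 := unitsOrd_apply p n hz hp2 hT w ⟨primeUnit w, primeUnit_mem_idealGroup hw⟩
  rw [hone, mul_one] at h3
  rw [← h3, ← smul_eq_mul, ← map_smul, ← AddMonoidHom.smul_apply, hδT, AddMonoidHom.zero_apply,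
    map_zero]

end Annihilator

end WeilJacobi

/-! ### The Jacobi module and the Stickelberger ideal -/

namespace WeilJacobi

section Element

variable (p : ℕ) [hp : Fact p.Prime] (n : ℕ) (K : Type*) [Field K] [NumberField K]
  [IsCyclotomicExtension {p ^ (n + 1)} ℚ K]

theorem stickelbergerElement_eq : stickelbergerElement p n K = (1 / (p ^ (n + 1) : ℚ)) •
    MonoidAlgebra.mapRingHom Gal(K/ℚ) (Int.castRingHom ℚ) (integralStickelberger p n K) := by
  set κ := IsCyclotomicExtension.Rat.galEquivZMod (p ^ (n + 1)) K with hκ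
  have hm : 1 < p ^ (n + 1) := Nat.one_lt_pow (Nat.succ_ne_zero n) hp.out.one_lt
  have : Fact (1 < p ^ (n + 1)) := ⟨hm⟩
  have hsigma : ∀ (a : ℤ) (ha : IsCoprime a (p : ℤ)),
      (κ (sigma p n K a ha) : ZMod (p ^ (n + 1))) = a := by
    intro a ha
    rw [sigma, MulEquiv.apply_symm_apply, ZMod.coe_unitOfIsCoprime]
  rw [stickelbergerElement, integralStickelberger, map_sum]
  congr 1
  symm
  refine Finset.sum_of_injOn (fun g => (κ g)⁻¹.val.val) ?_ ?_ ?_ ?_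
  · intro g _ h _ hgh
    exact κ.injective (inv_injective (Units.ext (ZMod.val_injective _ hgh)))
  · intro g _
    have hne : ((κ g)⁻¹ : (ZMod (p ^ (n + 1)))ˣ).val ≠ 0 := Units.ne_zero _
    exact Finset.mem_coe.2 (Finset.mem_Icc.2
      ⟨Nat.pos_of_ne_zero fun h => hne ((ZMod.val_eq_zero _).1 h), (ZMod.val_lt _).le⟩)
  · intro a ha hna
    refine dif_neg fun hcop => hna ⟨(sigma p n K a hcop)⁻¹, Finset.mem_coe.2 (Finset.mem_univ _), ?_⟩
    have hlt : a < p ^ (n + 1) := by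
      refine lt_of_le_of_ne (Finset.mem_Icc.1 ha).2 ?_
      rintro rfl
      rw [Nat.isCoprime_iff_coprime, Nat.coprime_pow_left_iff (Nat.succ_pos n), Nat.coprime_self]
        at hcop
      exact hp.out.ne_one hcop
    dsimp only
    rw [map_inv, inv_inv, hsigma, Int.cast_natCast, ZMod.val_natCast_of_lt hlt]
  · intro g _
    have hcop : IsCoprime (((κ g)⁻¹.val.val : ℕ) : ℤ) (p : ℤ) := by
      rw [Nat.isCoprime_iff_coprime]
      exact Nat.Coprime.coprime_dvd_right (dvd_pow_self p (Nat.succ_ne_zero n))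
        (ZMod.val_coe_unit_coprime _)
    have hg : (sigma p n K _ hcop)⁻¹ = g := by
      apply κ.injective
      apply inv_injective
      rw [map_inv, inv_inv]
      ext
      rw [hsigma, Int.cast_natCast, ZMod.natCast_zmod_val]
    rw [dif_pos hcop, hg, MonoidAlgebra.mapRingHom_single]
    congr 1

theorem smul_stickelbergerElement_eq_zero_iff (δ : MonoidAlgebra ℤ Gal(K/ℚ)) :
    δ • stickelbergerElement p n K = 0 ↔ δ * integralStickelberger p n K = 0 := by
  have h1 : δ • stickelbergerElement p n K =
      MonoidAlgebra.mapRingHom Gal(K/ℚ) (Int.castRingHom ℚ) δ * stickelbergerElement p n K := rfl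
  have hm : (1 / (p ^ (n + 1) : ℚ)) ≠ 0 :=
    one_div_ne_zero (pow_ne_zero _ (Nat.cast_ne_zero.2 hp.out.ne_zero))
  have hinj : Function.Injective (MonoidAlgebra.mapRingHom Gal(K/ℚ) (Int.castRingHom ℚ)) := by
    rw [injective_iff_map_eq_zero]
    intro x hx
    apply MonoidAlgebra.coeff_injective
    ext g
    have := congrArg (fun y : MonoidAlgebra ℚ Gal(K/ℚ) => y.coeff g) hx
    simpa using this
  rw [h1, stickelbergerElement_eq, mul_smul_comm, ← map_mul, smul_eq_zero_iff_right hm,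
    map_eq_zero_iff _ hinj]

end Element

section Isomorphism

variable (p : ℕ) [hp : Fact p.Prime] (n : ℕ) {K : Type*} [Field K] [NumberField K]
  [IsCyclotomicExtension {p ^ (n + 1)} ℚ K] {L : Type*} [Field L] [CharZero L] [Algebra K L]
  {z : ℕ → L} (hz : ∀ ℓ : ℕ, ℓ.Prime → ℓ ≠ p → IsPrimitiveRoot (z ℓ) ℓ)
  [IsCyclotomicExtension {m : ℕ | m.Coprime p} K L]

theorem exists_of_mem_jacobiModule {f : HomSmall p K} (hf : f ∈ jacobiModule p n K hz) :
    ∃ δ : MonoidAlgebra ℤ Gal(K/ℚ), homInclusion p n K L f = δ • tau p n K hz := by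
  obtain ⟨δ, hδ⟩ := Submodule.mem_span_singleton.1 hf.2
  exact ⟨δ, hδ.symm⟩

theorem mem_jacobiModule {f : HomSmall p K} {δ : MonoidAlgebra ℤ Gal(K/ℚ)}
    (hf : homInclusion p n K L f = δ • tau p n K hz) : f ∈ jacobiModule p n K hz :=
  ⟨mem_equivariantHom p n hz hf, Submodule.mem_span_singleton.2 ⟨δ, hf.symm⟩⟩

variable (K)

/-- The map `δ ↦ δ τ` on `S'`. -/
noncomputable def coeffToHom :
    stickelbergerCoeffIdeal p n K →ₗ[MonoidAlgebra ℤ Gal(K/ℚ)] HomBig p n K L :=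
  (LinearMap.toSpanSingleton _ _ (tau p n K hz)).comp (Submodule.subtype _)

/-- The map `δ ↦ δ θ` on `S'`. -/
noncomputable def coeffToStickelberger :
    stickelbergerCoeffIdeal p n K →ₗ[MonoidAlgebra ℤ Gal(K/ℚ)] MonoidAlgebra ℚ Gal(K/ℚ) :=
  (LinearMap.toSpanSingleton _ _ (stickelbergerElement p n K)).comp (Submodule.subtype _)

theorem ker_coeffToHom (hp2 : p ≠ 2) :
    LinearMap.ker (coeffToHom p n K hz) = LinearMap.ker (coeffToStickelberger p n K) := by
  ext δ
  rw [LinearMap.mem_ker, LinearMap.mem_ker]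
  change (δ : MonoidAlgebra ℤ Gal(K/ℚ)) • tau p n K hz = 0 ↔
    (δ : MonoidAlgebra ℤ Gal(K/ℚ)) • stickelbergerElement p n K = 0
  rw [smul_stickelbergerElement_eq_zero_iff]
  exact ⟨mul_integralStickelberger_eq_zero p n hz hp2, smul_tau_eq_zero p n hz hp2⟩

theorem range_coeffToStickelberger :
    LinearMap.range (coeffToStickelberger p n K) = stickelbergerIdeal p n K := by
  rw [coeffToStickelberger, LinearMap.range_comp, Submodule.range_subtype]
  rfl

theorem homInclusion_mem_range (f : jacobiModule p n K hz) :
    homInclusion p n K L f ∈ LinearMap.range (coeffToHom p n K hz) := by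
  obtain ⟨δ, hδ⟩ := exists_of_mem_jacobiModule p n hz f.2
  exact ⟨⟨δ, mem_stickelbergerCoeffIdeal_of_homInclusion_eq p n hz hδ⟩, hδ.symm⟩

/-- The Jacobi module is `S' τ`. -/
noncomputable def jacobiModuleEquivRange :
    jacobiModule p n K hz ≃ₗ[MonoidAlgebra ℤ Gal(K/ℚ)] LinearMap.range (coeffToHom p n K hz) :=
  LinearEquiv.ofBijective
    (((homInclusion p n K L).comp (Submodule.subtype _)).codRestrict _
      (homInclusion_mem_range p n K hz)) (by
    constructor
    · intro f g h
      exact Subtype.ext (homInclusion_injective p n (congrArg Subtype.val h))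
    · rintro ⟨_, δ, rfl⟩
      obtain ⟨f, hf⟩ := exists_homInclusion_eq p n hz δ.2
      exact ⟨⟨f, mem_jacobiModule p n hz hf⟩, Subtype.ext hf⟩)

/-- The isomorphism `δ τ ↦ δ θ` between the Jacobi module and the Stickelberger ideal. -/
noncomputable def jacobiModuleEquiv (hp2 : p ≠ 2) :
    jacobiModule p n K hz ≃ₗ[MonoidAlgebra ℤ Gal(K/ℚ)] stickelbergerIdeal p n K :=
  (jacobiModuleEquivRange p n K hz).trans <|
    (coeffToHom p n K hz).quotKerEquivRange.symm.trans <|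
      (Submodule.quotEquivOfEq _ _ (ker_coeffToHom p n K hz hp2)).trans <|
        (coeffToStickelberger p n K).quotKerEquivRange.trans <|
          LinearEquiv.ofEq _ _ (range_coeffToStickelberger p n K)

theorem jacobiModuleEquiv_apply (hp2 : p ≠ 2) {δ : MonoidAlgebra ℤ Gal(K/ℚ)}
    {f : jacobiModule p n K hz} (hf : homInclusion p n K L f = δ • tau p n K hz) :
    (jacobiModuleEquiv p n K hz hp2 f : MonoidAlgebra ℚ Gal(K/ℚ)) =
      δ • stickelbergerElement p n K := by
  have hδ := mem_stickelbergerCoeffIdeal_of_homInclusion_eq p n hz hf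
  have h1 : jacobiModuleEquivRange p n K hz f =
      (coeffToHom p n K hz).quotKerEquivRange (Submodule.Quotient.mk ⟨δ, hδ⟩) := Subtype.ext hf
  rw [jacobiModuleEquiv, LinearEquiv.trans_apply, h1, LinearEquiv.trans_apply,
    LinearEquiv.symm_apply_apply, LinearEquiv.trans_apply, Submodule.quotEquivOfEq_mk]
  rfl

end Isomorphism

end WeilJacobi

theorem mainTheorem5 (p : ℕ) [Fact p.Prime] (hp : p ≠ 2) (n : ℕ)
    (K L : Type*) [Field K] [NumberField K] [IsCyclotomicExtension {p ^ (n + 1)} ℚ K]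
    [Field L] [CharZero L] [Algebra K L] [IsCyclotomicExtension {m : ℕ | m.Coprime p} K L]
    (z : ℕ → L) (hz : ∀ ℓ : ℕ, ℓ.Prime → ℓ ≠ p → IsPrimitiveRoot (z ℓ) ℓ) :
    jacobiModule p n K hz ≤ weilModule p n K ∧
    (∀ δ ∈ stickelbergerCoeffIdeal p n K, ∃ f : jacobiModule p n K hz,
      homInclusion p n K L f = δ • tau p n K hz) ∧
    ∃ e : jacobiModule p n K hz ≃ₗ[MonoidAlgebra ℤ Gal(K/ℚ)] stickelbergerIdeal p n K,
      ∀ (δ : MonoidAlgebra ℤ Gal(K/ℚ)) (f : jacobiModule p n K hz),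
        homInclusion p n K L f = δ • tau p n K hz →
          (e f : MonoidAlgebra ℚ Gal(K/ℚ)) = δ • stickelbergerElement p n K := by
  refine ⟨fun f hf => ?_, fun δ hδ => ?_, jacobiModuleEquiv p n K hz hp, fun δ f hf => ?_⟩
  · obtain ⟨δ, hδ⟩ := exists_of_mem_jacobiModule p n hz hf
    exact mem_weilModule p n hz hp hδ
  · obtain ⟨f, hf⟩ := exists_homInclusion_eq p n hz hδ
    exact ⟨⟨f, mem_jacobiModule p n hz hf⟩, hf⟩
  · exact jacobiModuleEquiv_apply p n K hz hp hf
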